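/- Let $\Gamma$ be a graph without loops and multiple edges (not necessarily finite) with vertex set $I$, let $\Bbbk$ be a field, and let $\nu=\sum_{i\in I}\nu_i\, i\in\mathbb N[I]$, $m=|\nu|=\sum_i\nu_i$. Put $i\cdot i=2$, $i\cdot j=-1$ if $i,j$ are joined by an edge, and $i\cdot j=0$ otherwise. Let $\mathrm{Seq}(\nu)$ be the set of sequences $\mathbf i=i_1\dots i_m$ of vertices in which each $i\in I$ occurs $\nu_i$ times, and let $s_k$ act on it by exchanging the $k$-th and $(k+1)$-st entries. Let $R(\nu)$ be the associative unital $\Bbbk$-algebra generated by $1_{\mathbf i}$, $x_{k,\mathbf i}$ $(1\le k\le m)$, $\delta_{k,\mathbf i}$ $(1\le k<m)$, for $\mathbf i\in\mathrm{Seq}(\nu)$, subject to the following relations. The $1_{\mathbf i}$ are orthogonal idempotents with sum $1$; $x_{k,\mathbf i}=1_{\mathbf i}x_{k,\mathbf i}1_{\mathbf i}$; $\delta_{k,\mathbf i}=1_{s_k\mathbf i}\delta_{k,\mathbf i}1_{\mathbf i}$. Omitting the sequence from $x_k,\delta_k$ where it is determined by the factor $1_{\mathbf i}$ on the right: $x_kx_l1_{\mathbf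 i}=x_lx_k1_{\mathbf i}$; $\delta_kx_l1_{\mathbf i}=x_l\delta_k1_{\mathbf i}$ for $l\ne k,k+1$; $\delta_k\delta_l1_{\mathbf i}=\delta_l\delta_k1_{\mathbf i}$ for $|k-l|>1$; $\delta_k^2 1_{\mathbf i}$ equals $0$, $1_{\mathbf i}$ or $(x_k+x_{k+1})1_{\mathbf i}$ according as $i_k=i_{k+1}$, $i_k\cdot i_{k+1}=0$ or $i_k\cdot i_{k+1}=-1$; $(\delta_kx_k-x_{k+1}\delta_k)1_{\mathbf i}=(x_k\delta_k-\delta_kx_{k+1})1_{\mathbf i}$, and both equal $1_{\mathbf i}$ if $i_k=i_{k+1}$ and $0$ otherwise; $(\delta_k\delta_{k+1}\delta_k-\delta_{k+1}\delta_k\delta_{k+1})1_{\mathbf i}$ equals $1_{\mathbf i}$ if $i_k=i_{k+2}$ and $i_k\cdot i_{k+1}=-1$, and $0$ otherwise. It is $\mathbb Z$-graded by $\deg 1_{\mathbf i}=0$, $\deg x_{k,\mathbf i}=2$, $\deg\delta_{k,\mathbf i}=-\,i_k\cdot i_{k+1}$. Let $G_0(R(\nu))$ be the Grothendieck group of the category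 of finite-dimensional graded left $R(\nu)$-modules with grading-preserving homomorphisms. It is a $\mathbb Z[q,q^{-1}]$-module, where $q^a[M]=[M\{a\}]$ and $M\{a\}$ is $M$ with its grading shifted up by $a$, so $M\{a\}_n=M_{n-a}$. For such $M$ put $$\mathrm{ch}(M)=\sum_{\mathbf i\in\mathrm{Seq}(\nu)}\mathrm{gdim}(1_{\mathbf i}M)\cdot\mathbf i,\qquad \mathrm{gdim}(V)=\sum_{n\in\mathbb Z}q^n\dim_{\Bbbk}V_n ,$$ an element of the free $\mathbb Z[q,q^{-1}]$-module $\mathbb Z[q,q^{-1}]\mathrm{Seq}(\nu)$ with basis $\mathrm{Seq}(\nu)$. This induces a $\mathbb Z[q,q^{-1}]$-linear map on $G_0(R(\nu))$. **Theorem.** The character map $\mathrm{ch}\colon G_0(R(\nu))\to\mathbb Z[q,q^{-1}]\mathrm{Seq}(\nu)$ is injective. Equivalently, the characters of simple finite-dimensional graded $R(\nu)$-modules, one from each class up to isomorphism and grading shift, are linearly independent over $\mathbb Z[q,q^{-1}]$. -/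

import Mathlib

open scoped LaurentPolynomial

universe u v

noncomputable section

namespace KLR

/-! ### Sequences of vertices -/

section Sequences

variable {I : Type v}

open Classical in
/-- The Cartan form of a graph on vertices: `i · i = 2`, `i · j = -1` if `i` and `j` are joined
by an edge, and `i · j = 0` otherwise. -/
def cartan (Γ : SimpleGraph I) (i j : I) : ℤ :=
  if i = j then 2 else if Γ.Adj i j then -1 else 0

/-- `Seq ν`: the sequences `i_1 … i_m` of vertices, `m = |ν|`, in which each vertex `a` appears
`ν a` times. Positions are numbered from `0`. -/
def Seq (ν : I →₀ ℕ) : Type v :=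
  {i : Fin ν.degree → I // ∀ a : I, Nat.card {k : Fin ν.degree // i k = a} = ν a}

lemma Seq.mem_support {ν : I →₀ ℕ} (i : Seq ν) (k : Fin ν.degree) : i.1 k ∈ ν.support := by
  rw [Finsupp.mem_support_iff, ← i.2 (i.1 k)]
  have : Nonempty {l : Fin ν.degree // i.1 l = i.1 k} := ⟨⟨k, rfl⟩⟩
  exact Nat.card_pos.ne'

instance (ν : I →₀ ℕ) : Finite (Seq ν) := by
  let f : Seq ν → (Fin ν.degree → ν.support) := fun i k => ⟨i.1 k, i.mem_support k⟩
  refine Finite.of_injective f fun i j h => Subtype.ext (funext fun k => ?_)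
  exact congrArg Subtype.val (congrFun h k)

instance (ν : I →₀ ℕ) : Fintype (Seq ν) := Fintype.ofFinite _

/-- The action of the transposition of the neighbouring positions `a`, `a + 1` on sequences. -/
def Seq.swap {ν : I →₀ ℕ} (a : ℕ) (h : a + 1 < ν.degree) (i : Seq ν) : Seq ν :=
  ⟨fun k => i.1 (Equiv.swap ⟨a, (Nat.lt_succ_self a).trans h⟩ ⟨a + 1, h⟩ k), fun c => by
    rw [← i.2 c]
    exact Nat.card_congr ((Equiv.swap _ _).subtypeEquiv fun k => Iff.rfl)⟩

/-- The label of a sequence in position `a`. -/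
def Seq.at {ν : I →₀ ℕ} (i : Seq ν) (a : ℕ) (h : a < ν.degree) : I := i.1 ⟨a, h⟩

lemma Seq.swap_at_left {ν : I →₀ ℕ} (i : Seq ν) (a : ℕ) (h : a + 1 < ν.degree)
    (h' : a < ν.degree) : (i.swap a h).at a h' = i.at (a + 1) h := by
  simp [Seq.swap, Seq.at]

lemma Seq.swap_at_right {ν : I →₀ ℕ} (i : Seq ν) (a : ℕ) (h : a + 1 < ν.degree) :
    (i.swap a h).at (a + 1) h = i.at a (Nat.lt_of_succ_lt h) := by
  simp [Seq.swap, Seq.at]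

lemma Seq.swap_at_of_ne {ν : I →₀ ℕ} (i : Seq ν) (a b : ℕ) (h : a + 1 < ν.degree)
    (hb : b < ν.degree) (h1 : b ≠ a) (h2 : b ≠ a + 1) : (i.swap a h).at b hb = i.at b hb := by
  have : Equiv.swap (⟨a, (Nat.lt_succ_self a).trans h⟩ : Fin ν.degree) ⟨a + 1, h⟩ ⟨b, hb⟩
      = ⟨b, hb⟩ := Equiv.swap_apply_of_ne_of_ne (by simpa [Fin.ext_iff]) (by simpa [Fin.ext_iff])
  simp [Seq.swap, Seq.at, this]

end Sequences

/-! ### The ring `R(ν)` over a field -/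

/-- The elementary diagrams: `idem i` consists of vertical strands labelled by `i` (the idempotent
`1_i`), `dot a h i` is `1_i` with a dot on the strand in position `a` (the element `x_{a,i}`), and
`cross a h i` is the crossing of the strands in positions `a`, `a + 1` with bottom sequence `i` and
top sequence `i.swap a h` (the element `δ_{a,i}`). -/
inductive Gen {I : Type v} (ν : I →₀ ℕ) : Type v
  | idem (i : Seq ν) : Gen ν
  | dot (a : ℕ) (h : a < ν.degree) (i : Seq ν) : Gen ν
  | cross (a : ℕ) (h : a + 1 < ν.degree) (i : Seq ν) : Gen ν

section Algebra

variable (k : Type u) [Field k] {I : Type v} (Γ : SimpleGraph I) (ν : I →₀ ℕ)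

namespace Free

variable {ν}

/-- `1_i` in the free algebra. -/
def E (i : Seq ν) : FreeAlgebra k (Gen ν) := FreeAlgebra.ι k (Gen.idem i)

/-- `x_{a,i}` in the free algebra. -/
def X (a : ℕ) (h : a < ν.degree) (i : Seq ν) : FreeAlgebra k (Gen ν) :=
  FreeAlgebra.ι k (Gen.dot a h i)

/-- `δ_{a,i}` in the free algebra. -/
def D (a : ℕ) (h : a + 1 < ν.degree) (i : Seq ν) : FreeAlgebra k (Gen ν) :=
  FreeAlgebra.ι k (Gen.cross a h i)

end Free

open Free

/-- The defining relations of `R(ν)`. A product `x * y` is the diagram `x` put on top of `y`. -/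
inductive Rel : FreeAlgebra k (Gen ν) → FreeAlgebra k (Gen ν) → Prop
  -- concatenation of diagrams: the `1_i` are orthogonal idempotents with sum `1`,
  -- and the other elementary diagrams have the prescribed bottom and top
  | idem_mul_self (i : Seq ν) : Rel (E k i * E k i) (E k i)
  | idem_mul_of_ne (i j : Seq ν) (hij : i ≠ j) : Rel (E k i * E k j) 0
  | sum_idem : Rel (∑ i : Seq ν, E k i) 1
  | dot_mul_idem (a : ℕ) (h : a < ν.degree) (i : Seq ν) : Rel (X k a h i * E k i) (X k a h i)
  | idem_mul_dot (a : ℕ) (h : a < ν.degree) (i : Seq ν) : Rel (E k i * X k a h i) (X k a h i)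
  | cross_mul_idem (a : ℕ) (h : a + 1 < ν.degree) (i : Seq ν) :
      Rel (D k a h i * E k i) (D k a h i)
  | idem_mul_cross (a : ℕ) (h : a + 1 < ν.degree) (i : Seq ν) :
      Rel (E k (i.swap a h) * D k a h i) (D k a h i)
  -- isotopies of diagrams: distant dots and crossings commute
  | dot_dot (a b : ℕ) (ha : a < ν.degree) (hb : b < ν.degree) (i : Seq ν) :
      Rel (X k a ha i * X k b hb i) (X k b hb i * X k a ha i)
  | cross_dot (a b : ℕ) (ha : a + 1 < ν.degree) (hb : b < ν.degree) (h1 : b ≠ a)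
      (h2 : b ≠ a + 1) (i : Seq ν) :
      Rel (D k a ha i * X k b hb i) (X k b hb (i.swap a ha) * D k a ha i)
  | cross_cross (a b : ℕ) (ha : a + 1 < ν.degree) (hb : b + 1 < ν.degree) (hab : a + 1 < b)
      (i : Seq ν) :
      Rel (D k a ha (i.swap b hb) * D k b hb i) (D k b hb (i.swap a ha) * D k a ha i)
  -- double crossings
  | sq_of_eq (a : ℕ) (h : a + 1 < ν.degree) (i : Seq ν)
      (hi : i.at a (Nat.lt_of_succ_lt h) = i.at (a + 1) h) :
      Rel (D k a h (i.swap a h) * D k a h i) 0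
  | sq_of_not_adj (a : ℕ) (h : a + 1 < ν.degree) (i : Seq ν)
      (hi : i.at a (Nat.lt_of_succ_lt h) ≠ i.at (a + 1) h)
      (hadj : ¬ Γ.Adj (i.at a (Nat.lt_of_succ_lt h)) (i.at (a + 1) h)) :
      Rel (D k a h (i.swap a h) * D k a h i) (E k i)
  | sq_of_adj (a : ℕ) (h : a + 1 < ν.degree) (i : Seq ν)
      (hadj : Γ.Adj (i.at a (Nat.lt_of_succ_lt h)) (i.at (a + 1) h)) :
      Rel (D k a h (i.swap a h) * D k a h i)
        (X k a (Nat.lt_of_succ_lt h) i + X k (a + 1) h i)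
  -- dots sliding through crossings
  | slide_left_of_ne (a : ℕ) (h : a + 1 < ν.degree) (i : Seq ν)
      (hi : i.at a (Nat.lt_of_succ_lt h) ≠ i.at (a + 1) h) :
      Rel (D k a h i * X k a (Nat.lt_of_succ_lt h) i) (X k (a + 1) h (i.swap a h) * D k a h i)
  | slide_right_of_ne (a : ℕ) (h : a + 1 < ν.degree) (i : Seq ν)
      (hi : i.at a (Nat.lt_of_succ_lt h) ≠ i.at (a + 1) h) :
      Rel (D k a h i * X k (a + 1) h i) (X k a (Nat.lt_of_succ_lt h) (i.swap a h) * D k a h i)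
  | slide_left_of_eq (a : ℕ) (h : a + 1 < ν.degree) (i : Seq ν)
      (hi : i.at a (Nat.lt_of_succ_lt h) = i.at (a + 1) h) :
      Rel (D k a h i * X k a (Nat.lt_of_succ_lt h) i
        - X k (a + 1) h (i.swap a h) * D k a h i) (E k i)
  | slide_right_of_eq (a : ℕ) (h : a + 1 < ν.degree) (i : Seq ν)
      (hi : i.at a (Nat.lt_of_succ_lt h) = i.at (a + 1) h) :
      Rel (X k a (Nat.lt_of_succ_lt h) (i.swap a h) * D k a h i
        - D k a h i * X k (a + 1) h i) (E k i)
  -- triple crossings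
  | braid (a : ℕ) (h : a + 1 + 1 < ν.degree) (i : Seq ν)
      (hi : ¬ (i.at a (Nat.lt_of_succ_lt (Nat.lt_of_succ_lt h)) = i.at (a + 1 + 1) h ∧
        Γ.Adj (i.at a (Nat.lt_of_succ_lt (Nat.lt_of_succ_lt h)))
          (i.at (a + 1) (Nat.lt_of_succ_lt h)))) :
      Rel (D k a (Nat.lt_of_succ_lt h) ((i.swap a (Nat.lt_of_succ_lt h)).swap (a + 1) h)
          * D k (a + 1) h (i.swap a (Nat.lt_of_succ_lt h)) * D k a (Nat.lt_of_succ_lt h) i)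
        (D k (a + 1) h ((i.swap (a + 1) h).swap a (Nat.lt_of_succ_lt h))
          * D k a (Nat.lt_of_succ_lt h) (i.swap (a + 1) h) * D k (a + 1) h i)
  | braid_of_adj (a : ℕ) (h : a + 1 + 1 < ν.degree) (i : Seq ν)
      (hi : i.at a (Nat.lt_of_succ_lt (Nat.lt_of_succ_lt h)) = i.at (a + 1 + 1) h)
      (hadj : Γ.Adj (i.at a (Nat.lt_of_succ_lt (Nat.lt_of_succ_lt h)))
          (i.at (a + 1) (Nat.lt_of_succ_lt h))) :
      Rel (D k a (Nat.lt_of_succ_lt h) ((i.swap a (Nat.lt_of_succ_lt h)).swap (a + 1) h)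
          * D k (a + 1) h (i.swap a (Nat.lt_of_succ_lt h)) * D k a (Nat.lt_of_succ_lt h) i
        - D k (a + 1) h ((i.swap (a + 1) h).swap a (Nat.lt_of_succ_lt h))
          * D k a (Nat.lt_of_succ_lt h) (i.swap (a + 1) h) * D k (a + 1) h i)
        (E k i)

/-- The ring `R(ν)` over the field `k`. -/
abbrev R : Type (max u v) := RingQuot (Rel k Γ ν)

/-- The class of an elementary diagram in `R(ν)`. -/
def gen (g : Gen ν) : R k Γ ν := RingQuot.mkAlgHom k (Rel k Γ ν) (FreeAlgebra.ι k g)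

variable {ν} in
/-- The idempotent `1_i` of `R(ν)`. -/
def idem (i : Seq ν) : R k Γ ν := gen k Γ ν (Gen.idem i)

variable {ν} in
/-- The degree of an elementary diagram: a dot has degree `2`, the crossing of strands labelled `i`
and `j` has degree `- i · j`. -/
def Gen.deg : Gen ν → ℤ
  | Gen.idem _ => 0
  | Gen.dot _ _ _ => 2
  | Gen.cross a h i => - cartan Γ (i.at a (Nat.lt_of_succ_lt h)) (i.at (a + 1) h)

/-- The homogeneous part of degree `n` of `R(ν)`: the span of the products of elementary diagrams
of total degree `n`. -/
def grading (n : ℤ) : Submodule k (R k Γ ν) :=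
  Submodule.span k {x | ∃ w : List (Gen ν), (w.map (Gen.deg Γ)).sum = n ∧
    x = (w.map (gen k Γ ν)).prod}

instance : SetLike.GradedMonoid (grading k Γ ν) where
  one_mem := Submodule.subset_span ⟨[], by simp, by simp⟩
  mul_mem := by
    intro m n x y hx hy
    have : grading k Γ ν m * grading k Γ ν n ≤ grading k Γ ν (m + n) := by
      rw [grading, grading, Submodule.span_mul_span]
      refine Submodule.span_le.2 ?_
      rintro _ ⟨_, ⟨w, rfl, rfl⟩, _, ⟨w', rfl, rfl⟩, rfl⟩
      exact Submodule.subset_span ⟨w ++ w', by simp, by simp⟩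
    exact this (Submodule.mul_mem_mul hx hy)

/-- The homogeneous part of degree `n` of the free algebra on the elementary diagrams. -/
def freeGrading (n : ℤ) : Submodule k (FreeAlgebra k (Gen ν)) :=
  Submodule.span k {x | ∃ w : List (Gen ν), (w.map (Gen.deg Γ)).sum = n ∧
    x = (w.map (FreeAlgebra.ι k)).prod}

lemma freeGrading_one : (1 : FreeAlgebra k (Gen ν)) ∈ freeGrading k Γ ν 0 :=
  Submodule.subset_span ⟨[], by simp, by simp⟩

lemma freeGrading_mul {m n : ℤ} {x y : FreeAlgebra k (Gen ν)} (hx : x ∈ freeGrading k Γ ν m)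
    (hy : y ∈ freeGrading k Γ ν n) : x * y ∈ freeGrading k Γ ν (m + n) := by
  have : freeGrading k Γ ν m * freeGrading k Γ ν n ≤ freeGrading k Γ ν (m + n) := by
    rw [freeGrading, freeGrading, Submodule.span_mul_span]
    refine Submodule.span_le.2 ?_
    rintro _ ⟨_, ⟨w, rfl, rfl⟩, _, ⟨w', rfl, rfl⟩, rfl⟩
    exact Submodule.subset_span ⟨w ++ w', by simp, by simp⟩
  exact this (Submodule.mul_mem_mul hx hy)

lemma freeGrading_gen (g : Gen ν) : FreeAlgebra.ι k g ∈ freeGrading k Γ ν (g.deg Γ) :=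
  Submodule.subset_span ⟨[g], by simp, by simp⟩

variable {ν} in
lemma E_mem (i : Seq ν) : E k i ∈ freeGrading k Γ ν 0 :=
  freeGrading_gen k Γ ν (Gen.idem i)

variable {ν} in
lemma X_mem (a : ℕ) (h : a < ν.degree) (i : Seq ν) : X k a h i ∈ freeGrading k Γ ν 2 :=
  freeGrading_gen k Γ ν (Gen.dot a h i)

variable {ν} in
lemma D_mem (a : ℕ) (h : a + 1 < ν.degree) (i : Seq ν) : D k a h i ∈ freeGrading k Γ ν
    (- cartan Γ (i.at a (Nat.lt_of_succ_lt h)) (i.at (a + 1) h)) :=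
  freeGrading_gen k Γ ν (Gen.cross a h i)

lemma cartan_comm (i j : I) : cartan Γ i j = cartan Γ j i := by
  unfold cartan
  rw [eq_comm (a := i) (b := j), Γ.adj_comm i j]

variable {k Γ ν} in
lemma freeGrading_cast {m n : ℤ} {x : FreeAlgebra k (Gen ν)} (hx : x ∈ freeGrading k Γ ν m)
    (h : m = n) : x ∈ freeGrading k Γ ν n := h ▸ hx

/-- The defining relations are homogeneous. -/
lemma Rel.homogeneous {x y : FreeAlgebra k (Gen ν)} (h : Rel k Γ ν x y) :
    ∃ n, x ∈ freeGrading k Γ ν n ∧ y ∈ freeGrading k Γ ν n := by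
  have hc := cartan_comm Γ
  have mul {m n : ℤ} {x y : FreeAlgebra k (Gen ν)} := @freeGrading_mul k _ _ Γ ν m n x y
  cases h with
  | idem_mul_self i => exact ⟨0, freeGrading_cast (mul (E_mem k Γ i) (E_mem k Γ i)) (add_zero 0), E_mem k Γ i⟩
  | idem_mul_of_ne i j hij => exact ⟨_, mul (E_mem k Γ i) (E_mem k Γ j), zero_mem _⟩
  | sum_idem => exact ⟨0, sum_mem fun i _ => E_mem k Γ i, freeGrading_one k Γ ν⟩
  | dot_mul_idem a h i =>
    exact ⟨2, freeGrading_cast (mul (X_mem k Γ a h i) (E_mem k Γ i)) (add_zero 2), X_mem k Γ a h i⟩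
  | idem_mul_dot a h i =>
    exact ⟨2, freeGrading_cast (mul (E_mem k Γ i) (X_mem k Γ a h i)) (zero_add 2), X_mem k Γ a h i⟩
  | cross_mul_idem a h i =>
    exact ⟨_, freeGrading_cast (mul (D_mem k Γ a h i) (E_mem k Γ i)) (add_zero _),
      D_mem k Γ a h i⟩
  | idem_mul_cross a h i =>
    exact ⟨_, freeGrading_cast (mul (E_mem k Γ _) (D_mem k Γ a h i)) (zero_add _),
      D_mem k Γ a h i⟩
  | dot_dot a b ha hb i =>
    exact ⟨_, mul (X_mem k Γ a ha i) (X_mem k Γ b hb i), mul (X_mem k Γ b hb i) (X_mem k Γ a ha i)⟩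
  | cross_dot a b ha hb h1 h2 i =>
    exact ⟨_, mul (D_mem k Γ a ha i) (X_mem k Γ b hb i),
      freeGrading_cast (mul (X_mem k Γ b hb _) (D_mem k Γ a ha i)) (add_comm _ _)⟩
  | cross_cross a b ha hb hab i =>
    refine ⟨_, mul (D_mem k Γ a ha _) (D_mem k Γ b hb i),
      freeGrading_cast (mul (D_mem k Γ b hb _) (D_mem k Γ a ha i)) ?_⟩
    rw [Seq.swap_at_of_ne _ _ _ _ _ (by omega) (by omega),
      Seq.swap_at_of_ne _ _ _ _ _ (by omega) (by omega),
      Seq.swap_at_of_ne _ _ _ _ _ (by omega) (by omega),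
      Seq.swap_at_of_ne _ _ _ _ _ (by omega) (by omega), add_comm]
  | sq_of_eq a h i hi => exact ⟨_, mul (D_mem k Γ a h _) (D_mem k Γ a h i), zero_mem _⟩
  | sq_of_not_adj a h i hi hadj =>
    refine ⟨0, freeGrading_cast (mul (D_mem k Γ a h _) (D_mem k Γ a h i)) ?_, E_mem k Γ i⟩
    rw [Seq.swap_at_left, Seq.swap_at_right, hc (i.at (a + 1) _)]
    simp [cartan, hi, hadj]
  | sq_of_adj a h i hadj =>
    refine ⟨2, freeGrading_cast (mul (D_mem k Γ a h _) (D_mem k Γ a h i)) ?_,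
      add_mem (X_mem k Γ _ _ i) (X_mem k Γ _ _ i)⟩
    rw [Seq.swap_at_left, Seq.swap_at_right, hc (i.at (a + 1) _)]
    simp [cartan, hadj.ne, hadj]
  | slide_left_of_ne a h i hi =>
    exact ⟨_, mul (D_mem k Γ a h i) (X_mem k Γ _ _ i),
      freeGrading_cast (mul (X_mem k Γ _ _ _) (D_mem k Γ a h i)) (add_comm _ _)⟩
  | slide_right_of_ne a h i hi =>
    exact ⟨_, mul (D_mem k Γ a h i) (X_mem k Γ _ _ i),
      freeGrading_cast (mul (X_mem k Γ _ _ _) (D_mem k Γ a h i)) (add_comm _ _)⟩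
  | slide_left_of_eq a h i hi =>
    refine ⟨0, sub_mem (freeGrading_cast (mul (D_mem k Γ a h i) (X_mem k Γ _ _ i)) ?_)
      (freeGrading_cast (mul (X_mem k Γ _ _ _) (D_mem k Γ a h i)) ?_), E_mem k Γ i⟩ <;>
    simp [cartan, hi]
  | slide_right_of_eq a h i hi =>
    refine ⟨0, sub_mem (freeGrading_cast (mul (X_mem k Γ _ _ _) (D_mem k Γ a h i)) ?_)
      (freeGrading_cast (mul (D_mem k Γ a h i) (X_mem k Γ _ _ i)) ?_), E_mem k Γ i⟩ <;>
    simp [cartan, hi]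
  | braid a h i hi =>
    refine ⟨_, mul (mul (D_mem k Γ a _ _) (D_mem k Γ (a + 1) _ _)) (D_mem k Γ a _ i),
      freeGrading_cast (mul (mul (D_mem k Γ (a + 1) _ _) (D_mem k Γ a _ _))
        (D_mem k Γ (a + 1) _ i)) ?_⟩
    simp only [Seq.swap_at_left, Seq.swap_at_right, Seq.swap_at_of_ne _ a (a + 1 + 1) _ _
      (by omega) (by omega), Seq.swap_at_of_ne _ (a + 1) a _ _ (by omega) (by omega)]
    ring
  | braid_of_adj a h i hi hadj =>
    refine ⟨0, sub_mem (freeGrading_cast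
      (mul (mul (D_mem k Γ a _ _) (D_mem k Γ (a + 1) _ _)) (D_mem k Γ a _ i)) ?_)
      (freeGrading_cast (mul (mul (D_mem k Γ (a + 1) _ _) (D_mem k Γ a _ _))
        (D_mem k Γ (a + 1) _ i)) ?_), E_mem k Γ i⟩ <;>
    · simp only [Seq.swap_at_left, Seq.swap_at_right, Seq.swap_at_of_ne _ a (a + 1 + 1) _ _
        (by omega) (by omega), Seq.swap_at_of_ne _ (a + 1) a _ _ (by omega) (by omega),
        ← hi]
      simp [cartan, hadj.ne, hadj.ne', hadj, hadj.symm]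

open DirectSum in
/-- The map from the free algebra to the direct sum of the homogeneous parts of `R(ν)`. -/
def freeDecompose : FreeAlgebra k (Gen ν) →ₐ[k] ⨁ n, grading k Γ ν n :=
  FreeAlgebra.lift k fun g => DirectSum.of (fun n => grading k Γ ν n) (g.deg Γ)
    ⟨gen k Γ ν g, Submodule.subset_span ⟨[g], by simp, by simp⟩⟩

lemma freeDecompose_word (w : List (Gen ν))
    (h : (w.map (gen k Γ ν)).prod ∈ grading k Γ ν (w.map (Gen.deg Γ)).sum) :
    freeDecompose k Γ ν (w.map (FreeAlgebra.ι k)).prod =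
      DirectSum.of (fun n => grading k Γ ν n) (w.map (Gen.deg Γ)).sum
        ⟨(w.map (gen k Γ ν)).prod, h⟩ := by
  induction w with
  | nil => simp only [List.map_nil, List.prod_nil, map_one]; rfl
  | cons g w ih =>
    simp only [List.map_cons, List.prod_cons, map_mul]
    rw [ih (Submodule.subset_span ⟨w, rfl, rfl⟩)]
    simp only [freeDecompose, FreeAlgebra.lift_ι_apply]
    rw [DirectSum.of_mul_of]
    rfl

lemma freeDecompose_of_mem {n : ℤ} {x : FreeAlgebra k (Gen ν)} (hx : x ∈ freeGrading k Γ ν n) :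
    ∃ h : RingQuot.mkAlgHom k (Rel k Γ ν) x ∈ grading k Γ ν n,
      freeDecompose k Γ ν x = DirectSum.of (fun n => grading k Γ ν n) n ⟨_, h⟩ := by
  induction hx using Submodule.span_induction with
  | mem x hx =>
    obtain ⟨w, rfl, rfl⟩ := hx
    have e : RingQuot.mkAlgHom k (Rel k Γ ν) (w.map (FreeAlgebra.ι k)).prod
        = (w.map (gen k Γ ν)).prod := by
      rw [map_list_prod, List.map_map]; rfl
    have h := (Submodule.subset_span ⟨w, rfl, rfl⟩ :
      (w.map (gen k Γ ν)).prod ∈ grading k Γ ν (w.map (Gen.deg Γ)).sum)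
    refine ⟨by rw [e]; exact h, ?_⟩
    rw [freeDecompose_word k Γ ν w h]
    congr 2
    exact e.symm
  | zero =>
    refine ⟨by simp, ?_⟩
    rw [map_zero, eq_comm]
    convert map_zero (DirectSum.of (fun n => grading k Γ ν n) n) using 2
    exact Subtype.ext (map_zero _)
  | add x y _ _ hx hy =>
    obtain ⟨hx, ex⟩ := hx
    obtain ⟨hy, ey⟩ := hy
    refine ⟨by rw [map_add]; exact add_mem hx hy, ?_⟩
    rw [map_add, ex, ey, ← map_add]
    congr 1
    exact Subtype.ext (map_add _ _ _).symm
  | smul c x _ hx =>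
    obtain ⟨hx, ex⟩ := hx
    refine ⟨by rw [map_smul]; exact Submodule.smul_mem _ _ hx, ?_⟩
    rw [map_smul, ex]
    change c • DirectSum.lof k ℤ (fun n => grading k Γ ν n) n _ = DirectSum.lof k ℤ _ n _
    rw [← map_smul]
    congr 1
    exact Subtype.ext (map_smul _ _ _).symm

open DirectSum in
/-- The decomposition of elements of `R(ν)` into homogeneous parts. -/
def decompose : R k Γ ν →ₐ[k] ⨁ n, grading k Γ ν n :=
  RingQuot.liftAlgHom k ⟨freeDecompose k Γ ν, fun x y h => by
    obtain ⟨n, hx, hy⟩ := h.homogeneous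
    obtain ⟨hx, ex⟩ := freeDecompose_of_mem k Γ ν hx
    obtain ⟨hy, ey⟩ := freeDecompose_of_mem k Γ ν hy
    rw [ex, ey]
    congr 2
    exact RingQuot.mkAlgHom_rel k h⟩

/-- `R(ν)` is a graded `k`-algebra. -/
instance : GradedAlgebra (grading k Γ ν) :=
  GradedAlgebra.ofAlgHom _ (decompose k Γ ν)
    (by
      refine RingQuot.ringQuot_ext' _ _ _ (FreeAlgebra.hom_ext (funext fun g => ?_))
      simp [decompose, freeDecompose, gen])
    (by
      rintro n ⟨x, hx⟩
      have key : ∀ y ∈ grading k Γ ν n, ∃ z ∈ freeGrading k Γ ν n,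
          RingQuot.mkAlgHom k (Rel k Γ ν) z = y := by
        intro y hy
        induction hy using Submodule.span_induction with
        | mem y hy =>
          obtain ⟨w, rfl, rfl⟩ := hy
          refine ⟨_, Submodule.subset_span ⟨w, rfl, rfl⟩, ?_⟩
          rw [map_list_prod, List.map_map]; rfl
        | zero => exact ⟨0, zero_mem _, map_zero _⟩
        | add y y' _ _ h h' =>
          obtain ⟨z, hz, rfl⟩ := h
          obtain ⟨z', hz', rfl⟩ := h'
          exact ⟨z + z', add_mem hz hz', map_add _ _ _⟩
        | smul c y _ h =>
          obtain ⟨z, hz, rfl⟩ := h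
          exact ⟨c • z, Submodule.smul_mem _ _ hz, map_smul _ _ _⟩
      obtain ⟨z, hz, rfl⟩ := key x hx
      obtain ⟨h, e⟩ := freeDecompose_of_mem k Γ ν hz
      simpa [decompose] using e)

end Algebra

/-! ### Finite-dimensional graded modules -/

section Modules

variable (k : Type u) [Field k] {I : Type v} (Γ : SimpleGraph I) (ν : I →₀ ℕ)

/-- A finite-dimensional graded left `R(ν)`-module. -/
structure FMod where
  carrier : Type (max u v)
  [addCommGroup : AddCommGroup carrier]
  [module : Module k carrier]
  [moduleR : Module (R k Γ ν) carrier]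
  [isScalarTower : IsScalarTower k (R k Γ ν) carrier]
  [finite : Module.Finite k carrier]
  /-- the homogeneous parts -/
  part : ℤ → Submodule k carrier
  isInternal : DirectSum.IsInternal part
  smul_mem : ∀ {m n : ℤ} {r : R k Γ ν} {x : carrier},
    r ∈ grading k Γ ν m → x ∈ part n → r • x ∈ part (m + n)

namespace FMod

attribute [instance] addCommGroup module moduleR isScalarTower finite

variable {k Γ ν}

/-- A homomorphism of the underlying `R(ν)`-modules is grading-preserving. -/
def IsGraded {M N : FMod k Γ ν} (f : M.carrier →ₗ[R k Γ ν] N.carrier) : Prop :=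
  ∀ n : ℤ, ∀ x ∈ M.part n, f x ∈ N.part n

/-- Isomorphism of graded modules. -/
def Iso (M N : FMod k Γ ν) : Prop :=
  ∃ f : M.carrier ≃ₗ[R k Γ ν] N.carrier,
    IsGraded f.toLinearMap ∧ IsGraded f.symm.toLinearMap

/-- There is a short exact sequence `0 → M' → M → M'' → 0` of grading-preserving homomorphisms. -/
def ShortExact (M' M M'' : FMod k Γ ν) : Prop :=
  ∃ (f : M'.carrier →ₗ[R k Γ ν] M.carrier) (g : M.carrier →ₗ[R k Γ ν] M''.carrier),
    IsGraded f ∧ IsGraded g ∧ Function.Injective f ∧ Function.Exact f g ∧ Function.Surjective g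

/-- A submodule is graded if it is the sum of its homogeneous parts. -/
def IsGradedSubmodule (M : FMod k Γ ν) (N : Submodule (R k Γ ν) M.carrier) : Prop :=
  N.restrictScalars k = ⨆ n : ℤ, N.restrictScalars k ⊓ M.part n

/-- Simple graded modules. -/
def IsSimple (M : FMod k Γ ν) : Prop :=
  Nontrivial M.carrier ∧
    ∀ N : Submodule (R k Γ ν) M.carrier, M.IsGradedSubmodule N → N = ⊥ ∨ N = ⊤

/-- The module `M{a}`: `M` with the grading shifted up by `a`. -/
def shift (M : FMod k Γ ν) (a : ℤ) : FMod k Γ ν where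
  carrier := M.carrier
  part n := M.part (n - a)
  isInternal := by
    have h := (DirectSum.isInternal_submodule_iff_iSupIndep_and_iSup_eq_top _).1 M.isInternal
    refine (DirectSum.isInternal_submodule_iff_iSupIndep_and_iSup_eq_top _).2 ⟨?_, ?_⟩
    · exact h.1.comp fun _ _ e => sub_left_inj.1 e
    · rw [← h.2]
      exact (Equiv.subRight a).iSup_comp (g := M.part)
  smul_mem := by
    intro m n r x hr hx
    rw [add_sub_assoc]
    exact M.smul_mem hr hx

lemma shift_zero (M : FMod k Γ ν) : M.shift 0 = M := by
  simp [shift]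

lemma shift_shift (M : FMod k Γ ν) (a b : ℤ) : (M.shift a).shift b = M.shift (a + b) := by
  simp [shift, sub_sub, add_comm]

lemma ShortExact.shift {M' M M'' : FMod k Γ ν} (h : ShortExact M' M M'') (a : ℤ) :
    ShortExact (M'.shift a) (M.shift a) (M''.shift a) := by
  obtain ⟨f, g, hf, hg, h⟩ := h
  exact ⟨f, g, fun n => hf (n - a), fun n => hg (n - a), h⟩

/-! ### Characters of modules -/

/-- The graded dimension `∑ₙ dim (W ∩ Mₙ) qⁿ` of a subspace `W` of a graded module `M`. -/
def gdim (M : FMod k Γ ν) (W : Submodule k M.carrier) : ℤ[T;T⁻¹] :=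
  ∑ᶠ n : ℤ, (Module.finrank k ↥(W ⊓ M.part n) : ℤ) • LaurentPolynomial.T n

/-- The subspace `1_i M`. -/
def weightSpace (M : FMod k Γ ν) (i : Seq ν) : Submodule k M.carrier :=
  LinearMap.range (Algebra.lsmul k k M.carrier (idem k Γ i))

/-- The character `ch M = ∑ᵢ gdim (1_i M) · i` of a module. -/
def char (M : FMod k Γ ν) : Seq ν →₀ ℤ[T;T⁻¹] :=
  Finsupp.equivFunOnFinite.symm fun i => M.gdim (M.weightSpace i)

lemma finite_part_ne_bot (M : FMod k Γ ν) : {n | M.part n ≠ ⊥}.Finite :=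
  WellFoundedGT.finite_ne_bot_of_iSupIndep M.isInternal.submodule_iSupIndep

lemma gdim_support (M : FMod k Γ ν) (W : Submodule k M.carrier) :
    (Function.support fun n : ℤ => (Module.finrank k ↥(W ⊓ M.part n) : ℤ) •
      (LaurentPolynomial.T n : ℤ[T;T⁻¹])).Finite := by
  refine M.finite_part_ne_bot.subset fun n hn h => hn ?_
  have e : W ⊓ M.part n = ⊥ := by rw [h, inf_bot_eq]
  change (Module.finrank k ↥(W ⊓ M.part n) : ℤ) • _ = _
  rw [e, finrank_bot, Nat.cast_zero, zero_smul]

lemma idem_mem (i : Seq ν) : idem k Γ i ∈ grading k Γ ν 0 :=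
  Submodule.subset_span ⟨[Gen.idem i], by simp [Gen.deg], by simp [idem]⟩

lemma idem_mul_idem (i : Seq ν) : idem k Γ i * idem k Γ i = idem k Γ i := by
  have h := RingQuot.mkAlgHom_rel k (Rel.idem_mul_self (k := k) (Γ := Γ) i)
  rwa [map_mul] at h

lemma mem_weightSpace {M : FMod k Γ ν} {i : Seq ν} {x : M.carrier} :
    x ∈ M.weightSpace i ↔ idem k Γ i • x = x := by
  constructor
  · rintro ⟨y, rfl⟩
    simp [← mul_smul, idem_mul_idem]
  · intro h
    exact ⟨x, h⟩

lemma idem_smul_mem {M : FMod k Γ ν} (i : Seq ν) {n : ℤ} {x : M.carrier} (hx : x ∈ M.part n) :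
    idem k Γ i • x ∈ M.weightSpace i ⊓ M.part n := by
  refine ⟨mem_weightSpace.2 (by rw [← mul_smul, idem_mul_idem]), ?_⟩
  simpa using M.smul_mem (idem_mem i) hx

/-- An element of a graded module with image in degree `n` may be replaced by its component
of degree `n`. -/
lemma exists_part {M N : FMod k Γ ν} {f : M.carrier →ₗ[R k Γ ν] N.carrier} (hf : IsGraded f)
    (x : M.carrier) {n : ℤ} (hx : f x ∈ N.part n) : ∃ y ∈ M.part n, f y = f x := by
  classical
  let _ := M.isInternal.chooseDecomposition
  let _ := N.isInternal.chooseDecomposition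
  have key : ∀ x : M.carrier, (DirectSum.decompose N.part (f x) n : N.carrier)
      = f (DirectSum.decompose M.part x n) := by
    intro x
    induction x using DirectSum.Decomposition.inductionOn M.part with
    | zero => simp
    | @homogeneous j m =>
      by_cases h : j = n
      · subst h
        rw [DirectSum.decompose_of_mem_same _ (hf _ _ m.2),
          DirectSum.decompose_of_mem_same _ m.2]
      · rw [DirectSum.decompose_of_mem_ne _ (hf _ _ m.2) h,
          DirectSum.decompose_of_mem_ne _ m.2 h, map_zero]
    | add a b ha hb => simp [ha, hb]
  refine ⟨_, (DirectSum.decompose M.part x n).2, ?_⟩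
  rw [← key, DirectSum.decompose_of_mem_same _ hx]

lemma ShortExact.finrank {M' M M'' : FMod k Γ ν} (h : ShortExact M' M M'') (i : Seq ν) (n : ℤ) :
    Module.finrank k ↥(M.weightSpace i ⊓ M.part n)
      = Module.finrank k ↥(M'.weightSpace i ⊓ M'.part n)
        + Module.finrank k ↥(M''.weightSpace i ⊓ M''.part n) := by
  obtain ⟨f, g, hf, hg, hinj, hex, hsurj⟩ := h
  have hf' : ∀ x ∈ M'.weightSpace i ⊓ M'.part n, f x ∈ M.weightSpace i ⊓ M.part n :=
    fun x hx => ⟨mem_weightSpace.2 (by rw [← map_smul, mem_weightSpace.1 hx.1]), hf _ _ hx.2⟩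
  have hg' : ∀ x ∈ M.weightSpace i ⊓ M.part n, g x ∈ M''.weightSpace i ⊓ M''.part n :=
    fun x hx => ⟨mem_weightSpace.2 (by rw [← map_smul, mem_weightSpace.1 hx.1]), hg _ _ hx.2⟩
  let F := (f.restrictScalars k).restrict hf'
  let G := (g.restrictScalars k).restrict hg'
  have hF : Function.Injective F := fun x y hxy =>
    Subtype.ext (hinj (congrArg Subtype.val hxy))
  have hG : Function.Surjective G := by
    rintro ⟨y, hy⟩
    obtain ⟨x, rfl⟩ := hsurj y
    obtain ⟨z, hz, e⟩ := exists_part hg x hy.2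
    refine ⟨⟨idem k Γ i • z, idem_smul_mem i hz⟩, Subtype.ext ?_⟩
    change g (idem k Γ i • z) = g x
    rw [map_smul, e, mem_weightSpace.1 hy.1]
  have hFG : LinearMap.ker G = LinearMap.range F := by
    ext ⟨x, hx⟩
    constructor
    · intro h
      have h0 : g x = 0 := congrArg Subtype.val (LinearMap.mem_ker.1 h)
      obtain ⟨w, rfl⟩ := (hex x).1 h0
      obtain ⟨z, hz, e⟩ := exists_part hf w hx.2
      refine ⟨⟨idem k Γ i • z, idem_smul_mem i hz⟩, Subtype.ext ?_⟩
      change f (idem k Γ i • z) = f w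
      rw [map_smul, e, mem_weightSpace.1 hx.1]
    · rintro ⟨y, hy⟩
      rw [LinearMap.mem_ker, ← hy]
      exact Subtype.ext ((hex _).2 ⟨y.1, rfl⟩)
  have h1 := LinearMap.finrank_range_add_finrank_ker G
  rw [LinearMap.range_eq_top.2 hG, finrank_top, hFG, LinearMap.finrank_range_of_inj hF] at h1
  omega

/-- The character is additive on short exact sequences. -/
lemma ShortExact.char {M' M M'' : FMod k Γ ν} (h : ShortExact M' M M'') :
    M.char = M'.char + M''.char := by
  refine Finsupp.ext fun i => ?_
  change M.gdim _ = M'.gdim _ + M''.gdim _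
  rw [gdim, gdim, gdim, ← finsum_add_distrib (gdim_support _ _) (gdim_support _ _)]
  refine finsum_congr fun n => ?_
  rw [h.finrank, Nat.cast_add, add_smul]

/-- The character of `M{a}` is `q ^ a` times the character of `M`. -/
lemma char_shift (M : FMod k Γ ν) (a : ℤ) :
    (M.shift a).char = (LaurentPolynomial.T a : ℤ[T;T⁻¹]) • M.char := by
  refine Finsupp.ext fun i => ?_
  change (M.shift a).gdim _ = LaurentPolynomial.T a * M.gdim _
  rw [gdim, gdim, mul_finsum' _ _ (gdim_support _ _), ← finsum_comp_equiv (Equiv.addRight a)]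
  refine finsum_congr fun n => ?_
  have e : M.part (n + a - a) = M.part n := by rw [add_sub_cancel_right]
  have e' : Module.finrank k ↥(M.weightSpace i ⊓ M.part (n + a - a))
      = Module.finrank k ↥(M.weightSpace i ⊓ M.part n) := by rw [e]
  change (Module.finrank k ↥(M.weightSpace i ⊓ M.part (n + a - a)) : ℤ) •
    LaurentPolynomial.T (n + a) = _
  rw [e', mul_smul_comm, ← LaurentPolynomial.T_add, add_comm a n]

end FMod

/-! ### The Grothendieck group and the character map -/

/-- The relations `[M] = [M'] + [M'']` for all short exact sequences `0 → M' → M → M'' → 0`. -/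
def G0.relations : AddSubgroup (FreeAbelianGroup (FMod k Γ ν)) :=
  AddSubgroup.closure {x | ∃ M' M M'' : FMod k Γ ν, FMod.ShortExact M' M M'' ∧
    x = FreeAbelianGroup.of M - (FreeAbelianGroup.of M' + FreeAbelianGroup.of M'')}

/-- The Grothendieck group of the category of finite-dimensional graded `R(ν)`-modules. -/
def G0 : Type _ := FreeAbelianGroup (FMod k Γ ν) ⧸ G0.relations k Γ ν

namespace G0

instance : AddCommGroup (G0 k Γ ν) :=
  inferInstanceAs (AddCommGroup (FreeAbelianGroup (FMod k Γ ν) ⧸ G0.relations k Γ ν))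

variable {k Γ ν}

/-- The class `[M]` of a module. -/
def cls (M : FMod k Γ ν) : G0 k Γ ν := QuotientAddGroup.mk (FreeAbelianGroup.of M)

lemma cls_eq_add {M' M M'' : FMod k Γ ν} (h : FMod.ShortExact M' M M'') :
    cls M = cls M' + cls M'' := by
  refine eq_of_sub_eq_zero ((QuotientAddGroup.eq_zero_iff
    (FreeAbelianGroup.of M - (FreeAbelianGroup.of M' + FreeAbelianGroup.of M''))).2 ?_)
  exact AddSubgroup.subset_closure ⟨M', M, M'', h, rfl⟩

/-- A function that is additive on short exact sequences extends to the Grothendieck group. -/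
def lift {A : Type*} [AddCommGroup A] (φ : FMod k Γ ν → A)
    (hφ : ∀ M' M M'' : FMod k Γ ν, FMod.ShortExact M' M M'' → φ M = φ M' + φ M'') :
    G0 k Γ ν →+ A :=
  QuotientAddGroup.lift _ (FreeAbelianGroup.lift φ) <| by
    refine (AddSubgroup.closure_le _).2 ?_
    rintro _ ⟨M', M, M'', h, rfl⟩
    simp [hφ M' M M'' h]

lemma lift_cls {A : Type*} [AddCommGroup A] (φ : FMod k Γ ν → A)
    (hφ : ∀ M' M M'' : FMod k Γ ν, FMod.ShortExact M' M M'' → φ M = φ M' + φ M'')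
    (M : FMod k Γ ν) : lift φ hφ (cls M) = φ M :=
  FreeAbelianGroup.lift_apply_of φ M

lemma addHom_ext {A : Type*} [AddCommGroup A] {f g : G0 k Γ ν →+ A}
    (h : ∀ M, f (cls M) = g (cls M)) : f = g :=
  QuotientAddGroup.addMonoidHom_ext _ (FreeAbelianGroup.lift_ext _ _ h)

/-- The grading shift on the Grothendieck group: `[M] ↦ [M{a}]`. -/
def shift (a : ℤ) : AddMonoid.End (G0 k Γ ν) :=
  lift (fun M => cls (M.shift a)) fun _ _ _ h => cls_eq_add (h.shift a)

lemma shift_cls (a : ℤ) (M : FMod k Γ ν) : shift a (cls M) = cls (M.shift a) :=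
  lift_cls _ _ M

variable (k Γ ν) in
/-- The action of `ℤ` on the Grothendieck group by grading shifts. -/
def shiftHom : Multiplicative ℤ →* AddMonoid.End (G0 k Γ ν) where
  toFun a := shift a.toAdd
  map_one' := addHom_ext fun M => by
    change shift 0 (cls M) = cls M
    rw [shift_cls, FMod.shift_zero]
  map_mul' a b := addHom_ext fun M => by
    change shift (a.toAdd + b.toAdd) (cls M) = shift a.toAdd (shift b.toAdd (cls M))
    rw [shift_cls, shift_cls, shift_cls, FMod.shift_shift, add_comm]

/-- The `ℤ[q, q⁻¹]`-module structure: `q ^ a` acts by the grading shift by `a`. -/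
instance : Module ℤ[T;T⁻¹] (G0 k Γ ν) :=
  Module.compHom (G0 k Γ ν)
    (AddMonoidAlgebra.lift ℤ (AddMonoid.End (G0 k Γ ν)) ℤ (shiftHom k Γ ν)).toRingHom

lemma T_smul (a : ℤ) (x : G0 k Γ ν) :
    (LaurentPolynomial.T a : ℤ[T;T⁻¹]) • x = shift a x := by
  change AddMonoidAlgebra.lift ℤ (AddMonoid.End (G0 k Γ ν)) ℤ (shiftHom k Γ ν)
    (LaurentPolynomial.T a) x = _
  rw [LaurentPolynomial.T, AddMonoidAlgebra.lift_single, one_smul]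
  rfl

lemma T_smul_cls (a : ℤ) (M : FMod k Γ ν) :
    (LaurentPolynomial.T a : ℤ[T;T⁻¹]) • cls M = cls (M.shift a) := by
  rw [T_smul, shift_cls]

end G0

/-- The character map `ch : G₀(R(ν)) → ℤ[q, q⁻¹] Seq(ν)`, `[M] ↦ ch M`. -/
def ch : G0 k Γ ν →ₗ[ℤ[T;T⁻¹]] (Seq ν →₀ ℤ[T;T⁻¹]) :=
  { G0.lift (fun M : FMod k Γ ν => M.char) fun _ _ _ h => h.char with
    map_smul' := by
      intro p x
      set c := G0.lift (fun M : FMod k Γ ν => M.char) fun _ _ _ h => h.char with hc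
      change c (p • x) = p • c x
      have hT : ∀ (a : ℤ) (y : G0 k Γ ν),
          c ((LaurentPolynomial.T a : ℤ[T;T⁻¹]) • y) = (LaurentPolynomial.T a : ℤ[T;T⁻¹]) • c y := by
        intro a y
        have : c.comp (DistribSMul.toAddMonoidHom (G0 k Γ ν) (LaurentPolynomial.T a : ℤ[T;T⁻¹]))
            = (DistribSMul.toAddMonoidHom (Seq ν →₀ ℤ[T;T⁻¹])
              (LaurentPolynomial.T a : ℤ[T;T⁻¹])).comp c := by
          refine G0.addHom_ext fun M => ?_
          change c ((LaurentPolynomial.T a : ℤ[T;T⁻¹]) • G0.cls M)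
            = (LaurentPolynomial.T a : ℤ[T;T⁻¹]) • c (G0.cls M)
          rw [G0.T_smul_cls, hc, G0.lift_cls, G0.lift_cls, FMod.char_shift]
        exact DFunLike.congr_fun this y
      induction p using LaurentPolynomial.induction_on' with
      | add p p' hp hp' => rw [add_smul, add_smul, map_add, hp, hp']
      | C_mul_T n r =>
        have e : (LaurentPolynomial.C r * LaurentPolynomial.T n : ℤ[T;T⁻¹])
            = r • LaurentPolynomial.T n := by
          rw [← LaurentPolynomial.smul_eq_C_mul]
        rw [e, smul_assoc, smul_assoc, map_zsmul, hT] }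

lemma ch_cls (M : FMod k Γ ν) : ch k Γ ν (G0.cls M) = M.char :=
  G0.lift_cls (fun M : FMod k Γ ν => M.char) (fun _ _ _ h => h.char) M

end Modules

end KLR

end

noncomputable section

set_option linter.unusedSectionVars false

/-! Strands with equal labels are peeled off from the right, and the theorem is proved by induction
on the number `r` of strands whose dots and crossings are taken into account. The objects of the
induction are homogeneous subspaces `N` of graded modules that are stable under the idempotents, the
first `r` dots and the crossings among the first `r` strands, and simple as such (`IsSimpleSub`).
For `r = ν.degree` and `N = ⊤` these are the simple graded modules; for `r = 0` they are lines
spanned by a homogeneous weight vector.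

Fix a label `i` and let `s` be smallest such that some weight of `N` has label `i` in all positions
from `s` to `r - 1`. Let `U` be the sum of these weight spaces of `N`, and call a vector of `U`
singular if all crossings inside the block kill it. Crossings of equal labels lower the degree by 2,
so a nonzero `U` has singular vectors in its lowest degree (`singular_ne_bot`). The central point is
a Mackey-type argument: anything generated from a space `V` of singular vectors, stable under the
first `s` strands, is obtained by pulling strands of the block to the left. By the choice of `s` the
entry before the block is not `i`, so a strand that leaves the block pushes a foreign label into it.
What remains in the block weights is only `V` multiplied by polynomials in the dots of the block
(`exists_stable_of_block`, `mem_dotSpan_of_mem_generate`).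

Simplicity of `N` therefore gives `U ≤ K + XU` for each nonzero homogeneous stable space `K` of
singular vectors, where `XU` is the image of the dots of the block. Dots have positive degree, so `U
≤ XU` forces `U = 0`, as in Nakayama's lemma. Hence singular vectors meet `XU` trivially, the
singular vectors form a simple object for `s` strands (`IsSimpleSub.singular`), and they determine
`N`: the graph of an isomorphism between two spaces of singular vectors generates the graph of an
isomorphism between the simple objects (`IsSimpleSub.exists_isIsoGraph`). Endomorphism rings of
simple modules never enter, so `k` may be any field.

On a weight `j` with the block `i ⋯ i`, the dots and crossings of the block satisfy the nil Hecke
relations. A filtration argument shows that the graded dimension of `1_j N` is a nonzero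
`q`-factorial times that of the singular vectors of weight `j` (`gdim_eq_qFactorial_mul`). Now take
a nontrivial linear relation among characters, choose `i` and the longest block that occurs in a
member with nonzero coefficient, and compare coefficients at the weights with this block: this is a
nontrivial relation for `s < r` strands, which is impossible by induction
(`linearIndependent_subChar`).

Finally, composition series show that the classes of simple modules generate `G0`; `ch` sends these
generators to a linearly independent family, hence is injective. -/

namespace KLR

/-! ### Sequences with positions in `ℕ` -/

section Relations

variable {I : Type v} {ν : I →₀ ℕ}

/-- The label of a sequence in position `a`, if there is such a position. -/
def Seq.label (j : Seq ν) (a : ℕ) : Option I :=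
  if h : a < ν.degree then some (j.at a h) else none

/-- The exchange of the entries in positions `a` and `a + 1`, if there are such positions. -/
def Seq.flip (a : ℕ) (j : Seq ν) : Seq ν :=
  if h : a + 1 < ν.degree then j.swap a h else j

lemma Seq.flip_of_lt {a : ℕ} (h : a + 1 < ν.degree) (j : Seq ν) : j.flip a = j.swap a h :=
  dif_pos h

lemma Seq.label_of_lt {a : ℕ} (h : a < ν.degree) (j : Seq ν) : j.label a = some (j.at a h) :=
  dif_pos h

lemma Seq.ext_label {i j : Seq ν} (h : ∀ a, i.label a = j.label a) : i = j := by
  refine Subtype.ext (funext fun a => ?_)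
  have := h a
  rw [label_of_lt a.2, label_of_lt a.2] at this
  exact Option.some.inj this

lemma Seq.label_flip {a : ℕ} (h : a + 1 < ν.degree) (j : Seq ν) (b : ℕ) :
    (j.flip a).label b = j.label (Equiv.swap a (a + 1) b) := by
  rw [flip_of_lt h]
  rcases eq_or_ne b a with rfl | hba
  · rw [Equiv.swap_apply_left, label_of_lt h, label_of_lt (by omega), swap_at_left]
  rcases eq_or_ne b (a + 1) with rfl | hba'
  · rw [Equiv.swap_apply_right, label_of_lt h, label_of_lt (by omega), swap_at_right]
  rw [Equiv.swap_apply_of_ne_of_ne hba hba']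
  by_cases hb : b < ν.degree
  · rw [label_of_lt hb, label_of_lt hb, swap_at_of_ne _ _ _ _ _ hba hba']
  · simp [label, hb]

lemma Seq.flip_flip (a : ℕ) (j : Seq ν) : (j.flip a).flip a = j := by
  by_cases h : a + 1 < ν.degree
  · refine ext_label fun b => ?_
    rw [label_flip h, label_flip h, Equiv.swap_apply_self]
  · simp [flip, h]

/-- Out of range, `flip` is the identity, so the case of equal default labels `none` needs no
exclusion. -/
lemma Seq.flip_of_label_eq {a : ℕ} {j : Seq ν} (hj : j.label a = j.label (a + 1)) :
    j.flip a = j := by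
  by_cases h : a + 1 < ν.degree
  · refine ext_label fun b => ?_
    rw [label_flip h]
    rcases eq_or_ne b a with rfl | hba
    · rw [Equiv.swap_apply_left, hj]
    rcases eq_or_ne b (a + 1) with rfl | hba'
    · rw [Equiv.swap_apply_right, hj]
    rw [Equiv.swap_apply_of_ne_of_ne hba hba']
  · simp [flip, h]

lemma Seq.label_eq_iff {a : ℕ} (h : a + 1 < ν.degree) (j : Seq ν) :
    j.label a = j.label (a + 1) ↔ j.at a (Nat.lt_of_succ_lt h) = j.at (a + 1) h := by
  rw [label_of_lt h, label_of_lt (Nat.lt_of_succ_lt h), Option.some_inj]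

end Relations

/-! ### The defining relations, summed over all labels -/

section Relations

variable (k : Type u) [Field k] {I : Type v} (Γ : SimpleGraph I) (ν : I →₀ ℕ)

/-- The dot in position `a`, summed over all labels of the strands. -/
def dot (a : ℕ) : R k Γ ν :=
  if h : a < ν.degree then ∑ j, gen k Γ ν (Gen.dot a h j) else 0

/-- The crossing of the strands in positions `a` and `a + 1`, summed over all labels. -/
def crossing (a : ℕ) : R k Γ ν :=
  if h : a + 1 < ν.degree then ∑ j, gen k Γ ν (Gen.cross a h j) else 0

variable {k Γ ν}

local notation "𝖷" => dot k Γ ν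
local notation "𝖣" => crossing k Γ ν
local notation "𝖤" => idem k Γ

lemma rel_eq {x y : FreeAlgebra k (Gen ν)} (h : Rel k Γ ν x y) :
    RingQuot.mkAlgHom k (Rel k Γ ν) x = RingQuot.mkAlgHom k (Rel k Γ ν) y :=
  RingQuot.mkAlgHom_rel k h

lemma idem_mul_idem_of_ne {i j : Seq ν} (h : i ≠ j) : 𝖤 i * 𝖤 j = 0 := by
  have := rel_eq (Rel.idem_mul_of_ne (k := k) (Γ := Γ) i j h)
  rwa [map_mul, map_zero] at this

lemma sum_idem : ∑ j : Seq ν, 𝖤 j = 1 := by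
  have := rel_eq (Rel.sum_idem (k := k) (Γ := Γ) (ν := ν))
  rwa [map_sum, map_one] at this

lemma gen_dot_mul_idem {a : ℕ} (h : a < ν.degree) (j : Seq ν) :
    gen k Γ ν (Gen.dot a h j) * 𝖤 j = gen k Γ ν (Gen.dot a h j) := by
  have := rel_eq (Rel.dot_mul_idem (k := k) (Γ := Γ) a h j)
  rwa [map_mul] at this

lemma idem_mul_gen_dot {a : ℕ} (h : a < ν.degree) (j : Seq ν) :
    𝖤 j * gen k Γ ν (Gen.dot a h j) = gen k Γ ν (Gen.dot a h j) := by
  have := rel_eq (Rel.idem_mul_dot (k := k) (Γ := Γ) a h j)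
  rwa [map_mul] at this

lemma gen_cross_mul_idem {a : ℕ} (h : a + 1 < ν.degree) (j : Seq ν) :
    gen k Γ ν (Gen.cross a h j) * 𝖤 j = gen k Γ ν (Gen.cross a h j) := by
  have := rel_eq (Rel.cross_mul_idem (k := k) (Γ := Γ) a h j)
  rwa [map_mul] at this

lemma idem_mul_gen_cross {a : ℕ} (h : a + 1 < ν.degree) (j : Seq ν) :
    𝖤 (j.swap a h) * gen k Γ ν (Gen.cross a h j) = gen k Γ ν (Gen.cross a h j) := by
  have := rel_eq (Rel.idem_mul_cross (k := k) (Γ := Γ) a h j)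
  rwa [map_mul] at this

/-- Cutting the sum over all labels with one idempotent recovers the original generator, so nothing
is lost by working with `dot` and `crossing` alone. -/
lemma dot_mul_idem_eq_gen {a : ℕ} (h : a < ν.degree) (j : Seq ν) :
    𝖷 a * 𝖤 j = gen k Γ ν (Gen.dot a h j) := by
  rw [dot, dif_pos h, Finset.sum_mul, Finset.sum_eq_single j, gen_dot_mul_idem]
  · intro i _ hij
    rw [← gen_dot_mul_idem, mul_assoc, idem_mul_idem_of_ne hij, mul_zero]
  · simp

lemma idem_mul_dot_eq_gen {a : ℕ} (h : a < ν.degree) (j : Seq ν) :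
    𝖤 j * 𝖷 a = gen k Γ ν (Gen.dot a h j) := by
  rw [dot, dif_pos h, Finset.mul_sum, Finset.sum_eq_single j, idem_mul_gen_dot]
  · intro i _ hij
    rw [← idem_mul_gen_dot, ← mul_assoc, idem_mul_idem_of_ne hij.symm, zero_mul]
  · simp

lemma crossing_mul_idem_eq_gen {a : ℕ} (h : a + 1 < ν.degree) (j : Seq ν) :
    𝖣 a * 𝖤 j = gen k Γ ν (Gen.cross a h j) := by
  rw [crossing, dif_pos h, Finset.sum_mul, Finset.sum_eq_single j, gen_cross_mul_idem]
  · intro i _ hij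
    rw [← gen_cross_mul_idem, mul_assoc, idem_mul_idem_of_ne hij, mul_zero]
  · simp

lemma idem_mul_crossing_eq_gen {a : ℕ} (h : a + 1 < ν.degree) (j : Seq ν) :
    𝖤 (j.flip a) * 𝖣 a = gen k Γ ν (Gen.cross a h j) := by
  rw [crossing, dif_pos h, Finset.mul_sum, Finset.sum_eq_single j, Seq.flip_of_lt h,
    idem_mul_gen_cross]
  · intro i _ hij
    rw [← idem_mul_gen_cross, ← mul_assoc, idem_mul_idem_of_ne, zero_mul]
    intro e
    rw [← Seq.flip_of_lt h] at e
    exact hij (by rw [← Seq.flip_flip a i, ← e, Seq.flip_flip])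
  · simp

lemma idem_mul_dot (a : ℕ) (j : Seq ν) : 𝖤 j * 𝖷 a = 𝖷 a * 𝖤 j := by
  by_cases h : a < ν.degree
  · rw [idem_mul_dot_eq_gen h, dot_mul_idem_eq_gen h]
  · simp [dot, h]

/-- For `a` out of range both sides vanish, since `crossing` is then `0`; this default removes the
range condition here and in most relations below. -/
lemma crossing_mul_idem (a : ℕ) (j : Seq ν) : 𝖣 a * 𝖤 j = 𝖤 (j.flip a) * 𝖣 a := by
  by_cases h : a + 1 < ν.degree
  · rw [crossing_mul_idem_eq_gen h, idem_mul_crossing_eq_gen h]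
  · simp [crossing, h]

lemma idem_mul_crossing (a : ℕ) (j : Seq ν) : 𝖤 j * 𝖣 a = 𝖣 a * 𝖤 (j.flip a) := by
  rw [crossing_mul_idem, Seq.flip_flip]

/-- Elements that agree after multiplication with the idempotents are equal. -/
lemma eq_of_mul_idem {x y : R k Γ ν} (h : ∀ j, x * 𝖤 j = y * 𝖤 j) : x = y := by
  rw [← mul_one x, ← mul_one y, ← sum_idem, Finset.mul_sum, Finset.mul_sum]
  exact Finset.sum_congr rfl fun j _ => h j

lemma map_E (j : Seq ν) : RingQuot.mkAlgHom k (Rel k Γ ν) (Free.E k j) = 𝖤 j := rfl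

lemma map_X {a : ℕ} (h : a < ν.degree) (j : Seq ν) :
    RingQuot.mkAlgHom k (Rel k Γ ν) (Free.X k a h j) = 𝖷 a * 𝖤 j :=
  (dot_mul_idem_eq_gen h j).symm

lemma map_D {a : ℕ} (h : a + 1 < ν.degree) (j : Seq ν) :
    RingQuot.mkAlgHom k (Rel k Γ ν) (Free.D k a h j) = 𝖣 a * 𝖤 j :=
  (crossing_mul_idem_eq_gen h j).symm

/-- Inner idempotents of a word are forced by the rightmost one. Used as a rewriting rule, this and
the next lemma turn each defining relation into one between `dot` and `crossing`. -/
lemma mul_idem_mul_dot_mul_idem (x : R k Γ ν) (b : ℕ) (j : Seq ν) :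
    x * 𝖤 j * (𝖷 b * 𝖤 j) = x * 𝖷 b * 𝖤 j := by
  rw [← idem_mul_dot, mul_assoc, ← mul_assoc (𝖤 j), FMod.idem_mul_idem, idem_mul_dot, mul_assoc]

lemma mul_idem_mul_crossing_mul_idem (x : R k Γ ν) {a : ℕ} (h : a + 1 < ν.degree) (j : Seq ν) :
    x * 𝖤 (j.swap a h) * (𝖣 a * 𝖤 j) = x * 𝖣 a * 𝖤 j := by
  rw [← Seq.flip_of_lt h, crossing_mul_idem, mul_assoc, ← mul_assoc (𝖤 _), FMod.idem_mul_idem,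
    ← crossing_mul_idem, mul_assoc]

lemma dot_mul_dot (a b : ℕ) : 𝖷 a * 𝖷 b = 𝖷 b * 𝖷 a := by
  by_cases ha : a < ν.degree
  · by_cases hb : b < ν.degree
    · refine eq_of_mul_idem fun j => ?_
      simpa only [map_mul, map_X, mul_idem_mul_dot_mul_idem] using
        rel_eq (Rel.dot_dot (k := k) (Γ := Γ) a b ha hb j)
    · simp [dot, hb]
  · simp [dot, ha]

lemma crossing_mul_dot {a b : ℕ} (h1 : b ≠ a) (h2 : b ≠ a + 1) : 𝖣 a * 𝖷 b = 𝖷 b * 𝖣 a := by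
  by_cases ha : a + 1 < ν.degree
  · by_cases hb : b < ν.degree
    · refine eq_of_mul_idem fun j => ?_
      simpa only [map_mul, map_X, map_D, mul_idem_mul_dot_mul_idem, mul_idem_mul_crossing_mul_idem]
        using rel_eq (Rel.cross_dot (k := k) (Γ := Γ) a b ha hb h1 h2 j)
    · simp [dot, hb]
  · simp [crossing, ha]

lemma crossing_mul_crossing {a b : ℕ} (h : a + 1 < b) : 𝖣 a * 𝖣 b = 𝖣 b * 𝖣 a := by
  by_cases hb : b + 1 < ν.degree
  · refine eq_of_mul_idem fun j => ?_
    have ha : a + 1 < ν.degree := by omega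
    simpa only [map_mul, map_D, mul_idem_mul_crossing_mul_idem]
      using rel_eq (Rel.cross_cross (k := k) (Γ := Γ) a b ha hb h j)
  · simp [crossing, hb]

lemma crossing_sq_of_eq {a : ℕ} (j : Seq ν) (hj : j.label a = j.label (a + 1)) :
    𝖣 a * 𝖣 a * 𝖤 j = 0 := by
  by_cases h : a + 1 < ν.degree
  · simpa only [map_mul, map_D, mul_idem_mul_crossing_mul_idem, map_zero]
      using rel_eq (Rel.sq_of_eq (k := k) (Γ := Γ) a h j ((j.label_eq_iff h).1 hj))
  · simp [crossing, h]

/-- The three cases of the quadratic relation in one form: the later arguments only need that a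
double crossing is an expression in the idempotent and the two adjacent dots. -/
lemma crossing_sq (a : ℕ) (j : Seq ν) :
    ∃ c d : k, 𝖣 a * 𝖣 a * 𝖤 j = c • 𝖤 j + d • ((𝖷 a + 𝖷 (a + 1)) * 𝖤 j) := by
  by_cases h : a + 1 < ν.degree
  · by_cases hj : j.label a = j.label (a + 1)
    · exact ⟨0, 0, by rw [crossing_sq_of_eq j hj, zero_smul, zero_smul, add_zero]⟩
    · rw [Seq.label_eq_iff h] at hj
      by_cases hadj : Γ.Adj (j.at a (Nat.lt_of_succ_lt h)) (j.at (a + 1) h)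
      · refine ⟨0, 1, ?_⟩
        have := rel_eq (Rel.sq_of_adj (k := k) a h j hadj)
        simp only [map_mul, map_D, map_X, map_add, mul_idem_mul_crossing_mul_idem] at this
        rw [this, zero_smul, one_smul, zero_add, add_mul]
      · refine ⟨1, 0, ?_⟩
        have := rel_eq (Rel.sq_of_not_adj (k := k) a h j hj hadj)
        simp only [map_mul, map_D, map_E, mul_idem_mul_crossing_mul_idem] at this
        rw [this, zero_smul, one_smul, add_zero]
  · exact ⟨0, 0, by simp [crossing, h]⟩

lemma crossing_mul_dot_of_eq {a : ℕ} (h : a + 1 < ν.degree) (j : Seq ν)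
    (hj : j.label a = j.label (a + 1)) :
    𝖣 a * 𝖷 a * 𝖤 j = 𝖷 (a + 1) * 𝖣 a * 𝖤 j + 𝖤 j := by
  have := rel_eq (Rel.slide_left_of_eq (k := k) (Γ := Γ) a h j ((j.label_eq_iff h).1 hj))
  simp only [map_sub, map_mul, map_X, map_D, map_E, mul_idem_mul_dot_mul_idem,
    mul_idem_mul_crossing_mul_idem] at this
  rw [← sub_eq_iff_eq_add', this]

lemma dot_mul_crossing_of_eq {a : ℕ} (h : a + 1 < ν.degree) (j : Seq ν)
    (hj : j.label a = j.label (a + 1)) :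
    𝖷 a * 𝖣 a * 𝖤 j = 𝖣 a * 𝖷 (a + 1) * 𝖤 j + 𝖤 j := by
  have := rel_eq (Rel.slide_right_of_eq (k := k) (Γ := Γ) a h j ((j.label_eq_iff h).1 hj))
  simp only [map_sub, map_mul, map_X, map_D, map_E, mul_idem_mul_dot_mul_idem,
    mul_idem_mul_crossing_mul_idem] at this
  rw [← sub_eq_iff_eq_add', this]

lemma crossing_mul_dot_of_ne {a : ℕ} (h : a + 1 < ν.degree) (j : Seq ν)
    (hj : j.label a ≠ j.label (a + 1)) :
    𝖣 a * 𝖷 a * 𝖤 j = 𝖷 (a + 1) * 𝖣 a * 𝖤 j := by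
  have := rel_eq (Rel.slide_left_of_ne (k := k) (Γ := Γ) a h j (mt (j.label_eq_iff h).2 hj))
  simpa only [map_mul, map_X, map_D, mul_idem_mul_dot_mul_idem,
    mul_idem_mul_crossing_mul_idem] using this

lemma dot_mul_crossing_of_ne {a : ℕ} (h : a + 1 < ν.degree) (j : Seq ν)
    (hj : j.label a ≠ j.label (a + 1)) :
    𝖷 a * 𝖣 a * 𝖤 j = 𝖣 a * 𝖷 (a + 1) * 𝖤 j := by
  have := rel_eq (Rel.slide_right_of_ne (k := k) (Γ := Γ) a h j (mt (j.label_eq_iff h).2 hj))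
  simpa only [map_mul, map_X, map_D, mul_idem_mul_dot_mul_idem,
    mul_idem_mul_crossing_mul_idem] using this.symm

/-- The exceptional braid relation would need an edge from a vertex to itself. -/
lemma braid_of_label_eq {a : ℕ} (j : Seq ν) (hj : j.label a = j.label (a + 1)) :
    𝖣 a * 𝖣 (a + 1) * 𝖣 a * 𝖤 j = 𝖣 (a + 1) * 𝖣 a * 𝖣 (a + 1) * 𝖤 j := by
  by_cases h : a + 1 + 1 < ν.degree
  · have := rel_eq (Rel.braid (k := k) (Γ := Γ) a h j fun hh => by
      rw [(j.label_eq_iff (by omega)).1 hj] at hh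
      exact Γ.loopless.irrefl _ hh.2)
    simpa only [map_mul, map_D, mul_idem_mul_crossing_mul_idem] using this
  · simp [crossing, h]

lemma neg_one_smul_idem (j : Seq ν) : (-1 : k) • 𝖤 j = -𝖤 j := neg_one_smul k (𝖤 j)

/-- The exact correction term is irrelevant for stability of subspaces; only that it is a multiple
of the idempotent matters. -/
lemma braid (a : ℕ) (j : Seq ν) : ∃ c : k,
    𝖣 (a + 1) * 𝖣 a * 𝖣 (a + 1) * 𝖤 j = 𝖣 a * 𝖣 (a + 1) * 𝖣 a * 𝖤 j + c • 𝖤 j := by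
  by_cases h : a + 1 + 1 < ν.degree
  · by_cases hj : j.at a (Nat.lt_of_succ_lt (Nat.lt_of_succ_lt h)) = j.at (a + 1 + 1) h ∧
        Γ.Adj (j.at a (Nat.lt_of_succ_lt (Nat.lt_of_succ_lt h)))
          (j.at (a + 1) (Nat.lt_of_succ_lt h))
    · refine ⟨-1, ?_⟩
      have := rel_eq (Rel.braid_of_adj (k := k) (Γ := Γ) a h j hj.1 hj.2)
      simp only [map_sub, map_mul, map_D, map_E, mul_idem_mul_crossing_mul_idem] at this
      rw [neg_one_smul_idem, ← sub_eq_add_neg, eq_sub_iff_add_eq', ← eq_sub_iff_add_eq, this]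
    · refine ⟨0, ?_⟩
      have := rel_eq (Rel.braid (k := k) (Γ := Γ) a h j hj)
      simp only [map_mul, map_D, mul_idem_mul_crossing_mul_idem] at this
      rw [zero_smul, add_zero, this]
  · exact ⟨0, by simp [crossing, h]⟩

/-- The span of the idempotents `1_i`. -/
def idemSpan (k : Type u) [Field k] (Γ : SimpleGraph I) (ν : I →₀ ℕ) : Submodule k (R k Γ ν) :=
  Submodule.span k (Set.range (idem k Γ))

lemma smul_idem_mem_idemSpan (c : k) (j : Seq ν) : c • 𝖤 j ∈ idemSpan k Γ ν :=
  Submodule.smul_mem _ _ (Submodule.subset_span ⟨j, rfl⟩)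

/-- Elements that agree up to multiples of the idempotents after multiplication with the
idempotents are equal up to a combination of idempotents. -/
lemma exists_eq_add_idemSpan {x y : R k Γ ν} (h : ∀ j, ∃ c : k, x * 𝖤 j = y * 𝖤 j + c • 𝖤 j) :
    ∃ p ∈ idemSpan k Γ ν, x = y + p := by
  choose c hc using h
  refine ⟨∑ j, c j • 𝖤 j, sum_mem fun j _ => smul_idem_mem_idemSpan _ j, ?_⟩
  rw [← mul_one x, ← mul_one y, ← sum_idem, Finset.mul_sum, Finset.mul_sum,
    ← Finset.sum_add_distrib]
  exact Finset.sum_congr rfl fun j _ => hc j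

/-- A crossing permutes the idempotents, so their span can be moved past it. -/
lemma exists_mul_crossing {p : R k Γ ν} (hp : p ∈ idemSpan k Γ ν) (a : ℕ) :
    ∃ p' ∈ idemSpan k Γ ν, p * 𝖣 a = 𝖣 a * p' := by
  induction hp using Submodule.span_induction with
  | mem x hx =>
    obtain ⟨j, rfl⟩ := hx
    exact ⟨_, Submodule.subset_span ⟨j.flip a, rfl⟩, idem_mul_crossing a j⟩
  | zero => exact ⟨0, zero_mem _, by simp⟩
  | add x y _ _ hx hy =>
    obtain ⟨x', hx', ex⟩ := hx
    obtain ⟨y', hy', ey⟩ := hy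
    exact ⟨_, add_mem hx' hy', by rw [add_mul, mul_add, ex, ey]⟩
  | smul c x _ hx =>
    obtain ⟨x', hx', ex⟩ := hx
    exact ⟨_, Submodule.smul_mem _ c hx', by rw [smul_mul_assoc, mul_smul_comm, ex]⟩

/-- All cases of dot sliding at once: the dot changes strands, and the error has no crossing at all.
-/
lemma exists_dot_mul_crossing (a b : ℕ) : ∃ p ∈ idemSpan k Γ ν,
    𝖷 b * 𝖣 a = 𝖣 a * 𝖷 (Equiv.swap a (a + 1) b) + p := by
  by_cases ha : a + 1 < ν.degree
  · refine exists_eq_add_idemSpan fun j => ?_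
    rcases eq_or_ne b a with rfl | hba
    · rw [Equiv.swap_apply_left]
      by_cases hj : j.label b = j.label (b + 1)
      · exact ⟨1, by rw [dot_mul_crossing_of_eq ha j hj, one_smul]⟩
      · exact ⟨0, by rw [dot_mul_crossing_of_ne ha j hj, zero_smul, add_zero]⟩
    rcases eq_or_ne b (a + 1) with rfl | hba'
    · rw [Equiv.swap_apply_right]
      by_cases hj : j.label a = j.label (a + 1)
      · exact ⟨-1, by rw [crossing_mul_dot_of_eq ha j hj, neg_one_smul_idem, add_neg_cancel_right]⟩
      · exact ⟨0, by rw [crossing_mul_dot_of_ne ha j hj, zero_smul, add_zero]⟩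
    rw [Equiv.swap_apply_of_ne_of_ne hba hba']
    exact ⟨0, by rw [crossing_mul_dot hba hba', zero_smul, add_zero]⟩
  · exact ⟨0, zero_mem _, by simp [crossing, ha]⟩

lemma exists_braid (a : ℕ) : ∃ p ∈ idemSpan k Γ ν,
    𝖣 (a + 1) * 𝖣 a * 𝖣 (a + 1) = 𝖣 a * 𝖣 (a + 1) * 𝖣 a + p :=
  exists_eq_add_idemSpan fun j => braid a j

lemma dot_mem_grading (a : ℕ) : 𝖷 a ∈ grading k Γ ν 2 := by
  by_cases h : a < ν.degree
  · rw [dot, dif_pos h]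
    exact sum_mem fun j _ => Submodule.subset_span ⟨[Gen.dot a h j], by simp [Gen.deg], by simp⟩
  · simp [dot, h]

/-- The degree of a crossing depends on the labels, so the total `crossing` need not be homogeneous;
its pieces at the single idempotents are. -/
lemma crossing_mul_idem_mem_grading (a : ℕ) (j : Seq ν) : ∃ d : ℤ, 𝖣 a * 𝖤 j ∈ grading k Γ ν d := by
  by_cases h : a + 1 < ν.degree
  · rw [crossing_mul_idem_eq_gen h]
    exact ⟨_, Submodule.subset_span ⟨[Gen.cross a h j], rfl, by simp⟩⟩
  · exact ⟨0, by simp [crossing, h]⟩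

lemma crossing_mul_idem_mem_grading_of_eq {a : ℕ} {j : Seq ν} (hj : j.label a = j.label (a + 1)) :
    𝖣 a * 𝖤 j ∈ grading k Γ ν (-2) := by
  by_cases h : a + 1 < ν.degree
  · rw [crossing_mul_idem_eq_gen h]
    refine Submodule.subset_span ⟨[Gen.cross a h j], ?_, by simp⟩
    simp [Gen.deg, cartan, (j.label_eq_iff h).1 hj]
  · simp [crossing, h]

end Relations

lemma swap_succ_mem {s r a b : ℕ} (hb : s ≤ b) (hb' : b + 1 < r) (ha : s ≤ a) (ha' : a < r) :
    s ≤ Equiv.swap b (b + 1) a ∧ Equiv.swap b (b + 1) a < r := by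
  rcases eq_or_ne a b with rfl | h1
  · rw [Equiv.swap_apply_left]
    omega
  rcases eq_or_ne a (b + 1) with rfl | h2
  · rw [Equiv.swap_apply_right]
    omega
  rw [Equiv.swap_apply_of_ne_of_ne h1 h2]
  exact ⟨ha, ha'⟩

/-! ### Stable subspaces and the strand-pulling construction -/

section Stable

variable {k : Type u} [Field k] {I : Type v} {Γ : SimpleGraph I} {ν : I →₀ ℕ}
variable {Y : Type*} [AddCommGroup Y] [Module k Y] [Module (R k Γ ν) Y] [IsScalarTower k (R k Γ ν) Y]

local notation "𝖷" => dot k Γ ν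
local notation "𝖣" => crossing k Γ ν
local notation "𝖤" => idem k Γ

lemma smul_mem_of_mem_span {g : R k Γ ν} {s : Set Y} {N : Submodule k Y} (h : ∀ x ∈ s, g • x ∈ N)
    {x : Y} (hx : x ∈ Submodule.span k s) : g • x ∈ N :=
  (Submodule.span_le.2 h : Submodule.span k s ≤ N.comap (Algebra.lsmul k k Y g)) hx

lemma sum_idem_smul (x : Y) : ∑ j : Seq ν, 𝖤 j • x = x := by
  rw [← Finset.sum_smul, sum_idem, one_smul]

variable (k Γ ν) in
/-- Stability of a subspace under the idempotents, the dots on the first `r` strands, and the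
crossings of these strands, except for the crossing of the strands in positions `q - 1` and `q`. -/
structure Stable (r q : ℕ) (N : Submodule k Y) : Prop where
  idem_smul : ∀ j : Seq ν, ∀ x ∈ N, 𝖤 j • x ∈ N
  dot_smul : ∀ a < r, ∀ x ∈ N, 𝖷 a • x ∈ N
  crossing_smul : ∀ a, a + 1 < r → a + 1 ≠ q → ∀ x ∈ N, 𝖣 a • x ∈ N

lemma idemSpan_smul_mem {N : Submodule k Y} (hN : ∀ j : Seq ν, ∀ x ∈ N, 𝖤 j • x ∈ N) {p : R k Γ ν}
    (hp : p ∈ idemSpan k Γ ν) {x : Y} (hx : x ∈ N) : p • x ∈ N := by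
  induction hp using Submodule.span_induction with
  | mem p hp =>
    obtain ⟨j, rfl⟩ := hp
    exact hN j x hx
  | zero => simp
  | add p p' _ _ h h' => rw [add_smul]; exact add_mem h h'
  | smul c p _ h => rw [smul_assoc]; exact N.smul_mem c h

/-- A double crossing is a combination of idempotents and dots, so stability under the crossing
itself is not needed. -/
lemma crossing_sq_smul_mem {N : Submodule k Y} (hN : ∀ j : Seq ν, ∀ x ∈ N, 𝖤 j • x ∈ N) {a : ℕ}
    (h1 : ∀ x ∈ N, 𝖷 a • x ∈ N) (h2 : ∀ x ∈ N, 𝖷 (a + 1) • x ∈ N) {x : Y} (hx : x ∈ N) :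
    𝖣 a • 𝖣 a • x ∈ N := by
  have : 𝖣 a • 𝖣 a • x = ∑ j, (𝖣 a * 𝖣 a * 𝖤 j) • x := by
    simp only [mul_smul, ← Finset.smul_sum, sum_idem_smul]
  rw [this]
  refine sum_mem fun j _ => ?_
  obtain ⟨c, d, e⟩ := crossing_sq (k := k) (Γ := Γ) a j
  rw [e, add_smul, smul_assoc, smul_assoc, mul_smul, add_smul]
  exact add_mem (N.smul_mem _ (hN j x hx))
    (N.smul_mem _ (add_mem (h1 _ (hN j x hx)) (h2 _ (hN j x hx))))

/-! ### Pulling one strand to the left -/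

variable (k Γ ν) in
/-- The diagram that moves the strand in position `q` to the left by `t` positions. -/
def pull (q : ℕ) : ℕ → R k Γ ν
  | 0 => 1
  | t + 1 => 𝖣 (q - (t + 1)) * pull q t

/-- The pull only touches the positions from `q - t` to `q`, and both strands of the crossing lie to
the left of these. -/
lemma crossing_mul_pull {q a t : ℕ} (h : a + 1 + t < q) :
    𝖣 a * pull k Γ ν q t = pull k Γ ν q t * 𝖣 a := by
  induction t with
  | zero => simp [pull]
  | succ t ih =>
    rw [pull, ← mul_assoc, crossing_mul_crossing (by omega), mul_assoc, ih (by omega), mul_assoc]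

lemma crossing_mul_pull_of_gt {q a t : ℕ} (h : q < a) (ht : t ≤ q) :
    𝖣 a * pull k Γ ν q t = pull k Γ ν q t * 𝖣 a := by
  induction t with
  | zero => simp [pull]
  | succ t ih =>
    rw [pull, ← mul_assoc, ← crossing_mul_crossing (by omega), mul_assoc, ih (by omega), mul_assoc]

lemma exists_mul_pull {p : R k Γ ν} (hp : p ∈ idemSpan k Γ ν) (q t : ℕ) :
    ∃ p' ∈ idemSpan k Γ ν, p * pull k Γ ν q t = pull k Γ ν q t * p' := by
  induction t generalizing p with
  | zero => exact ⟨p, hp, by simp [pull]⟩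
  | succ t ih =>
    obtain ⟨p', hp', e⟩ := exists_mul_crossing hp (q - (t + 1))
    obtain ⟨p'', hp'', e'⟩ := ih hp'
    exact ⟨p'', hp'', by rw [pull, ← mul_assoc, e, mul_assoc, e', mul_assoc]⟩

variable (k Γ ν) in
/-- The sum of the images of a subspace under pulling the strand in position `q` to the left by at
most `t` positions. -/
def pullSpan (q t : ℕ) (V : Submodule k Y) : Submodule k Y :=
  Submodule.span k {y | ∃ u ≤ t, ∃ v ∈ V, y = pull k Γ ν q u • v}

variable {r q : ℕ} {V : Submodule k Y}

lemma pull_smul_mem {u t : ℕ} (h : u ≤ t) {v : Y} (hv : v ∈ V) :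
    pull k Γ ν q u • v ∈ pullSpan k Γ ν q t V :=
  Submodule.subset_span ⟨u, h, v, hv, rfl⟩

lemma le_pullSpan (t : ℕ) : V ≤ pullSpan k Γ ν q t V := fun v hv => by
  simpa [pull] using pull_smul_mem (k := k) (Γ := Γ) (ν := ν) (q := q) (Nat.zero_le t) hv

lemma pullSpan_mono {t t' : ℕ} (h : t ≤ t') : pullSpan k Γ ν q t V ≤ pullSpan k Γ ν q t' V :=
  Submodule.span_mono fun _ ⟨u, hu, hv⟩ => ⟨u, hu.trans h, hv⟩

lemma idem_smul_mem_pullSpan (hV : Stable k Γ ν r q V) (t : ℕ) (j : Seq ν) {x : Y}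
    (hx : x ∈ pullSpan k Γ ν q t V) : 𝖤 j • x ∈ pullSpan k Γ ν q t V := by
  refine smul_mem_of_mem_span ?_ hx
  rintro _ ⟨u, hu, v, hv, rfl⟩
  obtain ⟨p, hp, e⟩ := exists_mul_pull (p := 𝖤 j) (Submodule.subset_span ⟨j, rfl⟩) q u
  rw [← mul_smul, e, mul_smul]
  exact pull_smul_mem hu (idemSpan_smul_mem hV.idem_smul hp hv)

/-- The crossing lengthens a pull by exactly `t` positions; it commutes with shorter pulls and then
acts on `V`, where it is not the excluded crossing in position `q - 1`. -/
lemma crossing_smul_mem_pullSpan_succ (hV : Stable k Γ ν r q V) (hq : q < r) {t : ℕ}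
    (ht : t < q) {x : Y} (hx : x ∈ pullSpan k Γ ν q t V) :
    𝖣 (q - (t + 1)) • x ∈ pullSpan k Γ ν q (t + 1) V := by
  refine smul_mem_of_mem_span ?_ hx
  rintro _ ⟨u, hu, v, hv, rfl⟩
  rcases hu.eq_or_lt with rfl | hu
  · rw [← mul_smul]
    exact pull_smul_mem le_rfl hv
  · rw [← mul_smul, crossing_mul_pull (by omega), mul_smul]
    exact pull_smul_mem (by omega) (hV.crossing_smul _ (by omega) (by omega) v hv)

/-- The dot slides through the leftmost crossing of the pull. The error term removes this crossing
and leaves a shorter pull, which lies in the span. -/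
lemma dot_smul_mem_pullSpan (hV : Stable k Γ ν r q V) (hq : q < r) {t : ℕ} (ht : t ≤ q) {a : ℕ}
    (ha : a < r) {x : Y} (hx : x ∈ pullSpan k Γ ν q t V) : 𝖷 a • x ∈ pullSpan k Γ ν q t V := by
  refine smul_mem_of_mem_span ?_ hx
  rintro _ ⟨u, hu, v, hv, rfl⟩
  refine pullSpan_mono hu ?_
  replace hu := hu.trans ht
  clear hx x
  induction u generalizing a with
  | zero =>
    rw [pull, one_smul]
    exact le_pullSpan _ (hV.dot_smul a ha v hv)
  | succ u ih =>
    obtain ⟨p, hp, e⟩ := exists_dot_mul_crossing (k := k) (Γ := Γ) (ν := ν) (q - (u + 1)) a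
    rw [pull, mul_smul, ← mul_smul, e, add_smul, mul_smul]
    refine add_mem (crossing_smul_mem_pullSpan_succ hV hq (by omega) (ih
      (swap_succ_mem (Nat.zero_le _) (by omega) (Nat.zero_le _) ha).2 (by omega))) ?_
    exact pullSpan_mono (Nat.le_succ u) (idemSpan_smul_mem
      (fun j x hx => idem_smul_mem_pullSpan hV _ j hx) hp (pull_smul_mem le_rfl hv))

/-- A crossing strictly to the right of the leftmost crossing of the pull, and left of position `q`,
moves inwards until it is next to the leftmost one. There the braid relation turns it into a
crossing to the right of the whole pull, shifted by one position to the left; it is absorbed by `V`,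
and the error is a pull shorter by two. -/
lemma crossing_smul_pull_smul_mem (hV : Stable k Γ ν r q V) (hq : q < r) {t : ℕ} (ht : t ≤ q)
    {a : ℕ} (ha : q < a + t) (ha' : a < q) {v : Y} (hv : v ∈ V) :
    𝖣 a • pull k Γ ν q t • v ∈ pullSpan k Γ ν q t V := by
  induction t with
  | zero => omega
  | succ t ih =>
    rcases eq_or_ne a (q - (t + 1) + 1) with rfl | hne
    · obtain ⟨t, rfl⟩ : ∃ t', t = t' + 1 := ⟨t - 1, by omega⟩
      set b := q - (t + 1 + 1) with hb
      have hb' : q - (t + 1) = b + 1 := by omega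
      rw [pull, pull, hb', ← hb]
      obtain ⟨p, hp, e⟩ := exists_braid (k := k) (Γ := Γ) (ν := ν) b
      have e' : (𝖣 (b + 1) * (𝖣 b * (𝖣 (b + 1) * pull k Γ ν q t)))
          = 𝖣 b * (𝖣 (b + 1) * pull k Γ ν q t) * 𝖣 b + p * pull k Γ ν q t := by
        rw [← mul_assoc, ← mul_assoc, e, add_mul, mul_assoc (𝖣 b * 𝖣 (b + 1)),
          crossing_mul_pull (by omega), ← mul_assoc, mul_assoc (𝖣 b) (𝖣 (b + 1))]
      rw [← mul_smul, e', add_smul, mul_smul _ (𝖣 b), mul_smul p]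
      refine add_mem ?_ (pullSpan_mono (by omega) (idemSpan_smul_mem
        (fun j x hx => idem_smul_mem_pullSpan hV _ j hx) hp (pull_smul_mem (le_refl t) hv)))
      have := pull_smul_mem (k := k) (Γ := Γ) (ν := ν) (q := q) (le_refl (t + 1 + 1))
        (hV.crossing_smul b (by omega) (by omega) v hv)
      rwa [pull, pull, hb', ← hb] at this
    · rw [pull, ← mul_smul, ← mul_assoc, ← crossing_mul_crossing (by omega), mul_assoc, mul_smul,
        mul_smul]
      exact crossing_smul_mem_pullSpan_succ hV hq (by omega) (ih (by omega) (by omega))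

/-- The pulls of length `0, …, q` correspond to the minimal coset representatives of `S_q × S_1` in
`S_{q+1}`: the strand in position `q` joins the left group, so the excluded crossing moves from `q -
1` to `q`. -/
lemma Stable.pullSpan (hV : Stable k Γ ν r q V) (hq : q < r) :
    Stable k Γ ν r (q + 1) (pullSpan k Γ ν q q V) where
  idem_smul j x hx := idem_smul_mem_pullSpan hV q j hx
  dot_smul a ha x hx := dot_smul_mem_pullSpan hV hq le_rfl ha hx
  crossing_smul a ha haq x hx := by
    refine smul_mem_of_mem_span ?_ hx
    rintro _ ⟨u, hu, v, hv, rfl⟩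
    rcases lt_or_ge q a with h | h
    · rw [← mul_smul, crossing_mul_pull_of_gt h hu, mul_smul]
      exact pull_smul_mem hu (hV.crossing_smul a ha (by omega) v hv)
    have hq' : a < q := by omega
    -- The leftmost crossing of the pull is in position `q - u`. To the right of it the braid
    -- argument applies, and at it a double crossing arises. To the left of it the crossing either
    -- extends the pull or commutes with it.
    rcases lt_trichotomy q (a + u) with h | h | h
    · exact pullSpan_mono hu (crossing_smul_pull_smul_mem hV hq hu h hq' hv)
    · obtain ⟨u, rfl⟩ : ∃ t', u = t' + 1 := ⟨u - 1, by omega⟩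
      obtain rfl : a = q - (u + 1) := by omega
      rw [pull, mul_smul]
      exact crossing_sq_smul_mem (fun j x hx => idem_smul_mem_pullSpan hV _ j hx)
        (fun x hx => dot_smul_mem_pullSpan hV hq le_rfl (by omega) hx)
        (fun x hx => dot_smul_mem_pullSpan hV hq le_rfl (by omega) hx)
        (pull_smul_mem (by omega) hv)
    · rcases Nat.lt_or_ge (a + 1 + u) q with h' | h'
      · rw [← mul_smul, crossing_mul_pull h', mul_smul]
        exact pull_smul_mem hu (hV.crossing_smul a (by omega) (by omega) v hv)
      · obtain rfl : a = q - (u + 1) := by omega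
        rw [← mul_smul]
        exact pull_smul_mem (t := q) (u := u + 1) (by omega) hv

end Stable

/-! ### Weights, blocks of equal labels and generated subspaces -/

section Weights

variable {k : Type u} [Field k] {I : Type v} {Γ : SimpleGraph I} {ν : I →₀ ℕ}
variable {Y : Type*} [AddCommGroup Y] [Module k Y] [Module (R k Γ ν) Y] [IsScalarTower k (R k Γ ν) Y]

local notation "𝖷" => dot k Γ ν
local notation "𝖣" => crossing k Γ ν
local notation "𝖤" => idem k Γ

variable (k Γ Y) in
/-- The sum of the weight spaces for the weights in a set `J`. -/
def weightSum (J : Set (Seq ν)) : Submodule k Y where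
  carrier := {x | ∀ j ∉ J, 𝖤 j • x = 0}
  add_mem' hx hy j hj := by rw [smul_add, hx j hj, hy j hj, add_zero]
  zero_mem' j _ := smul_zero _
  smul_mem' c x hx j hj := by rw [smul_comm, hx j hj, smul_zero]

lemma eq_zero_of_idem_smul {x : Y} (h : ∀ j : Seq ν, 𝖤 j • x = 0) : x = 0 := by
  rw [← sum_idem_smul (k := k) (Γ := Γ) (ν := ν) x]
  exact Finset.sum_eq_zero fun j _ => h j

lemma weightSum_mono {J J' : Set (Seq ν)} (h : J ⊆ J') : weightSum k Γ Y J ≤ weightSum k Γ Y J' :=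
  fun _ hx j hj => hx j fun hj' => hj (h hj')

lemma eq_zero_of_mem_weightSum {J J' : Set (Seq ν)} (h : Disjoint J J') {x : Y}
    (hx : x ∈ weightSum k Γ Y J) (hx' : x ∈ weightSum k Γ Y J') : x = 0 :=
  eq_zero_of_idem_smul (k := k) (Γ := Γ) (ν := ν) fun j => by
    by_cases hj : j ∈ J
    · exact hx' j (Set.disjoint_left.1 h hj)
    · exact hx j hj

lemma idem_smul_mem_weightSum {J : Set (Seq ν)} (i : Seq ν) {x : Y}
    (hx : x ∈ weightSum k Γ Y J) : 𝖤 i • x ∈ weightSum k Γ Y J := fun j hj => by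
  rcases eq_or_ne j i with rfl | h
  · rw [hx j hj, smul_zero]
  · rw [← mul_smul, idem_mul_idem_of_ne h, zero_smul]

lemma dot_smul_mem_weightSum {J : Set (Seq ν)} (a : ℕ) {x : Y}
    (hx : x ∈ weightSum k Γ Y J) : 𝖷 a • x ∈ weightSum k Γ Y J := fun j hj => by
  rw [← mul_smul, idem_mul_dot, mul_smul, hx j hj, smul_zero]

lemma crossing_smul_mem_weightSum {J : Set (Seq ν)} (a : ℕ) {x : Y}
    (hx : x ∈ weightSum k Γ Y J) : 𝖣 a • x ∈ weightSum k Γ Y {j | j.flip a ∈ J} := fun j hj => by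
  rw [← mul_smul, idem_mul_crossing, mul_smul, hx _ hj, smul_zero]

/-- The bottom sequence of the diagram that moves the strand in position `q` to the left by `t`
positions, in terms of its top sequence. -/
def Seq.unpull (q : ℕ) : ℕ → Seq ν → Seq ν
  | 0, j => j
  | t + 1, j => Seq.unpull q t (j.flip (q - (t + 1)))

lemma pull_smul_mem_weightSum {J : Set (Seq ν)} (q t : ℕ) {x : Y} (hx : x ∈ weightSum k Γ Y J) :
    pull k Γ ν q t • x ∈ weightSum k Γ Y {j | j.unpull q t ∈ J} := by
  induction t with
  | zero => simpa [pull, Seq.unpull] using hx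
  | succ t ih =>
    rw [pull, mul_smul]
    exact crossing_smul_mem_weightSum _ ih

/-- Read from top to bottom, the entry in position `q - t` returns to position `q`, and the entries
it had overtaken move back by one position to the left. -/
lemma Seq.label_unpull {q t : ℕ} (hq : q < ν.degree) (ht : t ≤ q) (j : Seq ν) (b : ℕ) :
    (j.unpull q t).label b =
      j.label (if b < q - t ∨ q < b then b else if b = q then q - t else b + 1) := by
  induction t generalizing j with
  | zero =>
    rw [unpull]
    congr 1
    split_ifs <;> omega
  | succ t ih =>
    rw [unpull, ih (by omega), label_flip (by omega)]
    congr 1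
    rw [Equiv.swap_apply_def]
    split_ifs <;> omega

/-- The sequences with label `i` in the positions from `s` to `r - 1`. -/
def blockSeq (ν : I →₀ ℕ) (s r : ℕ) (i : I) : Set (Seq ν) :=
  {j | ∀ a, s ≤ a → a < r → j.label a = some i}

/-- The sequences that do not have label `i` in position `s - 1`. -/
def avoidSeq (ν : I →₀ ℕ) (s : ℕ) (i : I) : Set (Seq ν) :=
  {j | 0 < s → j.label (s - 1) ≠ some i}

variable {s r : ℕ} {i : I}

/-- Pulling strands to the left from a block with labels `i` that is not preceded by `i` leads out
of the weights with label `i` on the block. -/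
lemma exists_stable_of_block {V : Submodule k Y} (hr : r ≤ ν.degree) (hV : Stable k Γ ν r s V)
    (hV' : V ≤ weightSum k Γ Y (blockSeq ν s r i ∩ avoidSeq ν s i)) (t : ℕ) (ht : s + t ≤ r) :
    ∃ Z, Stable k Γ ν r (s + t) Z ∧ V ≤ Z ∧
      Z ≤ V ⊔ weightSum k Γ Y
        (blockSeq ν (s + t) r i ∩ {j | ∃ a, s ≤ a ∧ a < s + t ∧ j.label a ≠ some i}) := by
  induction t with
  | zero => exact ⟨V, hV, le_rfl, le_sup_left⟩
  | succ t ih =>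
    obtain ⟨Z, hZ, hVZ, hZV⟩ := ih (by omega)
    -- The strands of the block join the stable group on the left one at a time; now it is the turn
    -- of the strand in position `s + t`.
    refine ⟨pullSpan k Γ ν (s + t) (s + t) Z, hZ.pullSpan (by omega), hVZ.trans (le_pullSpan _),
      Submodule.span_le.2 ?_⟩
    rintro _ ⟨u, hu, z, hz, rfl⟩
    obtain ⟨v, hv, y, hy, rfl⟩ := Submodule.mem_sup.1 (hZV hz)
    rw [smul_add]
    refine add_mem ?_ (Submodule.mem_sup_right
      (weightSum_mono ?_ (pull_smul_mem_weightSum (s + t) u hy)))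
    -- A pull by at most `t` positions stays inside the block. Its crossings are in positions at
    -- least `s`, and `V` is stable under these.
    · rcases le_or_gt u t with h | h
      · refine Submodule.mem_sup_left ?_
        clear hu
        induction u with
        | zero => rwa [pull, one_smul]
        | succ u ih =>
          rw [pull, mul_smul]
          exact hV.crossing_smul _ (by omega) (by omega) _ (ih (by omega))
      -- A longer pull leaves the block, and the entry from position `s - 1`, which is not `i`,
      -- lands in position `s`.
      · refine Submodule.mem_sup_right
          (weightSum_mono ?_ (pull_smul_mem_weightSum (s + t) u (hV' hv)))
        rintro j ⟨h1, h2⟩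
        refine ⟨fun a ha ha' => ?_, s, le_rfl, by omega, ?_⟩
        · have := h1 a (by omega) ha'
          rwa [Seq.label_unpull (by omega) hu, if_pos (by omega)] at this
        · have := h2 (by omega)
          rwa [Seq.label_unpull (by omega) hu, if_neg (by omega), if_neg (by omega),
            Nat.sub_add_cancel (by omega)] at this
    -- A foreign label already inside the block moves by at most one position to the right: the
    -- pulled strand has label `i`, so it is not the foreign one and can only overtake it.
    · rintro j ⟨h1, a, ha, ha', h2⟩
      rw [Seq.label_unpull (by omega) hu] at h2
      refine ⟨fun b hb hb' => ?_, _, ?_, ?_, h2⟩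
      · have := h1 b (by omega) hb'
        rwa [Seq.label_unpull (by omega) hu, if_pos (by omega)] at this
      · split_ifs <;> omega
      · split_ifs <;> omega

variable (k Γ ν) in
/-- The smallest `r`-stable subspace that contains a given one. -/
def generate (r : ℕ) (V : Submodule k Y) : Submodule k Y :=
  sInf {W | V ≤ W ∧ Stable k Γ ν r 0 W}

lemma le_generate (r : ℕ) (V : Submodule k Y) : V ≤ generate k Γ ν r V :=
  le_sInf fun _ h => h.1

lemma generate_le {V W : Submodule k Y} (h : V ≤ W) (hW : Stable k Γ ν r 0 W) :
    generate k Γ ν r V ≤ W := sInf_le ⟨h, hW⟩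

lemma stable_generate (r : ℕ) (V : Submodule k Y) : Stable k Γ ν r 0 (generate k Γ ν r V) where
  idem_smul j x hx := (Submodule.mem_sInf).2 fun W hW =>
    hW.2.idem_smul j x (Submodule.mem_sInf.1 hx W hW)
  dot_smul a ha x hx := (Submodule.mem_sInf).2 fun W hW =>
    hW.2.dot_smul a ha x (Submodule.mem_sInf.1 hx W hW)
  crossing_smul a ha ha' x hx := (Submodule.mem_sInf).2 fun W hW =>
    hW.2.crossing_smul a ha ha' x (Submodule.mem_sInf.1 hx W hW)

variable (k Γ ν) in
/-- The smallest subspace that contains a given one and is stable under the dots in the positions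
from `s` to `r - 1`. -/
def dotSpan (s r : ℕ) (V : Submodule k Y) : Submodule k Y :=
  sInf {W | V ≤ W ∧ ∀ a, s ≤ a → a < r → ∀ x ∈ W, 𝖷 a • x ∈ W}

lemma le_dotSpan (s r : ℕ) (V : Submodule k Y) : V ≤ dotSpan k Γ ν s r V :=
  le_sInf fun _ h => h.1

lemma dotSpan_le {V W : Submodule k Y} (h : V ≤ W)
    (hW : ∀ a, s ≤ a → a < r → ∀ x ∈ W, 𝖷 a • x ∈ W) : dotSpan k Γ ν s r V ≤ W := sInf_le ⟨h, hW⟩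

lemma dot_smul_mem_dotSpan {V : Submodule k Y} {a : ℕ} (h : s ≤ a) (h' : a < r) {x : Y}
    (hx : x ∈ dotSpan k Γ ν s r V) : 𝖷 a • x ∈ dotSpan k Γ ν s r V :=
  (Submodule.mem_sInf).2 fun W hW => hW.2 a h h' x (Submodule.mem_sInf.1 hx W hW)

/-- Elements that commute with the dots preserve the span. -/
lemma smul_mem_dotSpan {V : Submodule k Y} {g : R k Γ ν}
    (hg : ∀ a, s ≤ a → a < r → g * 𝖷 a = 𝖷 a * g) (hV : ∀ x ∈ V, g • x ∈ V) {x : Y}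
    (hx : x ∈ dotSpan k Γ ν s r V) : g • x ∈ dotSpan k Γ ν s r V := by
  refine (dotSpan_le (W := (dotSpan k Γ ν s r V).comap (Algebra.lsmul k k Y g))
    (fun x hx => le_dotSpan _ _ _ (hV x hx)) fun a ha ha' x hx => ?_) hx
  change g • 𝖷 a • x ∈ dotSpan k Γ ν s r V
  rw [← mul_smul, hg a ha ha', mul_smul]
  exact dot_smul_mem_dotSpan ha ha' hx

/-- A crossing of the block passes through polynomials in the dots up to lower terms and then kills
`V`. Everything to the left of the block commutes with these dots. Only the crossing that joins the
two parts, in position `s - 1`, is excluded. -/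
lemma stable_dotSpan {V : Submodule k Y} (hV : Stable k Γ ν s 0 V)
    (hV' : ∀ a, s ≤ a → a + 1 < r → ∀ x ∈ V, 𝖣 a • x = 0) :
    Stable k Γ ν r s (dotSpan k Γ ν s r V) where
  idem_smul j x hx := smul_mem_dotSpan (fun a _ _ => idem_mul_dot a j) (hV.idem_smul j) hx
  dot_smul a ha x hx := by
    rcases le_or_gt s a with h | h
    · exact dot_smul_mem_dotSpan h ha hx
    · exact smul_mem_dotSpan (fun b _ _ => dot_mul_dot a b) (hV.dot_smul a h) hx
  crossing_smul a ha ha' x hx := by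
    rcases le_or_gt s a with h | h
    -- Induction over the dots needs both that a vector is in the span and that its image under the
    -- crossing is, because the sliding error is an idempotent combination applied to the vector
    -- itself.
    · refine (dotSpan_le (W := dotSpan k Γ ν s r V ⊓
        (dotSpan k Γ ν s r V).comap (Algebra.lsmul k k Y (𝖣 a)))
        (fun x hx => ⟨le_dotSpan _ _ _ hx, ?_⟩) (fun b hb hb' x hx => ?_) hx).2
      · change 𝖣 a • x ∈ dotSpan k Γ ν s r V
        rw [hV' a h ha x hx]
        exact zero_mem _
      · refine ⟨dot_smul_mem_dotSpan hb hb' hx.1, ?_⟩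
        change 𝖣 a • 𝖷 b • x ∈ dotSpan k Γ ν s r V
        obtain ⟨p, hp, e⟩ := exists_dot_mul_crossing (k := k) (Γ := Γ) (ν := ν) a
          (Equiv.swap a (a + 1) b)
        rw [Equiv.swap_apply_self, ← sub_eq_iff_eq_add] at e
        rw [← mul_smul, ← e, sub_smul, mul_smul]
        have hb2 := swap_succ_mem h ha hb hb'
        exact sub_mem (dot_smul_mem_dotSpan hb2.1 hb2.2 hx.2) (idemSpan_smul_mem
          (fun j x hx => smul_mem_dotSpan (fun a _ _ => idem_mul_dot a j) (hV.idem_smul j) hx)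
          hp hx.1)
    · exact smul_mem_dotSpan (fun b hb _ => crossing_mul_dot (by omega) (by omega))
        (hV.crossing_smul a (by omega) (by omega)) hx

/-- The part with label `i` on a block of the subspace generated by singular vectors. -/
lemma mem_dotSpan_of_mem_generate {V : Submodule k Y} (hs : s ≤ r) (hr : r ≤ ν.degree)
    (hV : Stable k Γ ν s 0 V) (hV' : ∀ a, s ≤ a → a + 1 < r → ∀ x ∈ V, 𝖣 a • x = 0)
    (hw : V ≤ weightSum k Γ Y (blockSeq ν s r i ∩ avoidSeq ν s i)) {x : Y}
    (hx : x ∈ generate k Γ ν r V) (hx' : x ∈ weightSum k Γ Y (blockSeq ν s r i)) :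
    x ∈ dotSpan k Γ ν s r V := by
  have hw' : dotSpan k Γ ν s r V ≤ weightSum k Γ Y (blockSeq ν s r i ∩ avoidSeq ν s i) :=
    dotSpan_le hw fun a _ _ x hx => dot_smul_mem_weightSum a hx
  -- For `t = r - s` the excluded crossing would be in position `r - 1`, hence is not among those of
  -- the first `r` strands, and `Z` is stable under all of them.
  obtain ⟨Z, hZ, hVZ, hZV⟩ := exists_stable_of_block hr (stable_dotSpan hV hV') hw' (r - s)
    (by omega)
  have hZ' : Stable k Γ ν r 0 Z := ⟨hZ.idem_smul, hZ.dot_smul,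
    fun a ha _ => hZ.crossing_smul a ha (by omega)⟩
  obtain ⟨v, hv, y, hy, rfl⟩ := Submodule.mem_sup.1
    (hZV (generate_le ((le_dotSpan _ _ _).trans hVZ) hZ' hx))
  have hy' : y ∈ weightSum k Γ Y (blockSeq ν s r i) := by
    have := sub_mem hx' (weightSum_mono Set.inter_subset_left (hw' hv))
    rwa [add_sub_cancel_left] at this
  -- The remainder has a label different from `i` somewhere in the block, yet also only weights with
  -- the full block.
  have : y = 0 := by
    refine eq_zero_of_mem_weightSum (Set.disjoint_left.2 fun j h1 h2 => ?_) hy' hy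
    obtain ⟨a, ha, ha', h⟩ := h2.2
    exact h (h1 a ha (by omega))
  rwa [this, add_zero]

end Weights

/-! ### Gradings and simple stable subspaces -/

section Graded

variable {k : Type u} [Field k] {I : Type v} {Γ : SimpleGraph I} {ν : I →₀ ℕ}
variable {Y : Type*} [AddCommGroup Y] [Module k Y] [Module (R k Γ ν) Y] [IsScalarTower k (R k Γ ν) Y]
variable {Y' : Type*} [AddCommGroup Y'] [Module k Y'] [Module (R k Γ ν) Y']
  [IsScalarTower k (R k Γ ν) Y']

local notation "𝖷" => dot k Γ ν
local notation "𝖣" => crossing k Γ ν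
local notation "𝖤" => idem k Γ

variable (k Γ ν) in
/-- The projections to the homogeneous parts of a graded module that is bounded below. -/
structure IsGrading (π : ℤ → Y →ₗ[k] Y) : Prop where
  proj_self : ∀ n x, π n (π n x) = π n x
  proj_of_ne : ∀ {m n}, m ≠ n → ∀ x, π m (π n x) = 0
  smul_proj : ∀ {d : ℤ} {g : R k Γ ν}, g ∈ grading k Γ ν d → ∀ n x, g • π n x = π (d + n) (g • x)
  exists_sum : ∀ x, ∃ s : Finset ℤ, ∑ n ∈ s, π n x = x
  bounded : ∃ b : ℤ, ∀ n < b, π n = 0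

/-- A subspace is homogeneous if it contains the homogeneous components of its elements. -/
def IsHomog (π : ℤ → Y →ₗ[k] Y) (N : Submodule k Y) : Prop := ∀ n, ∀ x ∈ N, π n x ∈ N

variable {π : ℤ → Y →ₗ[k] Y} {π' : ℤ → Y' →ₗ[k] Y'}

lemma IsGrading.proj_smul (hπ : IsGrading k Γ ν π) {d : ℤ} {g : R k Γ ν}
    (hg : g ∈ grading k Γ ν d) (n : ℤ) (x : Y) : π n (g • x) = g • π (n - d) x := by
  rw [hπ.smul_proj hg, add_sub_cancel]

lemma IsGrading.eq_zero (hπ : IsGrading k Γ ν π) {x : Y} (h : ∀ n, π n x = 0) : x = 0 := by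
  obtain ⟨s, hs⟩ := hπ.exists_sum x
  rw [← hs]
  exact Finset.sum_eq_zero fun n _ => h n

lemma IsGrading.sum_eq_of_subset (hπ : IsGrading k Γ ν π) {x : Y} {s t : Finset ℤ}
    (hs : ∑ n ∈ s, π n x = x) (hst : s ⊆ t) : ∑ n ∈ t, π n x = x := by
  rw [← Finset.sum_subset hst, hs]
  intro n _ hn
  rw [← hs, map_sum]
  exact Finset.sum_eq_zero fun m hm => hπ.proj_of_ne (by rintro rfl; exact hn hm) x

lemma IsGrading.prod (hπ : IsGrading k Γ ν π) (hπ' : IsGrading k Γ ν π') :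
    IsGrading k Γ ν (fun n => (π n).prodMap (π' n)) where
  proj_self n x := Prod.ext (hπ.proj_self n x.1) (hπ'.proj_self n x.2)
  proj_of_ne h x := Prod.ext (hπ.proj_of_ne h x.1) (hπ'.proj_of_ne h x.2)
  smul_proj hg n x := Prod.ext (hπ.smul_proj hg n x.1) (hπ'.smul_proj hg n x.2)
  exists_sum x := by
    obtain ⟨s, hs⟩ := hπ.exists_sum x.1
    obtain ⟨t, ht⟩ := hπ'.exists_sum x.2
    refine ⟨s ∪ t, Prod.ext ?_ ?_⟩
    · rw [Prod.fst_sum]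
      exact hπ.sum_eq_of_subset hs Finset.subset_union_left
    · rw [Prod.snd_sum]
      exact hπ'.sum_eq_of_subset ht Finset.subset_union_right
  bounded := by
    obtain ⟨b, hb⟩ := hπ.bounded
    obtain ⟨b', hb'⟩ := hπ'.bounded
    refine ⟨min b b', fun n hn => ?_⟩
    rw [hb n (hn.trans_le (min_le_left _ _)), hb' n (hn.trans_le (min_le_right _ _))]
    ext <;> rfl

/-- A nonzero homogeneous subspace contains a nonzero homogeneous element of lowest degree. -/
lemma IsGrading.exists_lowest (hπ : IsGrading k Γ ν π) {N : Submodule k Y} (hN : N ≠ ⊥) :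
    ∃ n, (∃ x ∈ N, π n x ≠ 0) ∧ ∀ m < n, ∀ x ∈ N, π m x = 0 := by
  obtain ⟨b, hb⟩ := hπ.bounded
  obtain ⟨x, hx, hx0⟩ := N.exists_mem_ne_zero_of_ne_bot hN
  have h1 : ∃ n, ∃ x ∈ N, π n x ≠ 0 := by
    by_contra! h
    exact hx0 (hπ.eq_zero fun n => h n x hx)
  obtain ⟨n, hn, hn'⟩ := Int.exists_least_of_bdd ⟨b, fun n ⟨x, _, hx⟩ => by
    by_contra! h
    exact hx (by rw [hb n h, LinearMap.zero_apply])⟩ h1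
  refine ⟨n, hn, fun m hm x hx => ?_⟩
  by_contra h
  exact absurd (hn' m ⟨x, hx, h⟩) (by omega)

lemma IsHomog.inf {N N' : Submodule k Y} (h : IsHomog π N) (h' : IsHomog π N') :
    IsHomog π (N ⊓ N') := fun n x hx => ⟨h n x hx.1, h' n x hx.2⟩

lemma idem_mem_grading (j : Seq ν) : 𝖤 j ∈ grading k Γ ν 0 := FMod.idem_mem j

lemma IsGrading.proj_idem_smul (hπ : IsGrading k Γ ν π) (j : Seq ν) (n : ℤ) (x : Y) :
    π n (𝖤 j • x) = 𝖤 j • π n x := by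
  rw [hπ.proj_smul (idem_mem_grading j), sub_zero]

lemma IsGrading.proj_dot_smul (hπ : IsGrading k Γ ν π) (a : ℕ) (n : ℤ) (x : Y) :
    π n (𝖷 a • x) = 𝖷 a • π (n - 2) x :=
  hπ.proj_smul (dot_mem_grading a) n x

lemma isHomog_weightSum (hπ : IsGrading k Γ ν π) (J : Set (Seq ν)) :
    IsHomog π (weightSum k Γ Y J) := fun n x hx j hj => by
  rw [← hπ.proj_idem_smul, hx j hj, map_zero]

/-- The components of `𝖣 a • x` lie in a subspace that contains the images of the components of `x`
under the elements `𝖣 a * 𝖤 j`. -/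
lemma proj_crossing_smul_mem (hπ : IsGrading k Γ ν π) {N : Submodule k Y} {a : ℕ} {x : Y}
    (h : ∀ (j : Seq ν) (n : ℤ), 𝖣 a • 𝖤 j • π n x ∈ N) (n : ℤ) : π n (𝖣 a • x) ∈ N := by
  rw [← sum_idem_smul (k := k) (Γ := Γ) (ν := ν) x, Finset.smul_sum, map_sum]
  refine sum_mem fun j _ => ?_
  obtain ⟨d, hd⟩ := crossing_mul_idem_mem_grading (k := k) (Γ := Γ) a j
  rw [← mul_smul, hπ.proj_smul hd, mul_smul]
  exact h j _

/-- The vectors of the generated subspace whose homogeneous components all lie in it form a stable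
subspace `W` containing `V`, hence everything. Crossings are handled one idempotent at a time, as
they are not homogeneous otherwise. -/
lemma isHomog_generate (hπ : IsGrading k Γ ν π) {V : Submodule k Y} (hV : IsHomog π V) (r : ℕ) :
    IsHomog π (generate k Γ ν r V) := by
  have hg := stable_generate (k := k) (Γ := Γ) (ν := ν) r V
  let W : Submodule k Y :=
    generate k Γ ν r V ⊓ ⨅ n, (generate k Γ ν r V).comap (π n)
  have hmem : ∀ x, x ∈ W ↔ x ∈ generate k Γ ν r V ∧ ∀ n, π n x ∈ generate k Γ ν r V := by
    simp [W]
  have hW : Stable k Γ ν r 0 W := by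
    refine ⟨fun j x hx => ?_, fun a ha x hx => ?_, fun a ha ha' x hx => ?_⟩ <;>
      rw [hmem] at hx ⊢
    · refine ⟨hg.idem_smul j x hx.1, fun n => ?_⟩
      rw [hπ.proj_idem_smul]
      exact hg.idem_smul j _ (hx.2 n)
    · refine ⟨hg.dot_smul a ha x hx.1, fun n => ?_⟩
      rw [hπ.proj_dot_smul]
      exact hg.dot_smul a ha _ (hx.2 _)
    · exact ⟨hg.crossing_smul a ha ha' x hx.1, proj_crossing_smul_mem hπ fun j n =>
        hg.crossing_smul a ha ha' _ (hg.idem_smul j _ (hx.2 n))⟩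
  have hVW : V ≤ W := fun x hx =>
    (hmem x).2 ⟨le_generate r V hx, fun n => le_generate r V (hV n x hx)⟩
  exact fun n x hx => ((hmem x).1 (generate_le hVW hW hx)).2 n

lemma Stable.inf {r q : ℕ} {N N' : Submodule k Y} (h : Stable k Γ ν r q N)
    (h' : Stable k Γ ν r q N') : Stable k Γ ν r q (N ⊓ N') :=
  ⟨fun j x hx => ⟨h.idem_smul j x hx.1, h'.idem_smul j x hx.2⟩,
    fun a ha x hx => ⟨h.dot_smul a ha x hx.1, h'.dot_smul a ha x hx.2⟩,
    fun a ha ha' x hx => ⟨h.crossing_smul a ha ha' x hx.1, h'.crossing_smul a ha ha' x hx.2⟩⟩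

lemma Stable.of_le {r s : ℕ} (hs : s ≤ r) {N : Submodule k Y} (h : Stable k Γ ν r 0 N) :
    Stable k Γ ν s 0 N :=
  ⟨h.idem_smul, fun a ha => h.dot_smul a (by omega), fun a ha => h.crossing_smul a (by omega)⟩

/-! ### Dots, blocks and singular vectors -/

variable {s r : ℕ} {i : I}

variable (k Γ ν) in
/-- The image of the dots in the positions from `s` to `r - 1`. -/
def dotImage (s r : ℕ) (U : Submodule k Y) : Submodule k Y :=
  Submodule.span k {y | ∃ a, s ≤ a ∧ a < r ∧ ∃ x ∈ U, y = 𝖷 a • x}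

lemma dot_smul_mem_dotImage {U : Submodule k Y} {a : ℕ} (h : s ≤ a) (h' : a < r) {x : Y}
    (hx : x ∈ U) : 𝖷 a • x ∈ dotImage k Γ ν s r U :=
  Submodule.subset_span ⟨a, h, h', x, hx, rfl⟩

lemma dotImage_le {U W : Submodule k Y} (h : ∀ a, s ≤ a → a < r → ∀ x ∈ U, 𝖷 a • x ∈ W) :
    dotImage k Γ ν s r U ≤ W := by
  refine Submodule.span_le.2 ?_
  rintro _ ⟨a, ha, ha', x, hx, rfl⟩
  exact h a ha ha' x hx

lemma smul_mem_dotImage {U : Submodule k Y} {g : R k Γ ν}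
    (hg : ∀ a, s ≤ a → a < r → g * 𝖷 a = 𝖷 a * g) (hU : ∀ x ∈ U, g • x ∈ U) {x : Y}
    (hx : x ∈ dotImage k Γ ν s r U) : g • x ∈ dotImage k Γ ν s r U := by
  refine smul_mem_of_mem_span ?_ hx
  rintro _ ⟨a, ha, ha', x, hx, rfl⟩
  rw [← mul_smul, hg a ha ha', mul_smul]
  exact dot_smul_mem_dotImage ha ha' (hU x hx)

lemma isHomog_dotImage (hπ : IsGrading k Γ ν π) {U : Submodule k Y} (hU : IsHomog π U) :
    IsHomog π (dotImage k Γ ν s r U) := fun n x hx => by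
  refine (dotImage_le (W := (dotImage k Γ ν s r U).comap (π n)) fun a ha ha' x hx => ?_) hx
  rw [Submodule.mem_comap, hπ.proj_dot_smul]
  exact dot_smul_mem_dotImage ha ha' (hU _ x hx)

lemma stable_dotImage {U : Submodule k Y} (hU : Stable k Γ ν s 0 U) :
    Stable k Γ ν s 0 (dotImage k Γ ν s r U) :=
  ⟨fun j _ hx => smul_mem_dotImage (fun a _ _ => idem_mul_dot a j) (hU.idem_smul j) hx,
    fun a ha _ hx => smul_mem_dotImage (fun b _ _ => dot_mul_dot a b) (hU.dot_smul a ha) hx,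
    fun a ha ha' _ hx => smul_mem_dotImage (fun b hb _ => crossing_mul_dot (by omega) (by omega))
      (hU.crossing_smul a ha ha') hx⟩

/-- A polynomial in the dots is a constant plus terms that begin with a dot. -/
lemma dotSpan_le_sup_dotImage {V U : Submodule k Y} (h : dotSpan k Γ ν s r V ≤ U) :
    dotSpan k Γ ν s r V ≤ V ⊔ dotImage k Γ ν s r U := by
  have : dotSpan k Γ ν s r V ≤ U ⊓ (V ⊔ dotImage k Γ ν s r U) ⊓ dotSpan k Γ ν s r V :=
    dotSpan_le (fun x hx => ⟨⟨h (le_dotSpan _ _ _ hx), Submodule.mem_sup_left hx⟩,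
      le_dotSpan _ _ _ hx⟩) fun a ha ha' x hx =>
        ⟨⟨h (dot_smul_mem_dotSpan ha ha' hx.2),
          Submodule.mem_sup_right (dot_smul_mem_dotImage ha ha' hx.1.1)⟩,
          dot_smul_mem_dotSpan ha ha' hx.2⟩
  exact fun x hx => (this hx).1.2

/-- Dots have positive degree, so that they act nilpotently. -/
lemma eq_bot_of_le_dotImage (hπ : IsGrading k Γ ν π) {U : Submodule k Y}
    (h : U ≤ dotImage k Γ ν s r U) : U = ⊥ := by
  by_contra hU
  obtain ⟨n, ⟨x, hx, hx0⟩, hn⟩ := hπ.exists_lowest hU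
  have : dotImage k Γ ν s r U ≤ LinearMap.ker (π n) := dotImage_le fun a _ _ y hy => by
    rw [LinearMap.mem_ker, hπ.proj_dot_smul, hn _ (by omega) y hy, smul_zero]
  exact hx0 (this (h hx))

/-- Homogeneous stable subspaces without proper homogeneous stable subspaces. -/
structure IsSimpleSub (π : ℤ → Y →ₗ[k] Y) (r : ℕ) (N : Submodule k Y) : Prop where
  ne_bot : N ≠ ⊥
  homog : IsHomog π N
  stable : Stable k Γ ν r 0 N
  eq_of_le : ∀ N' ≤ N, N' ≠ ⊥ → IsHomog π N' → Stable k Γ ν r 0 N' → N' = N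

variable (k Γ ν) in
/-- The part of a subspace with label `i` in the positions from `s` to `r - 1`. -/
def blockPart (s r : ℕ) (i : I) (N : Submodule k Y) : Submodule k Y :=
  N ⊓ weightSum k Γ Y (blockSeq ν s r i)

variable (k Γ ν) in
/-- The vectors with label `i` in the positions from `s` to `r - 1` that are killed by all
crossings of these strands. -/
def singular (s r : ℕ) (i : I) (N : Submodule k Y) : Submodule k Y where
  carrier := {x | x ∈ blockPart k Γ ν s r i N ∧ ∀ a, s ≤ a → a + 1 < r → 𝖣 a • x = 0}
  add_mem' hx hy := ⟨add_mem hx.1 hy.1, fun a ha ha' => by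
    rw [smul_add, hx.2 a ha ha', hy.2 a ha ha', add_zero]⟩
  zero_mem' := ⟨zero_mem _, fun _ _ _ => smul_zero _⟩
  smul_mem' c x hx := ⟨Submodule.smul_mem _ c hx.1, fun a ha ha' => by
    rw [smul_comm, hx.2 a ha ha', smul_zero]⟩

lemma singular_le_blockPart (N : Submodule k Y) :
    singular k Γ ν s r i N ≤ blockPart k Γ ν s r i N := fun _ hx => hx.1

lemma stable_weightSum_blockSeq : Stable k Γ ν s 0 (weightSum k Γ Y (blockSeq ν s r i)) where
  idem_smul j x hx := idem_smul_mem_weightSum j hx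
  dot_smul a _ x hx := dot_smul_mem_weightSum a hx
  crossing_smul a ha _ x hx := by
    refine weightSum_mono ?_ (crossing_smul_mem_weightSum a hx)
    intro j hj b hb hb'
    by_cases hd : a + 1 < ν.degree
    · have := hj b hb hb'
      rwa [Seq.label_flip hd, Equiv.swap_apply_of_ne_of_ne (by omega) (by omega)] at this
    · have : j.flip a = j := dif_neg hd
      have h' : j.flip a ∈ blockSeq ν s r i := hj
      rw [this] at h'
      exact h' b hb hb'

lemma stable_blockPart (hs : s ≤ r) {N : Submodule k Y} (hN : Stable k Γ ν r 0 N) :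
    Stable k Γ ν s 0 (blockPart k Γ ν s r i N) :=
  (hN.of_le hs).inf stable_weightSum_blockSeq

lemma isHomog_blockPart (hπ : IsGrading k Γ ν π) {N : Submodule k Y} (hN : IsHomog π N) :
    IsHomog π (blockPart k Γ ν s r i N) :=
  hN.inf (isHomog_weightSum hπ _)

/-- Up to replacing an idempotent by another one, the operators on the first `s` strands commute
with the crossings of the block. -/
lemma stable_singular (hs : s ≤ r) {N : Submodule k Y} (hN : Stable k Γ ν r 0 N) :
    Stable k Γ ν s 0 (singular k Γ ν s r i N) := by
  have h := stable_blockPart (i := i) hs hN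
  refine ⟨fun j x hx => ⟨h.idem_smul j x hx.1, fun a ha ha' => ?_⟩,
    fun b hb x hx => ⟨h.dot_smul b hb x hx.1, fun a ha ha' => ?_⟩,
    fun b hb hb' x hx => ⟨h.crossing_smul b hb hb' x hx.1, fun a ha ha' => ?_⟩⟩
  · rw [← mul_smul, crossing_mul_idem, mul_smul, hx.2 a ha ha', smul_zero]
  · rw [← mul_smul, crossing_mul_dot (by omega) (by omega), mul_smul, hx.2 a ha ha', smul_zero]
  · rw [← mul_smul, ← crossing_mul_crossing (by omega), mul_smul, hx.2 a ha ha', smul_zero]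

/-- Crossings of strands with the same label have degree `-2`. -/
lemma proj_crossing_smul (hπ : IsGrading k Γ ν π) {x : Y}
    (hx : x ∈ weightSum k Γ Y (blockSeq ν s r i)) {a : ℕ} (ha : s ≤ a) (ha' : a + 1 < r) (n : ℤ) :
    π n (𝖣 a • x) = 𝖣 a • π (n + 2) x := by
  classical
  -- On the weights of the block the crossing agrees with the sum of its pieces at sequences with
  -- equal entries in `a` and `a + 1`, all of degree `-2`.
  have key : ∀ y ∈ weightSum k Γ Y (blockSeq ν s r i), 𝖣 a • y =
      ∑ j, (if j.label a = j.label (a + 1) then 𝖣 a * 𝖤 j else 0) • y := by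
    intro y hy
    conv_lhs => rw [← sum_idem_smul (k := k) (Γ := Γ) (ν := ν) y, Finset.smul_sum]
    refine Finset.sum_congr rfl fun j _ => ?_
    split_ifs with h
    · rw [mul_smul]
    · rw [hy j, smul_zero, zero_smul]
      exact fun hj => h (by rw [hj a ha (by omega), hj (a + 1) (by omega) ha'])
  rw [key x hx, key _ (isHomog_weightSum hπ _ _ x hx), map_sum]
  refine Finset.sum_congr rfl fun j _ => ?_
  split_ifs with h
  · rw [hπ.proj_smul (crossing_mul_idem_mem_grading_of_eq h), sub_neg_eq_add]
  · rw [zero_smul, zero_smul, map_zero]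

/-- Block crossings act homogeneously on the block part, so they kill each component of a vector
that they kill. -/
lemma isHomog_singular (hπ : IsGrading k Γ ν π) {N : Submodule k Y} (hN : IsHomog π N) :
    IsHomog π (singular k Γ ν s r i N) := fun n x hx =>
  ⟨isHomog_blockPart hπ hN n x hx.1, fun a ha ha' => by
    have := proj_crossing_smul hπ hx.1.2 ha ha' (n - 2)
    rw [hx.2 a ha ha', map_zero, sub_add_cancel] at this
    exact this.symm⟩

/-- Exchanging two equal entries does not change the sequence. -/
lemma crossing_smul_mem_blockPart {N : Submodule k Y} (hN : Stable k Γ ν r 0 N) {a : ℕ}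
    (ha : s ≤ a) (ha' : a + 1 < r) {x : Y} (hx : x ∈ blockPart k Γ ν s r i N) :
    𝖣 a • x ∈ blockPart k Γ ν s r i N := by
  refine ⟨hN.crossing_smul a ha' (by omega) x hx.1,
    weightSum_mono ?_ (crossing_smul_mem_weightSum a hx.2)⟩
  intro j hj
  have h : j.flip a ∈ blockSeq ν s r i := hj
  have := Seq.flip_of_label_eq (a := a) (j := j.flip a)
    (by rw [h a ha (by omega), h (a + 1) (by omega) ha'])
  rw [Seq.flip_flip] at this
  rwa [this]

/-- Block crossings lower the degree by 2, so components of lowest degree are killed by them. -/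
lemma singular_ne_bot (hπ : IsGrading k Γ ν π) {N : Submodule k Y} (hN : IsHomog π N)
    (hN' : Stable k Γ ν r 0 N) (h : blockPart k Γ ν s r i N ≠ ⊥) :
    singular k Γ ν s r i N ≠ ⊥ := by
  obtain ⟨n, ⟨x, hx, hx0⟩, hn⟩ := hπ.exists_lowest h
  refine (Submodule.ne_bot_iff _).2 ⟨π n x, ⟨isHomog_blockPart hπ hN n x hx, fun a ha ha' => ?_⟩,
    hx0⟩
  have := proj_crossing_smul hπ hx.2 ha ha' (n - 2)
  rw [sub_add_cancel] at this
  rw [← this]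
  exact hn _ (by omega) _ (crossing_smul_mem_blockPart hN' ha ha' hx)

lemma dot_smul_mem_blockPart {N : Submodule k Y} (hN : Stable k Γ ν r 0 N) {a : ℕ}
    (ha : a < r) {x : Y} (hx : x ∈ blockPart k Γ ν s r i N) :
    𝖷 a • x ∈ blockPart k Γ ν s r i N :=
  ⟨hN.dot_smul a ha x hx.1, dot_smul_mem_weightSum a hx.2⟩

lemma dotSpan_le_blockPart {N : Submodule k Y} (hN : Stable k Γ ν r 0 N) {V : Submodule k Y}
    (hV : V ≤ blockPart k Γ ν s r i N) : dotSpan k Γ ν s r V ≤ blockPart k Γ ν s r i N :=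
  dotSpan_le hV fun _ _ ha' _ hx => dot_smul_mem_blockPart hN ha' hx

variable {N : Submodule k Y}

/-- A simple subspace is generated by its singular vectors. -/
lemma IsSimpleSub.blockPart_le (hπ : IsGrading k Γ ν π)
    (hN : IsSimpleSub (Γ := Γ) (ν := ν) π r N) (hs : s ≤ r) (hr : r ≤ ν.degree)
    (ha : blockPart k Γ ν s r i N ≤ weightSum k Γ Y (avoidSeq ν s i)) {K : Submodule k Y}
    (hK : K ≤ singular k Γ ν s r i N) (hK0 : K ≠ ⊥) (hKh : IsHomog π K)
    (hKs : Stable k Γ ν s 0 K) :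
    blockPart k Γ ν s r i N ≤ K ⊔ dotImage k Γ ν s r (blockPart k Γ ν s r i N) := by
  have hKN : K ≤ blockPart k Γ ν s r i N := hK.trans (singular_le_blockPart N)
  -- By simplicity `K` generates all of `N`, and the block part of what it generates consists of
  -- polynomials in the dots applied to `K`.
  have e : generate k Γ ν r K = N := by
    refine hN.eq_of_le _ (generate_le (fun x hx => (hKN hx).1) hN.stable) (fun h => hK0 ?_)
      (isHomog_generate hπ hKh r) (stable_generate r K)
    exact le_bot_iff.1 (h ▸ le_generate r K)
  intro x hx
  refine dotSpan_le_sup_dotImage (dotSpan_le_blockPart hN.stable hKN)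
    (mem_dotSpan_of_mem_generate (i := i) hs hr hKs (fun a ha ha' x hx => (hK hx).2 a ha ha') ?_
      (e ▸ hx.1) hx.2)
  intro y hy j hj
  by_cases h : j ∈ blockSeq ν s r i
  · exact ha (hKN hy) j fun h' => hj ⟨h, h'⟩
  · exact (hKN hy).2 j h

/-- If the intersection were nonzero it would generate `N`, and the block part would be contained in
its own image under the dots, hence vanish because dots raise the degree. -/
lemma IsSimpleSub.singular_inf_dotImage (hπ : IsGrading k Γ ν π)
    (hN : IsSimpleSub (Γ := Γ) (ν := ν) π r N) (hs : s ≤ r) (hr : r ≤ ν.degree)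
    (ha : blockPart k Γ ν s r i N ≤ weightSum k Γ Y (avoidSeq ν s i)) :
    singular k Γ ν s r i N ⊓ dotImage k Γ ν s r (blockPart k Γ ν s r i N) = ⊥ := by
  by_contra h
  have hU := hN.blockPart_le hπ hs hr ha inf_le_left h
    ((isHomog_singular hπ hN.homog).inf (isHomog_dotImage hπ (isHomog_blockPart hπ hN.homog)))
    ((stable_singular hs hN.stable).inf (stable_dotImage (stable_blockPart hs hN.stable)))
  have := eq_bot_of_le_dotImage hπ (hU.trans (sup_le inf_le_right le_rfl))
  exact h (le_bot_iff.1 (this ▸ inf_le_left.trans (singular_le_blockPart N)))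

/-- The singular vectors of a simple subspace form a simple subspace. -/
lemma IsSimpleSub.singular (hπ : IsGrading k Γ ν π)
    (hN : IsSimpleSub (Γ := Γ) (ν := ν) π r N) (hs : s ≤ r) (hr : r ≤ ν.degree)
    (ha : blockPart k Γ ν s r i N ≤ weightSum k Γ Y (avoidSeq ν s i))
    (h : blockPart k Γ ν s r i N ≠ ⊥) :
    IsSimpleSub (Γ := Γ) (ν := ν) π s (singular k Γ ν s r i N) where
  ne_bot := singular_ne_bot hπ hN.homog hN.stable h
  homog := isHomog_singular hπ hN.homog
  stable := stable_singular hs hN.stable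
  eq_of_le K hK hK0 hKh hKs := by
    -- Write a singular `x` as an element of `K` plus an element of the dot image; the latter is
    -- again singular and so zero.
    refine le_antisymm hK fun x hx => ?_
    obtain ⟨y, hy, z, hz, rfl⟩ := Submodule.mem_sup.1
      (hN.blockPart_le hπ hs hr ha hK hK0 hKh hKs hx.1)
    have hz' : z ∈ KLR.singular k Γ ν s r i N := by
      have := sub_mem hx (hK hy)
      rwa [add_sub_cancel_left] at this
    have : z = 0 := by
      rw [← Submodule.mem_bot k, ← hN.singular_inf_dotImage hπ hs hr ha]
      exact ⟨hz', hz⟩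
    rwa [this, add_zero]

lemma Stable.map {q : ℕ} (f : Y →ₗ[R k Γ ν] Y') {Z : Submodule k Y} (hZ : Stable k Γ ν r q Z) :
    Stable k Γ ν r q (Z.map (f.restrictScalars k)) := by
  refine ⟨?_, ?_, ?_⟩
  · rintro j _ ⟨x, hx, rfl⟩
    exact ⟨_, hZ.idem_smul j x hx, map_smul f _ _⟩
  · rintro a ha _ ⟨x, hx, rfl⟩
    exact ⟨_, hZ.dot_smul a ha x hx, map_smul f _ _⟩
  · rintro a ha ha' _ ⟨x, hx, rfl⟩
    exact ⟨_, hZ.crossing_smul a ha ha' x hx, map_smul f _ _⟩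

lemma Stable.comap {q : ℕ} (f : Y →ₗ[R k Γ ν] Y') {Z : Submodule k Y'}
    (hZ : Stable k Γ ν r q Z) : Stable k Γ ν r q (Z.comap (f.restrictScalars k)) := by
  refine ⟨fun j x hx => ?_, fun a ha x hx => ?_, fun a ha ha' x hx => ?_⟩ <;>
    rw [Submodule.mem_comap, LinearMap.restrictScalars_apply] at hx ⊢ <;> rw [map_smul]
  · exact hZ.idem_smul j _ hx
  · exact hZ.dot_smul a ha _ hx
  · exact hZ.crossing_smul a ha ha' _ hx

lemma IsHomog.map {f : Y →ₗ[k] Y'} (hf : ∀ n x, π' n (f x) = f (π n x)) {Z : Submodule k Y}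
    (hZ : IsHomog π Z) : IsHomog π' (Z.map f) := by
  rintro n _ ⟨x, hx, rfl⟩
  exact ⟨_, hZ n x hx, (hf n x).symm⟩

lemma IsHomog.comap {f : Y →ₗ[k] Y'} (hf : ∀ n x, π' n (f x) = f (π n x)) {Z : Submodule k Y'}
    (hZ : IsHomog π' Z) : IsHomog π (Z.comap f) := fun n x hx => by
  rw [Submodule.mem_comap, ← hf]
  exact hZ n _ hx

lemma map_mem_dotImage (f : Y →ₗ[R k Γ ν] Y') {U : Submodule k Y} {U' : Submodule k Y'}
    (h : ∀ x ∈ U, f x ∈ U') {x : Y} (hx : x ∈ dotImage k Γ ν s r U) :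
    f x ∈ dotImage k Γ ν s r U' := by
  refine (dotImage_le (W := (dotImage k Γ ν s r U').comap (f.restrictScalars k))
    fun a ha ha' x hx => ?_) hx
  rw [Submodule.mem_comap, LinearMap.restrictScalars_apply, map_smul]
  exact dot_smul_mem_dotImage ha ha' (h x hx)

lemma map_mem_dotSpan_le (f : Y →ₗ[R k Γ ν] Y') {V : Submodule k Y} {N' : Submodule k Y'}
    (hN' : Stable k Γ ν r 0 N') (h : ∀ x ∈ V, f x ∈ blockPart k Γ ν s r i N') :
    ∀ x ∈ dotSpan k Γ ν s r V, f x ∈ blockPart k Γ ν s r i N' := by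
  intro x hx
  refine (dotSpan_le (W := (blockPart k Γ ν s r i N').comap (f.restrictScalars k)) h
    fun a ha ha' x hx => ?_) hx
  rw [Submodule.mem_comap, LinearMap.restrictScalars_apply, map_smul]
  exact dot_smul_mem_blockPart hN' ha' hx

/-! ### Extending isomorphisms from singular vectors, by means of graphs -/

section Graph

variable {P : Type*} [AddCommGroup P] [Module k P] [Module (R k Γ ν) P]
  [IsScalarTower k (R k Γ ν) P] {πP : ℤ → P →ₗ[k] P}

/-- The subspace generated by a subspace of singular vectors does not meet one of the summands,
if this is so for the singular vectors. -/
lemma IsSimpleSub.eq_zero_of_mem_generate (hπ : IsGrading k Γ ν π) (hπP : IsGrading k Γ ν πP)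
    (hπ' : IsGrading k Γ ν π') {N' : Submodule k Y'}
    (hN : IsSimpleSub (Γ := Γ) (ν := ν) π r N) (hN' : IsSimpleSub (Γ := Γ) (ν := ν) π' r N')
    (hs : s ≤ r) (hr : r ≤ ν.degree)
    (ha : blockPart k Γ ν s r i N ≤ weightSum k Γ Y (avoidSeq ν s i))
    (ha' : blockPart k Γ ν s r i N' ≤ weightSum k Γ Y' (avoidSeq ν s i))
    (h : blockPart k Γ ν s r i N ≠ ⊥)
    (p : P →ₗ[R k Γ ν] Y) (p' : P →ₗ[R k Γ ν] Y') (e : Y →ₗ[R k Γ ν] P)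
    (hp : ∀ x, p (e x) = x) (hp' : ∀ x, p' (e x) = 0) (hpp : ∀ x, p x = 0 → p' x = 0 → x = 0)
    (hπe : ∀ n x, πP n (e x) = e (π n x))
    {Z : Submodule k P} (hZ : IsHomog πP Z) (hZs : Stable k Γ ν s 0 Z)
    (hpZ : ∀ z ∈ Z, p z ∈ KLR.singular k Γ ν s r i N)
    (hpZ' : ∀ z ∈ Z, p' z ∈ KLR.singular k Γ ν s r i N')
    (hZ0 : ∀ z ∈ Z, p' z = 0 → p z = 0) {x : Y} (hx : e x ∈ generate k Γ ν r Z) : x = 0 := by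
  have hle : generate k Γ ν r Z ≤ N.comap (p.restrictScalars k) :=
    generate_le (fun z hz => (hpZ z hz).1.1) (hN.stable.comap p)
  by_contra hx0
  -- A nonzero intersection with the summand is a homogeneous stable subspace of `N`, hence all of
  -- it. In particular it contains a nonzero singular vector `y`, which is shown to vanish.
  have hcomap : (generate k Γ ν r Z).comap (e.restrictScalars k) = N := by
    refine hN.eq_of_le _ (fun y hy => ?_) ((Submodule.ne_bot_iff _).2 ⟨x, hx, hx0⟩)
      ((isHomog_generate hπP hZ r).comap hπe) ((stable_generate r Z).comap e)
    have := hle hy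
    rwa [Submodule.mem_comap, LinearMap.restrictScalars_apply, LinearMap.restrictScalars_apply, hp]
      at this
  obtain ⟨y, hy, hy0⟩ := (Submodule.ne_bot_iff _).1
    (singular_ne_bot (i := i) hπ hN.homog hN.stable h)
  have hey : e y ∈ generate k Γ ν r Z := by
    have : y ∈ N := hy.1.1
    rwa [← hcomap] at this
  have hwe : e y ∈ weightSum k Γ P (blockSeq ν s r i) := fun j hj => by
    rw [← map_smul, hy.1.2 j hj, map_zero]
  have hZw : Z ≤ weightSum k Γ P (blockSeq ν s r i ∩ avoidSeq ν s i) := by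
    intro z hz j hj
    have h1 := hpZ z hz
    have h2 := hpZ' z hz
    refine hpp _ ?_ ?_
    · rw [map_smul]
      by_cases h : j ∈ blockSeq ν s r i
      · exact ha h1.1 j fun h' => hj ⟨h, h'⟩
      · exact h1.1.2 j h
    · rw [map_smul]
      by_cases h : j ∈ blockSeq ν s r i
      · exact ha' h2.1 j fun h' => hj ⟨h, h'⟩
      · exact h2.1.2 j h
  have hD := mem_dotSpan_of_mem_generate (i := i) hs hr hZs (fun a hsa har z hz => by
    refine hpp _ ?_ ?_
    · rw [map_smul, (hpZ z hz).2 a hsa har]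
    · rw [map_smul, (hpZ' z hz).2 a hsa har]) hZw hey hwe
  -- Block weights of the generated subspace come from polynomials in the dots applied to `Z`: `e y`
  -- is `z` in `Z` plus an element `w` of the dot image.
  obtain ⟨z, hz, w, hw, hzw⟩ := Submodule.mem_sup.1 (dotSpan_le_sup_dotImage le_rfl hD)
  have hw1 : p w ∈ dotImage k Γ ν s r (blockPart k Γ ν s r i N) :=
    map_mem_dotImage p (map_mem_dotSpan_le p hN.stable fun z hz => (hpZ z hz).1) hw
  have hw2 : p' w ∈ dotImage k Γ ν s r (blockPart k Γ ν s r i N') :=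
    map_mem_dotImage p' (map_mem_dotSpan_le p' hN'.stable fun z hz => (hpZ' z hz).1) hw
  -- The other coordinate of `e y` is zero, so `p' z` is both singular and in the dot image. Then `p
  -- z` vanishes as well, and `y = p w` is in the same position in `N`.
  have hz2 : p' z = 0 := by
    rw [← Submodule.mem_bot k, ← hN'.singular_inf_dotImage hπ' hs hr ha']
    refine ⟨hpZ' z hz, ?_⟩
    have : p' z = - p' w := by rw [eq_neg_iff_add_eq_zero, ← map_add, hzw, hp']
    rw [this]
    exact neg_mem hw2
  apply hy0
  rw [← Submodule.mem_bot k, ← hN.singular_inf_dotImage hπ hs hr ha]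
  refine ⟨hy, ?_⟩
  rwa [← hp y, ← hzw, map_add, hZ0 z hz hz2, zero_add]

end Graph

/-- The graph of a grading-preserving isomorphism between stable subspaces. -/
structure IsIsoGraph (π : ℤ → Y →ₗ[k] Y) (π' : ℤ → Y' →ₗ[k] Y') (r : ℕ) (N : Submodule k Y)
    (N' : Submodule k Y') (Z : Submodule k (Y × Y')) : Prop where
  homog : IsHomog (fun n => (π n).prodMap (π' n)) Z
  stable : Stable k Γ ν r 0 Z
  map_fst : Z.map ((LinearMap.fst (R k Γ ν) Y Y').restrictScalars k) = N
  map_snd : Z.map ((LinearMap.snd (R k Γ ν) Y Y').restrictScalars k) = N'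
  eq_zero_fst : ∀ x, (x, 0) ∈ Z → x = 0
  eq_zero_snd : ∀ y, (0, y) ∈ Z → y = 0

/-- An isomorphism between the spaces of singular vectors of simple subspaces extends. -/
lemma IsSimpleSub.exists_isIsoGraph (hπ : IsGrading k Γ ν π) (hπ' : IsGrading k Γ ν π')
    {N' : Submodule k Y'}
    (hN : IsSimpleSub (Γ := Γ) (ν := ν) π r N) (hN' : IsSimpleSub (Γ := Γ) (ν := ν) π' r N')
    (hs : s ≤ r) (hr : r ≤ ν.degree)
    (ha : blockPart k Γ ν s r i N ≤ weightSum k Γ Y (avoidSeq ν s i))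
    (ha' : blockPart k Γ ν s r i N' ≤ weightSum k Γ Y' (avoidSeq ν s i))
    (h : blockPart k Γ ν s r i N ≠ ⊥) (h' : blockPart k Γ ν s r i N' ≠ ⊥)
    {Z : Submodule k (Y × Y')}
    (hZ : IsIsoGraph (Γ := Γ) (ν := ν) π π' s (KLR.singular k Γ ν s r i N)
      (KLR.singular k Γ ν s r i N') Z) :
    IsIsoGraph (Γ := Γ) (ν := ν) π π' r N N' (generate k Γ ν r Z) := by
  have hP := hπ.prod hπ'
  have hfst : ∀ z ∈ Z, z.1 ∈ KLR.singular k Γ ν s r i N := fun z hz => by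
    rw [← hZ.map_fst]
    exact ⟨z, hz, rfl⟩
  have hsnd : ∀ z ∈ Z, z.2 ∈ KLR.singular k Γ ν s r i N' := fun z hz => by
    rw [← hZ.map_snd]
    exact ⟨z, hz, rfl⟩
  have hZ1 : ∀ z ∈ Z, z.2 = 0 → z.1 = 0 := by
    rintro ⟨x, y⟩ hz (rfl : y = 0)
    exact hZ.eq_zero_fst x hz
  have hZ2 : ∀ z ∈ Z, z.1 = 0 → z.2 = 0 := by
    rintro ⟨x, y⟩ hz (rfl : x = 0)
    exact hZ.eq_zero_snd y hz
  refine ⟨isHomog_generate hP hZ.homog r, stable_generate r Z, ?_, ?_, fun x hx => ?_,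
    fun y hy => ?_⟩
  -- The projection of the generated subspace is a nonzero homogeneous stable subspace of the simple
  -- `N`.
  · refine hN.eq_of_le _ ?_ ?_ (IsHomog.map (π := fun n => (π n).prodMap (π' n))
      (fun _ _ => rfl) (isHomog_generate hP hZ.homog r)) ((stable_generate r Z).map _)
    · rw [Submodule.map_le_iff_le_comap]
      exact generate_le (fun z hz => (hfst z hz).1.1) (hN.stable.comap _)
    · intro hbot
      refine singular_ne_bot (i := i) hπ hN.homog hN.stable h ?_
      rw [← hZ.map_fst, ← le_bot_iff, ← hbot]
      exact Submodule.map_mono (le_generate r Z)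
  · refine hN'.eq_of_le _ ?_ ?_ (IsHomog.map (π := fun n => (π n).prodMap (π' n))
      (fun _ _ => rfl) (isHomog_generate hP hZ.homog r)) ((stable_generate r Z).map _)
    · rw [Submodule.map_le_iff_le_comap]
      exact generate_le (fun z hz => (hsnd z hz).1.1) (hN'.stable.comap _)
    · intro hbot
      refine singular_ne_bot (i := i) hπ' hN'.homog hN'.stable h' ?_
      rw [← hZ.map_snd, ← le_bot_iff, ← hbot]
      exact Submodule.map_mono (le_generate r Z)
  · exact hN.eq_zero_of_mem_generate hπ hP hπ' hN' hs hr ha ha' h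
      (LinearMap.fst _ _ _) (LinearMap.snd _ _ _) (LinearMap.inl _ _ _)
      (fun _ => rfl) (fun _ => rfl) (fun _ h1 h2 => Prod.ext h1 h2)
      (fun n x => Prod.ext rfl (map_zero (π' n))) hZ.homog hZ.stable hfst hsnd hZ1 hx
  · exact hN'.eq_zero_of_mem_generate hπ' hP hπ hN hs hr ha' ha h'
      (LinearMap.snd _ _ _) (LinearMap.fst _ _ _) (LinearMap.inr _ _ _)
      (fun _ => rfl) (fun _ => rfl) (fun _ h1 h2 => Prod.ext h2 h1)
      (fun n x => Prod.ext (map_zero (π n)) rfl) hZ.homog hZ.stable hsnd hfst hZ2 hy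

end Graded

/-! ### Nil Hecke rings -/

/-- The relations of the nil Hecke ring on `n` strands, in a corner of a ring. -/
structure NilHecke {A : Type*} [Ring A] (n : ℕ) (e : A) (d x : ℕ → A) : Prop where
  idem_mul_crossing : ∀ a, a + 1 < n → e * d a = d a
  crossing_mul_idem : ∀ a, a + 1 < n → d a * e = d a
  idem_mul_dot : ∀ a < n, e * x a = x a
  dot_mul_idem : ∀ a < n, x a * e = x a
  sq : ∀ a, a + 1 < n → d a * d a = 0
  braid : ∀ a, a + 2 < n → d (a + 1) * d a * d (a + 1) = d a * d (a + 1) * d a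
  comm : ∀ a b, a + 1 < b → b + 1 < n → d a * d b = d b * d a
  crossing_mul_dot : ∀ a b, b ≠ a → b ≠ a + 1 → a + 1 < n → b < n → d a * x b = x b * d a
  dot_mul_crossing : ∀ a, a + 1 < n → d a * x (a + 1) = x a * d a - e
  dot_mul_dot : ∀ a b, a < n → b < n → x a * x b = x b * x a

namespace NilHecke

variable {A : Type*} [Ring A] {n : ℕ} {e : A} {d x : ℕ → A}

/-- The product `e d₀ ⋯ dₜ₋₁`. -/
def nest (e : A) (d : ℕ → A) : ℕ → A
  | 0 => e
  | t + 1 => nest e d t * d t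

lemma crossing_mul_nest (h : NilHecke n e d x) {a t : ℕ} (ht : t < a) (ha : a + 1 < n) :
    d a * nest e d t = nest e d t * d a := by
  induction t with
  | zero => rw [nest, h.idem_mul_crossing a ha, h.crossing_mul_idem a ha]
  | succ t ih =>
    rw [nest, ← mul_assoc, ih (by omega), mul_assoc, mul_assoc, h.comm t a ht ha]

lemma idem_mul_dot_pow (h : NilHecke n e d x) {a : ℕ} (ha : a < n)
    (u : ℕ) : e * x a ^ u = x a ^ u * e := by
  induction u with
  | zero => simp
  | succ u ih => rw [pow_succ, ← mul_assoc, ih, mul_assoc, mul_assoc, h.idem_mul_dot a ha, h.dot_mul_idem a ha]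

lemma dot_mul_nest (h : NilHecke n e d x) {a t : ℕ} (ht : t < a)
    (ha : a < n) : x a * nest e d t = nest e d t * x a := by
  induction t with
  | zero => rw [nest, h.dot_mul_idem a ha, h.idem_mul_dot a ha]
  | succ t ih =>
    rw [nest, ← mul_assoc, ih (by omega), mul_assoc, mul_assoc,
      h.crossing_mul_dot t a (by omega) (by omega) (by omega) ha]

lemma dot_pow_mul_nest (h : NilHecke n e d x) {a t : ℕ} (ht : t < a)
    (ha : a < n) (u : ℕ) : x a ^ u * nest e d t = nest e d t * x a ^ u :=
  ((show Commute (x a) (nest e d t) from h.dot_mul_nest ht ha).pow_left u).eq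

lemma nest_mul_pow_mul_pow (h : NilHecke n e d x) {t : ℕ} (ht : t + 1 < n) (u w : ℕ) :
    nest e d t * x t ^ u * x (t + 1) ^ w = x (t + 1) ^ w * (nest e d t * x t ^ u) := by
  rw [← mul_assoc, h.dot_pow_mul_nest (Nat.lt_succ_self t) ht, mul_assoc, mul_assoc,
    ((show Commute (x (t + 1)) (x t) from h.dot_mul_dot _ _ ht (by omega)).pow_pow _ _).eq]

/-- The braid relation passes a crossing through the product with its index lowered by one. -/
lemma crossing_succ_mul_nest (h : NilHecke n e d x) {a t : ℕ} (hat : a + 1 < t) (ht : t < n) :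
    d (a + 1) * nest e d t = nest e d t * d a := by
  induction t with
  | zero => omega
  | succ t ih =>
    rcases eq_or_ne (a + 1) t with rfl | hne
    · rw [nest, nest, ← mul_assoc, ← mul_assoc, h.crossing_mul_nest (by omega) (by omega),
        mul_assoc, mul_assoc, ← mul_assoc (d (a + 1)), h.braid a ht]
      simp only [mul_assoc]
    · rw [nest, ← mul_assoc, ih (by omega) (by omega), mul_assoc, mul_assoc,
        h.comm a t (by omega) ht]

lemma crossing_zero_mul_nest (h : NilHecke n e d x) {t : ℕ} (h0 : 0 < t) (ht : t < n) :
    d 0 * nest e d t = 0 := by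
  induction t with
  | zero => omega
  | succ t ih =>
    rcases Nat.eq_zero_or_pos t with rfl | h'
    · rw [nest, nest, h.idem_mul_crossing 0 (by omega), h.sq 0 (by omega)]
    · rw [nest, ← mul_assoc, ih h' (by omega), zero_mul]

variable {Y : Type*} [AddCommGroup Y] [Module A Y]

/-- The product `d₀ ⋯ dₜ₋₁` turns vectors killed by the crossings of the first `t` strands into
vectors killed by those of the first `t + 1`: a crossing passes through with smaller index, except
`d 0`, which gives a square. -/
lemma crossing_smul_nest_smul (h : NilHecke n e d x) {t : ℕ} (ht : t < n) {v : Y}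
    (hv : ∀ a, a + 1 < t → d a • v = 0) : ∀ a, a + 1 < t + 1 → d a • nest e d t • v = 0 := by
  intro a ha
  cases a with
  | zero => rw [← mul_smul, h.crossing_zero_mul_nest (by omega) ht, zero_smul]
  | succ a =>
    rw [← mul_smul, h.crossing_succ_mul_nest (by omega) ht, mul_smul, hv a (by omega), smul_zero]

/-- The twisted Leibniz rule: the sum is the divided difference of the power of `x (t + 1)`, up to
sign. -/
lemma crossing_smul_dot_pow_smul (h : NilHecke n e d x) {t : ℕ}
    (ht : t + 1 < n) {v : Y} (hv : e • v = v) (u : ℕ) :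
    d t • x (t + 1) ^ u • v = x t ^ u • d t • v
      - ∑ i ∈ Finset.range u, x t ^ i • x (t + 1) ^ (u - 1 - i) • v := by
  induction u with
  | zero => simp
  | succ u ih =>
    rw [pow_succ', mul_smul, ← mul_smul, h.dot_mul_crossing t ht, sub_smul, mul_smul, ih,
      ← mul_smul e, h.idem_mul_dot_pow ht, mul_smul _ e, hv, Finset.sum_range_succ', smul_sub,
      Finset.smul_sum, pow_succ', mul_smul, sub_sub]
    congr 2
    · refine Finset.sum_congr rfl fun i _ => ?_
      rw [pow_succ' (x t) i, mul_smul, show u + 1 - 1 - (i + 1) = u - 1 - i by omega]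
    · simp

/-- On vectors killed by the crossings of the first `t + 1` strands the nested crossings act on
powers of `x t` by iterated divided differences. These lower the polynomial degree by `t`, killing
smaller powers and sending the `t`-th power to a sign. In the recursion only the last term of the
Leibniz sum can survive. -/
lemma nest_smul_dot_pow_smul (h : NilHecke n e d x) {t : ℕ}
    (ht : t < n) {v : Y} (hv : e • v = v) (hdv : ∀ a < t, d a • v = 0) :
    (∀ u < t, nest e d t • x t ^ u • v = 0) ∧ nest e d t • x t ^ t • v = (-1 : ℤ) ^ t • v := by
  induction t with
  | zero => simp [nest, hv]
  | succ t ih =>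
    obtain ⟨h1, h2⟩ := ih (by omega) fun a ha => hdv a (by omega)
    have key : ∀ u, nest e d (t + 1) • x (t + 1) ^ u • v =
        - ∑ i ∈ Finset.range u, x (t + 1) ^ (u - 1 - i) • nest e d t • x t ^ i • v := by
      intro u
      rw [nest, mul_smul, h.crossing_smul_dot_pow_smul ht hv, hdv t (by omega), smul_zero,
        zero_sub, smul_neg, Finset.smul_sum]
      congr 1
      refine Finset.sum_congr rfl fun i _ => ?_
      simp only [← mul_smul]
      rw [← mul_assoc, h.nest_mul_pow_mul_pow ht]
    refine ⟨fun u hu => ?_, ?_⟩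
    · rw [key, Finset.sum_eq_zero, neg_zero]
      intro i hi
      rw [h1 i (by have := Finset.mem_range.1 hi; omega), smul_zero]
    · rw [key, Finset.sum_range_succ, Finset.sum_eq_zero, zero_add, h2, pow_succ]
      · simp
      · intro i hi
        rw [h1 i (Finset.mem_range.1 hi), smul_zero]

/-- The operators "multiply by a power of the last dot, then apply the nested crossings" together
detect every vector killed by the smaller set of crossings. This makes the filtration below end at
zero. -/
lemma eq_zero_of_nest_smul (h : NilHecke n e d x) {t : ℕ}
    (ht : t < n) {v : Y} (hv : e • v = v) (hdv : ∀ a, a + 1 < t → d a • v = 0)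
    (hn : ∀ u ≤ t, nest e d t • x t ^ u • v = 0) : v = 0 := by
  induction t generalizing v with
  | zero => simpa [nest, hv] using hn 0 le_rfl
  | succ t ih =>
    have hdv' : ∀ a < t, d a • v = 0 := fun a ha => hdv a (by omega)
    have h1 := (h.nest_smul_dot_pow_smul (by omega) hv hdv').1
    -- The Leibniz rule transfers the hypothesis from `v` and `t + 1` to `d t • v` and `t`. Once `d
    -- t` kills `v`, the top power recovers `v` up to sign.
    have hw : d t • v = 0 := by
      refine ih (by omega) ?_ (fun a ha => ?_) fun u hu => ?_
      · rw [← mul_smul, h.idem_mul_crossing t ht]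
      · rw [← mul_smul, h.comm a t ha ht, mul_smul, hdv' a (by omega), smul_zero]
      · have e1 := h.crossing_smul_dot_pow_smul ht hv u
        rw [eq_sub_iff_add_eq] at e1
        rw [← e1, smul_add, ← mul_smul _ (d t), ← nest, hn u (by omega), zero_add, Finset.smul_sum]
        refine Finset.sum_eq_zero fun i hi => ?_
        have hi' := Finset.mem_range.1 hi
        have : nest e d t • x t ^ i • x (t + 1) ^ (u - 1 - i) • v =
            x (t + 1) ^ (u - 1 - i) • nest e d t • x t ^ i • v := by
          simp only [← mul_smul]
          rw [← mul_assoc, h.nest_mul_pow_mul_pow ht]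
        rw [this, h1 i (by omega), smul_zero]
    have h2 := (h.nest_smul_dot_pow_smul ht hv (fun a ha => by
      rcases Nat.lt_succ_iff_lt_or_eq.1 ha with ha | rfl
      · exact hdv' a ha
      · exact hw)).2
    rw [hn _ le_rfl] at h2
    rcases neg_one_pow_eq_or ℤ (t + 1) with h3 | h3 <;> rw [h3] at h2 <;> simpa using h2.symm

end NilHecke

/-! ### Weight multiplicities on a block, through the nil Hecke relations -/

section Multiplicity

variable {k : Type u} [Field k] {I : Type v} {Γ : SimpleGraph I} {ν : I →₀ ℕ}

local notation "𝖷" => dot k Γ ν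
local notation "𝖣" => crossing k Γ ν
local notation "𝖤" => idem k Γ

/-- Crossings of equal labels preserve the sequence, so they commute with its idempotent; squares
vanish and the braid relation has no correction. -/
lemma nilHecke_of_mem_blockSeq {s r : ℕ} {i : I} (hr : r ≤ ν.degree) {j : Seq ν}
    (hj : j ∈ blockSeq ν s r i) :
    NilHecke (r - s) (𝖤 j) (fun a => 𝖣 (s + a) * 𝖤 j) (fun a => 𝖷 (s + a) * 𝖤 j) := by
  have hl : ∀ a, a + 1 < r - s → j.label (s + a) = j.label (s + a + 1) := fun a ha => by
    rw [hj _ (by omega) (by omega), hj _ (by omega) (by omega)]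
  have hE := FMod.idem_mul_idem (k := k) (Γ := Γ) j
  have hx : ∀ a, 𝖤 j * 𝖷 (s + a) = 𝖷 (s + a) * 𝖤 j := fun a => KLR.idem_mul_dot _ j
  have hd : ∀ a, a + 1 < r - s → 𝖤 j * 𝖣 (s + a) = 𝖣 (s + a) * 𝖤 j := fun a ha => by
    rw [KLR.idem_mul_crossing, Seq.flip_of_label_eq (hl a ha)]
  have hcomb : ∀ y z : R k Γ ν, 𝖤 j * z = z * 𝖤 j → y * 𝖤 j * (z * 𝖤 j) = y * z * 𝖤 j := by
    intro y z h
    rw [mul_assoc y, ← mul_assoc (𝖤 j), h, mul_assoc z, hE, mul_assoc]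
  refine ⟨?_, ?_, ?_, ?_, ?_, ?_, ?_, ?_, ?_, ?_⟩
  · intro a ha
    rw [← mul_assoc, hd a ha, mul_assoc, hE]
  · intro a _
    rw [mul_assoc, hE]
  · intro a _
    rw [← mul_assoc, hx, mul_assoc, hE]
  · intro a _
    rw [mul_assoc, hE]
  · intro a ha
    rw [hcomb _ _ (hd a ha), crossing_sq_of_eq j (hl a ha)]
  · intro a ha
    rw [hcomb _ _ (hd a (by omega)), hcomb _ _ (hd (a + 1) (by omega)),
      hcomb _ _ (hd (a + 1) (by omega)), hcomb _ _ (hd a (by omega)), ← add_assoc,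
      braid_of_label_eq j (hl a (by omega))]
  · intro a b hab hb
    rw [hcomb _ _ (hd b hb), hcomb _ _ (hd a (by omega)), crossing_mul_crossing (by omega)]
  · intro a b h1 h2 ha _
    rw [hcomb _ _ (hx b), hcomb _ _ (hd a ha), KLR.crossing_mul_dot (by omega) (by omega)]
  · intro a ha
    rw [hcomb _ _ (hx (a + 1)), hcomb _ _ (hd a ha), ← add_assoc,
      dot_mul_crossing_of_eq (by omega) j (hl a ha), add_sub_cancel_right]
  · intro a b _ _
    rw [hcomb _ _ (hx b), hcomb _ _ (hx a), KLR.dot_mul_dot]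

namespace FMod

variable {M : FMod k Γ ν}

/-- Graded dimensions are additive in short exact sequences whose last map is homogeneous. -/
lemma gdim_eq_add {W W' W'' : Submodule k M.carrier} {a : ℤ}
    (h : ∀ n, Module.finrank k ↥(W ⊓ M.part n) =
      Module.finrank k ↥(W' ⊓ M.part n) + Module.finrank k ↥(W'' ⊓ M.part (n - a))) :
    M.gdim W = M.gdim W' + LaurentPolynomial.T a * M.gdim W'' := by
  have e : LaurentPolynomial.T a * M.gdim W'' =
      ∑ᶠ n : ℤ, (Module.finrank k ↥(W'' ⊓ M.part (n - a)) : ℤ) • LaurentPolynomial.T n := by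
    rw [gdim, mul_finsum' _ _ (gdim_support _ _),
      ← finsum_comp_equiv (Equiv.subRight a)]
    refine finsum_congr fun n => ?_
    rw [Equiv.subRight_apply, mul_smul_comm, ← LaurentPolynomial.T_add, add_sub_cancel]
  rw [e, gdim, gdim, ← finsum_add_distrib (gdim_support _ _)]
  · refine finsum_congr fun n => ?_
    rw [h, Nat.cast_add, add_smul]
  · have := (gdim_support M W'').preimage (sub_left_injective (b := a)).injOn
    refine this.subset fun n hn h0 => hn ?_
    have h1 : (Module.finrank k ↥(W'' ⊓ M.part (n - a)) : ℤ) •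
      (LaurentPolynomial.T (n - a) : ℤ[T;T⁻¹]) = 0 := h0
    change (Module.finrank k ↥(W'' ⊓ M.part (n - a)) : ℤ) • LaurentPolynomial.T n = 0
    rw [← sub_add_cancel n a, LaurentPolynomial.T_add, ← smul_mul_assoc, sub_add_cancel, h1,
      zero_mul]

/-- The vectors of weight `j` in a subspace that are killed by the crossings of the first `t` strands
of a block starting in position `s`. -/
def singularStep (N : Submodule k M.carrier) (j : Seq ν) (s t : ℕ) : Submodule k M.carrier where
  carrier := {x | x ∈ N ∧ 𝖤 j • x = x ∧ ∀ a, a + 1 < t → (𝖣 (s + a) * 𝖤 j) • x = 0}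
  add_mem' hx hy := ⟨add_mem hx.1 hy.1, by rw [smul_add, hx.2.1, hy.2.1], fun a ha => by
    rw [smul_add, hx.2.2 a ha, hy.2.2 a ha, add_zero]⟩
  zero_mem' := ⟨zero_mem _, smul_zero _, fun _ _ => smul_zero _⟩
  smul_mem' c x hx := ⟨Submodule.smul_mem _ c hx.1, by rw [smul_comm, hx.2.1], fun a ha => by
    rw [smul_comm, hx.2.2 a ha, smul_zero]⟩

/-- A filtration of `singularStep N j s t` with subquotients `singularStep N j s (t + 1)`. -/
def singularFiltration (N : Submodule k M.carrier) (j : Seq ν) (s t w : ℕ) :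
    Submodule k M.carrier where
  carrier := {x | x ∈ singularStep N j s t ∧ ∀ u < w,
    NilHecke.nest (𝖤 j) (fun a => 𝖣 (s + a) * 𝖤 j) t • (𝖷 (s + t) * 𝖤 j) ^ u • x = 0}
  add_mem' hx hy := ⟨add_mem hx.1 hy.1, fun u hu => by
    rw [smul_add, smul_add, hx.2 u hu, hy.2 u hu, add_zero]⟩
  zero_mem' := ⟨zero_mem _, fun _ _ => by rw [smul_zero, smul_zero]⟩
  smul_mem' c x hx := ⟨Submodule.smul_mem _ c hx.1, fun u hu => by
    rw [smul_comm _ c x, smul_comm _ c, hx.2 u hu, smul_zero]⟩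

lemma singularFiltration_zero (N : Submodule k M.carrier) (j : Seq ν) (s t : ℕ) :
    singularFiltration N j s t 0 = singularStep N j s t := by
  ext x
  exact ⟨fun h => h.1, fun h => ⟨h, fun u hu => absurd hu (Nat.not_lt_zero u)⟩⟩

lemma nest_mem_grading {s r : ℕ} {i : I} {j : Seq ν} (hj : j ∈ blockSeq ν s r i) {t : ℕ}
    (ht : t < r - s) :
    NilHecke.nest (𝖤 j) (fun a => 𝖣 (s + a) * 𝖤 j) t ∈ grading k Γ ν (-2 * t) := by
  induction t with
  | zero => simpa [NilHecke.nest] using idem_mem_grading j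
  | succ t ih =>
    have := SetLike.mul_mem_graded (ih (by omega)) (crossing_mul_idem_mem_grading_of_eq
      (k := k) (Γ := Γ) (a := s + t) (j := j)
      (by rw [hj _ (by omega) (by omega), hj _ (by omega) (by omega)]))
    rw [NilHecke.nest]
    convert this using 2
    push_cast
    ring

lemma dot_pow_mem_grading (a u : ℕ) (j : Seq ν) :
    (𝖷 a * 𝖤 j) ^ u ∈ grading k Γ ν (2 * u) := by
  have h : 𝖷 a * 𝖤 j ∈ grading k Γ ν 2 := by
    simpa using SetLike.mul_mem_graded (dot_mem_grading a) (idem_mem_grading (k := k) (Γ := Γ) j)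
  have := SetLike.pow_mem_graded u h
  rwa [nsmul_eq_mul, mul_comm] at this

variable {N : Submodule k M.carrier} {s r : ℕ} {i : I}

/-- The dot sits on strand `t` of the block, just beyond the strands whose crossings are required to
vanish. -/
lemma dot_pow_smul_mem_singularStep (hN : Stable k Γ ν r 0 N) (hr : r ≤ ν.degree) {j : Seq ν}
    (hj : j ∈ blockSeq ν s r i) {t : ℕ} (ht : t < r - s) (u : ℕ) {x : M.carrier}
    (hx : x ∈ singularStep N j s t) : (𝖷 (s + t) * 𝖤 j) ^ u • x ∈ singularStep N j s t := by
  have h := nilHecke_of_mem_blockSeq (k := k) (Γ := Γ) hr hj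
  induction u with
  | zero => rwa [pow_zero, one_smul]
  | succ u ih =>
    rw [pow_succ', mul_smul]
    refine ⟨?_, ?_, fun a ha => ?_⟩
    · rw [mul_smul]
      exact hN.dot_smul _ (by omega) _ (hN.idem_smul j _ ih.1)
    · rw [← mul_smul, h.idem_mul_dot t ht]
    · rw [← mul_smul, h.crossing_mul_dot a t (by omega) (by omega) (by omega) ht, mul_smul,
        ih.2.2 a ha, smul_zero]

lemma nest_smul_mem_singularStep (hN : Stable k Γ ν r 0 N) (hr : r ≤ ν.degree) {j : Seq ν}
    (hj : j ∈ blockSeq ν s r i) {t : ℕ} (ht : t < r - s) {x : M.carrier}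
    (hx : x ∈ singularStep N j s t) :
    NilHecke.nest (𝖤 j) (fun a => 𝖣 (s + a) * 𝖤 j) t • x ∈ singularStep N j s (t + 1) := by
  have h := nilHecke_of_mem_blockSeq (k := k) (Γ := Γ) hr hj
  have key : ∀ (t : ℕ), t < r - s → ∀ y ∈ N,
      NilHecke.nest (𝖤 j) (fun a => 𝖣 (s + a) * 𝖤 j) t • y ∈ N ∧
      𝖤 j * NilHecke.nest (𝖤 j) (fun a => 𝖣 (s + a) * 𝖤 j) t =
        NilHecke.nest (𝖤 j) (fun a => 𝖣 (s + a) * 𝖤 j) t := by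
    intro t ht
    induction t with
    | zero => exact fun y hy => ⟨hN.idem_smul j y hy, idem_mul_idem j⟩
    | succ t ih =>
      refine fun y hy => ⟨?_, ?_⟩
      · rw [NilHecke.nest, mul_smul, mul_smul]
        exact (ih (by omega) _ (hN.crossing_smul _ (by omega) (by omega) _
          (hN.idem_smul j y hy))).1
      · rw [NilHecke.nest, ← mul_assoc, (ih (by omega) y hy).2]
  refine ⟨(key t ht x hx.1).1, ?_, h.crossing_smul_nest_smul ht hx.2.2⟩
  rw [← mul_smul, (key t ht x hx.1).2]

/-- The graded dimensions of two consecutive steps of the filtration. -/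
lemma finrank_singularFiltration (hN : Stable k Γ ν r 0 N) (hr : r ≤ ν.degree) {j : Seq ν}
    (hj : j ∈ blockSeq ν s r i) {t w : ℕ} (ht : t < r - s) (hw : w ≤ t) (n : ℤ) :
    Module.finrank k ↥(singularFiltration N j s t w ⊓ M.part n) =
      Module.finrank k ↥(singularFiltration N j s t (w + 1) ⊓ M.part n) +
      Module.finrank k ↥(singularStep N j s (t + 1) ⊓ M.part (n - (2 * (t - w) : ℕ))) := by
  have h := nilHecke_of_mem_blockSeq (k := k) (Γ := Γ) hr hj
  set X := 𝖷 (s + t) * 𝖤 j with hX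
  set G := NilHecke.nest (𝖤 j) (fun a => 𝖣 (s + a) * 𝖤 j) t with hG
  -- The `w`-th power of the dot followed by the nested crossings has degree `2w - 2t` and maps this
  -- step of the filtration to the next singular space, with the following step as kernel.
  have hmaps : ∀ x ∈ singularFiltration N j s t w ⊓ M.part n,
      Algebra.lsmul k k M.carrier (G * X ^ w) x ∈
        singularStep N j s (t + 1) ⊓ M.part (n - (2 * (t - w) : ℕ)) := by
    rintro x ⟨hx, hxn⟩
    change (G * X ^ w) • x ∈ _
    rw [mul_smul]
    refine ⟨nest_smul_mem_singularStep hN hr hj ht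
      (dot_pow_smul_mem_singularStep hN hr hj ht w hx.1), ?_⟩
    have := M.smul_mem (nest_mem_grading (k := k) (Γ := Γ) hj ht)
      (M.smul_mem (dot_pow_mem_grading (k := k) (Γ := Γ) (s + t) w j) hxn)
    have e : -2 * (t : ℤ) + (2 * w + n) = n - (2 * (t - w) : ℕ) := by
      push_cast [hw]
      ring
    rwa [e] at this
  let f := (Algebra.lsmul k k M.carrier (G * X ^ w)).restrict hmaps
  have hsurj : LinearMap.range f = ⊤ := by
    rw [LinearMap.range_eq_top]
    rintro ⟨y, hy, hyn⟩
    have hd : ∀ a < t, (𝖣 (s + a) * 𝖤 j) • y = 0 := fun a ha => hy.2.2 a (by omega)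
    obtain ⟨h1, h2⟩ := h.nest_smul_dot_pow_smul ht hy.2.1 hd
    have hy' : y ∈ singularStep N j s t := ⟨hy.1, hy.2.1, fun a ha => hy.2.2 a (by omega)⟩
    -- A preimage of `y`: the total power of the dot becomes `t`, which gives back `y` up to the
    -- sign. For `u < w` the total power is below `t`, so the preimage lies in the filtration step.
    refine ⟨⟨(-1 : ℤ) ^ t • X ^ (t - w) • y, ⟨⟨?_, fun u hu => ?_⟩, ?_⟩⟩, Subtype.ext ?_⟩
    · exact zsmul_mem (dot_pow_smul_mem_singularStep hN hr hj ht _ hy') _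
    · rw [smul_comm _ ((-1 : ℤ) ^ t), smul_comm _ ((-1 : ℤ) ^ t), ← mul_smul (X ^ u), ← pow_add,
        h1 _ (by omega), smul_zero]
    · refine zsmul_mem ?_ _
      have := M.smul_mem (dot_pow_mem_grading (k := k) (Γ := Γ) (s + t) (t - w) j) hyn
      convert this using 2
      push_cast [hw]
      ring
    · change (G * X ^ w) • (-1 : ℤ) ^ t • X ^ (t - w) • y = y
      rw [smul_comm _ ((-1 : ℤ) ^ t), mul_smul, ← mul_smul (X ^ w), ← pow_add,
        Nat.add_sub_cancel' hw, h2, ← mul_smul, ← pow_add, Even.neg_one_pow ⟨t, rfl⟩, one_smul]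
  have hker : Module.finrank k (LinearMap.ker f) =
      Module.finrank k ↥(singularFiltration N j s t (w + 1) ⊓ M.part n) := by
    have : (LinearMap.ker f).map (Submodule.subtype _) =
        singularFiltration N j s t (w + 1) ⊓ M.part n := by
      ext x
      constructor
      · rintro ⟨⟨x, hx, hxn⟩, hf, rfl⟩
        have hf' : (G * X ^ w) • x = 0 := congrArg Subtype.val (LinearMap.mem_ker.1 hf)
        refine ⟨⟨hx.1, fun u hu => ?_⟩, hxn⟩
        rcases Nat.lt_succ_iff_lt_or_eq.1 hu with hu | rfl
        · exact hx.2 u hu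
        · rwa [mul_smul] at hf'
      · rintro ⟨hx, hxn⟩
        refine ⟨⟨x, ⟨hx.1, fun u hu => hx.2 u (by omega)⟩, hxn⟩, ?_, rfl⟩
        refine LinearMap.mem_ker.2 (Subtype.ext ?_)
        change (G * X ^ w) • x = 0
        rw [mul_smul]
        exact hx.2 w (Nat.lt_succ_self w)
    rw [← this]
    exact (LinearEquiv.finrank_eq (Submodule.equivSubtypeMap _ _))
  have := LinearMap.finrank_range_add_finrank_ker f
  rw [hsurj, finrank_top, hker] at this
  omega

lemma singularFiltration_eq_bot (hr : r ≤ ν.degree) {j : Seq ν}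
    (hj : j ∈ blockSeq ν s r i) {t : ℕ} (ht : t < r - s) :
    singularFiltration N j s t (t + 1) = ⊥ := by
  have h := nilHecke_of_mem_blockSeq (k := k) (Γ := Γ) hr hj
  refine (Submodule.eq_bot_iff _).2 fun x hx => ?_
  exact h.eq_zero_of_nest_smul ht hx.1.2.1 hx.1.2.2 fun u hu => hx.2 u (by omega)

lemma gdim_bot : M.gdim ⊥ = 0 := by
  rw [gdim, finsum_eq_zero_of_forall_eq_zero]
  intro n
  rw [bot_inf_eq, finrank_bot, Nat.cast_zero, zero_smul]

/-- The `t + 1` subquotients of the filtration are shifts of the next singular space by `2(t - w)`,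
and the factor is `1 + q² + ⋯ + q^{2t}`. -/
lemma gdim_singularStep (hN : Stable k Γ ν r 0 N) (hr : r ≤ ν.degree) {j : Seq ν}
    (hj : j ∈ blockSeq ν s r i) {t : ℕ} (ht : t < r - s) :
    M.gdim (singularStep N j s t) =
      (∑ w ∈ Finset.range (t + 1), LaurentPolynomial.T (2 * (t - w) : ℕ)) *
        M.gdim (singularStep N j s (t + 1)) := by
  have key : ∀ w ≤ t + 1, M.gdim (singularStep N j s t) =
      M.gdim (singularFiltration N j s t w) +
      (∑ w ∈ Finset.range w, LaurentPolynomial.T (2 * (t - w) : ℕ)) *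
        M.gdim (singularStep N j s (t + 1)) := by
    intro w hw
    induction w with
    | zero => simp [singularFiltration_zero]
    | succ w ih =>
      rw [ih (by omega), gdim_eq_add fun n =>
        finrank_singularFiltration hN hr hj ht (w := w) (by omega) n, Finset.sum_range_succ,
        add_mul]
      ring
  rw [key (t + 1) le_rfl, singularFiltration_eq_bot hr hj ht, gdim_bot, zero_add]

/-- The graded dimension of the nil Hecke module of rank `n!`. -/
def qFactorial (n : ℕ) : ℤ[T;T⁻¹] :=
  ∏ t ∈ Finset.range n, ∑ w ∈ Finset.range (t + 1), LaurentPolynomial.T (2 * (t - w) : ℕ)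

lemma qFactorial_ne_zero (n : ℕ) : qFactorial n ≠ 0 := by
  refine Finset.prod_ne_zero_iff.2 fun t _ h => ?_
  -- At `q = 1` the factor takes the value `t + 1`.
  have := congrArg (LaurentPolynomial.eval₂ (RingHom.id ℤ) (1 : ℤˣ)) h
  simp [map_sum] at this
  omega

lemma gdim_singularStep_zero (hN : Stable k Γ ν r 0 N) (hr : r ≤ ν.degree) {j : Seq ν}
    (hj : j ∈ blockSeq ν s r i) {t : ℕ} (ht : t ≤ r - s) :
    M.gdim (singularStep N j s 0) = qFactorial t * M.gdim (singularStep N j s t) := by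
  induction t with
  | zero => simp [qFactorial]
  | succ t ih =>
    rw [ih (by omega), gdim_singularStep hN hr hj (by omega), ← mul_assoc, qFactorial, qFactorial,
      Finset.prod_range_succ]

/-- The weight spaces of a stable subspace in terms of those of the singular vectors. -/
lemma gdim_eq_qFactorial_mul (hN : Stable k Γ ν r 0 N) (hr : r ≤ ν.degree) {j : Seq ν}
    (hj : j ∈ blockSeq ν s r i) :
    M.gdim (N ⊓ M.weightSpace j) =
      qFactorial (r - s) * M.gdim (singular k Γ ν s r i N ⊓ M.weightSpace j) := by
  have h0 : N ⊓ M.weightSpace j = singularStep N j s 0 := by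
    ext x
    rw [Submodule.mem_inf, mem_weightSpace]
    exact ⟨fun h => ⟨h.1, h.2, fun a ha => by omega⟩, fun h => ⟨h.1, h.2.1⟩⟩
  have h1 : singular k Γ ν s r i N ⊓ M.weightSpace j = singularStep N j s (r - s) := by
    ext x
    rw [Submodule.mem_inf, mem_weightSpace]
    constructor
    · rintro ⟨h, he⟩
      refine ⟨h.1.1, he, fun a ha => ?_⟩
      rw [mul_smul, he]
      exact h.2 _ (by omega) (by omega)
    · rintro ⟨h, he, hd⟩
      refine ⟨⟨⟨h, fun l hl => ?_⟩, fun a ha ha' => ?_⟩, he⟩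
      · rw [← he, ← mul_smul, idem_mul_idem_of_ne (by rintro rfl; exact hl hj), zero_smul]
      · have := hd (a - s) (by omega)
        rwa [mul_smul, he, Nat.add_sub_cancel' ha] at this
  rw [h0, h1, gdim_singularStep_zero hN hr hj le_rfl]

end FMod
end Multiplicity

/-! ### Linear independence of characters -/

section Characters

variable {k : Type u} [Field k] {I : Type v} {Γ : SimpleGraph I} {ν : I →₀ ℕ}

local notation "𝖷" => dot k Γ ν
local notation "𝖣" => crossing k Γ ν
local notation "𝖤" => idem k Γ

namespace FMod

open Classical in
/-- The projection of a graded module to its homogeneous part of degree `n`. -/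
def proj (M : FMod k Γ ν) (n : ℤ) : M.carrier →ₗ[k] M.carrier :=
  (M.part n).subtype ∘ₗ DirectSum.component k ℤ (fun n => M.part n) n ∘ₗ
    (LinearEquiv.ofBijective (DirectSum.coeLinearMap M.part) M.isInternal).symm.toLinearMap

variable {M : FMod k Γ ν}

lemma proj_mem (n : ℤ) (x : M.carrier) : M.proj n x ∈ M.part n := Subtype.property _

open Classical in
lemma proj_apply_of_mem {m n : ℤ} {x : M.carrier} (hx : x ∈ M.part m) :
    M.proj n x = if m = n then x else 0 := by
  have h : (LinearEquiv.ofBijective (DirectSum.coeLinearMap M.part) M.isInternal).symm x =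
      DirectSum.lof k ℤ (fun n => M.part n) m ⟨x, hx⟩ :=
    (LinearEquiv.symm_apply_eq _).2 (DirectSum.coeLinearMap_lof (A := M.part) m ⟨x, hx⟩).symm
  change ((DirectSum.component k ℤ (fun n => M.part n) n
    ((LinearEquiv.ofBijective (DirectSum.coeLinearMap M.part) M.isInternal).symm x) :
      M.part n) : M.carrier) = _
  rw [h, DirectSum.component.of]
  split_ifs with e
  · subst e; rfl
  · rfl

lemma proj_eq_self_iff {n : ℤ} {x : M.carrier} : M.proj n x = x ↔ x ∈ M.part n := by
  constructor
  · intro h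
    rw [← h]
    exact proj_mem n x
  · intro h
    rw [proj_apply_of_mem h, if_pos rfl]

/-- Linear maps that agree on homogeneous elements are equal. -/
lemma linearMap_ext {Z : Type*} [AddCommGroup Z] [Module k Z] {f g : M.carrier →ₗ[k] Z}
    (h : ∀ n, ∀ x ∈ M.part n, f x = g x) : f = g := by
  classical
  have htop : ⨆ n, M.part n ≤ LinearMap.eqLocus f g := iSup_le fun n x hx => h n x hx
  rw [M.isInternal.submodule_iSup_eq_top] at htop
  exact LinearMap.ext fun x => htop (Submodule.mem_top (x := x))

variable (M) in
-- Finite dimension leaves only finitely many nonzero degrees, which gives both the finite sums and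
-- the lower bound.
lemma isGrading_proj : IsGrading k Γ ν M.proj where
  proj_self n x := proj_eq_self_iff.2 (proj_mem n x)
  proj_of_ne h x := by rw [proj_apply_of_mem (proj_mem _ x), if_neg h.symm]
  smul_proj := by
    intro d g hg n x
    have : Algebra.lsmul k k M.carrier g ∘ₗ M.proj n =
        M.proj (d + n) ∘ₗ Algebra.lsmul k k M.carrier g := by
      refine linearMap_ext fun m y hy => ?_
      change g • M.proj n y = M.proj (d + n) (g • y)
      rw [proj_apply_of_mem hy, proj_apply_of_mem (M.smul_mem hg hy)]
      by_cases h : m = n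
      · rw [if_pos h, if_pos (by rw [h])]
      · rw [if_neg h, if_neg (by simpa using h), smul_zero]
    exact LinearMap.congr_fun this x
  exists_sum x := by
    refine ⟨M.finite_part_ne_bot.toFinset, ?_⟩
    have : ∑ n ∈ M.finite_part_ne_bot.toFinset, M.proj n = LinearMap.id := by
      refine linearMap_ext fun m y hy => ?_
      rw [LinearMap.sum_apply, LinearMap.id_apply, Finset.sum_eq_single m]
      · exact proj_eq_self_iff.2 hy
      · intro n _ hn
        rw [proj_apply_of_mem hy, if_neg hn.symm]
      · intro hm
        have hm' : M.part m = ⊥ := by simpa using hm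
        rw [hm', Submodule.mem_bot] at hy
        rw [hy, map_zero]
    simpa [LinearMap.sum_apply] using LinearMap.congr_fun this x
  bounded := by
    obtain ⟨b, hb⟩ := M.finite_part_ne_bot.bddBelow
    refine ⟨b, fun n hn => LinearMap.ext fun x => ?_⟩
    have : M.part n = ⊥ := by
      by_contra h
      exact absurd (hb h) (not_le.2 hn)
    have h := proj_mem n x
    rwa [this, Submodule.mem_bot] at h

/-- The character of a subspace. -/
def subChar (N : Submodule k M.carrier) : Seq ν →₀ ℤ[T;T⁻¹] :=
  Finsupp.equivFunOnFinite.symm fun j => M.gdim (N ⊓ M.weightSpace j)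

lemma subChar_apply (N : Submodule k M.carrier) (j : Seq ν) :
    subChar N j = M.gdim (N ⊓ M.weightSpace j) := rfl

lemma subChar_top : subChar (⊤ : Submodule k M.carrier) = M.char := by
  refine Finsupp.ext fun j => ?_
  rw [subChar_apply, top_inf_eq]
  rfl

lemma weightSpace_le_weightSum {J : Set (Seq ν)} {j : Seq ν} (hj : j ∈ J) :
    M.weightSpace j ≤ weightSum k Γ M.carrier J := fun x hx l hl => by
  rw [mem_weightSpace] at hx
  rw [← hx, ← mul_smul, idem_mul_idem_of_ne (by rintro rfl; exact hl hj), zero_smul]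

lemma inf_weightSpace_eq_bot {N : Submodule k M.carrier} {J : Set (Seq ν)}
    (hN : N ≤ weightSum k Γ M.carrier J) {j : Seq ν} (hj : j ∉ J) : N ⊓ M.weightSpace j = ⊥ := by
  refine (Submodule.eq_bot_iff _).2 fun x hx => ?_
  rw [← mem_weightSpace.1 hx.2]
  exact hN hx.1 j hj

lemma gdim_span_singleton {x : M.carrier} {n : ℤ} (hx : x ∈ M.part n) (hx0 : x ≠ 0) :
    M.gdim (k ∙ x) = LaurentPolynomial.T n := by
  rw [gdim, finsum_eq_single _ n]
  · have : (k ∙ x) ⊓ M.part n = k ∙ x :=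
      inf_eq_left.2 ((Submodule.span_singleton_le_iff_mem _ _).2 hx)
    rw [this, finrank_span_singleton hx0, Nat.cast_one, one_smul]
  · intro m hm
    have : (k ∙ x) ⊓ M.part m = ⊥ := by
      refine (Submodule.eq_bot_iff _).2 fun y hy => ?_
      obtain ⟨hy, hym⟩ := hy
      obtain ⟨c, rfl⟩ := Submodule.mem_span_singleton.1 hy
      rw [← proj_eq_self_iff.2 hym, proj_apply_of_mem (Submodule.smul_mem _ c hx),
        if_neg hm.symm]
    rw [this, finrank_bot, Nat.cast_zero, zero_smul]

end FMod

section Shift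

variable {Y : Type*} [AddCommGroup Y] [Module k Y] [Module (R k Γ ν) Y] [IsScalarTower k (R k Γ ν) Y]
variable {π : ℤ → Y →ₗ[k] Y}

lemma IsGrading.shift (hπ : IsGrading k Γ ν π) (a : ℤ) :
    IsGrading k Γ ν (fun n => π (n - a)) where
  proj_self n x := hπ.proj_self _ x
  proj_of_ne h x := hπ.proj_of_ne (by simpa using h) x
  smul_proj hg n x := by rw [hπ.smul_proj hg, add_sub_assoc]
  exists_sum x := by
    obtain ⟨s, hs⟩ := hπ.exists_sum x
    exact ⟨s.map (Equiv.addRight a).toEmbedding, by simpa using hs⟩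
  bounded := by
    obtain ⟨b, hb⟩ := hπ.bounded
    exact ⟨b + a, fun n hn => hb _ (by omega)⟩

lemma isHomog_shift_iff {a : ℤ} {N : Submodule k Y} :
    IsHomog (fun n => π (n - a)) N ↔ IsHomog π N :=
  ⟨fun h n x hx => by simpa using h (n + a) x hx, fun h n x hx => h (n - a) x hx⟩

lemma IsSimpleSub.shift {r : ℕ} {N : Submodule k Y} (h : IsSimpleSub (Γ := Γ) (ν := ν) π r N)
    (a : ℤ) : IsSimpleSub (Γ := Γ) (ν := ν) (fun n => π (n - a)) r N :=
  ⟨h.ne_bot, isHomog_shift_iff.2 h.homog, h.stable,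
    fun N' h1 h2 h3 h4 => h.eq_of_le N' h1 h2 (isHomog_shift_iff.1 h3) h4⟩

/-- A simple subspace without dots and crossings is spanned by a homogeneous weight vector. -/
lemma IsSimpleSub.exists_eq_span (hπ : IsGrading k Γ ν π) {N : Submodule k Y}
    (h : IsSimpleSub (Γ := Γ) (ν := ν) π 0 N) :
    ∃ (j : Seq ν) (n : ℤ) (x : Y), x ≠ 0 ∧ 𝖤 j • x = x ∧ π n x = x ∧ N = k ∙ x := by
  obtain ⟨y, hy, hy0⟩ := N.exists_mem_ne_zero_of_ne_bot h.ne_bot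
  obtain ⟨n, hn⟩ : ∃ n, π n y ≠ 0 := by
    by_contra! h'
    exact hy0 (hπ.eq_zero h')
  obtain ⟨j, hj⟩ : ∃ j : Seq ν, 𝖤 j • π n y ≠ 0 := by
    by_contra! h'
    exact hn (eq_zero_of_idem_smul (k := k) (Γ := Γ) (ν := ν) h')
  have h1 : 𝖤 j • 𝖤 j • π n y = 𝖤 j • π n y := by rw [← mul_smul, FMod.idem_mul_idem]
  have h2 : π n (𝖤 j • π n y) = 𝖤 j • π n y := by rw [hπ.proj_idem_smul, hπ.proj_self]
  refine ⟨j, n, 𝖤 j • π n y, hj, h1, h2, (h.eq_of_le _ ?_ ?_ ?_ ?_).symm⟩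
  · exact (Submodule.span_singleton_le_iff_mem _ _).2 (h.stable.idem_smul j _ (h.homog n y hy))
  · rwa [Ne, Submodule.span_singleton_eq_bot]
  · intro m z hz
    obtain ⟨c, rfl⟩ := Submodule.mem_span_singleton.1 hz
    rcases eq_or_ne m n with rfl | hmn
    · rw [map_smul, h2]
      exact hz
    · rw [map_smul, ← h2, hπ.proj_of_ne hmn, smul_zero]
      exact zero_mem _
  · refine ⟨fun l z hz => ?_, fun a ha => by omega, fun a ha => by omega⟩
    obtain ⟨c, rfl⟩ := Submodule.mem_span_singleton.1 hz
    rcases eq_or_ne l j with rfl | hlj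
    · rw [smul_comm, h1]
      exact hz
    · rw [smul_comm, ← mul_smul, idem_mul_idem_of_ne hlj, zero_smul, smul_zero]
      exact zero_mem _

variable {Y' : Type*} [AddCommGroup Y'] [Module k Y'] [Module (R k Γ ν) Y']
  [IsScalarTower k (R k Γ ν) Y'] {π' : ℤ → Y' →ₗ[k] Y'}

/-- The base of the induction: homogeneous lines of equal weight are isomorphic after the shift by
the difference of their degrees. -/
lemma isIsoGraph_span (hπ : IsGrading k Γ ν π) (hπ' : IsGrading k Γ ν π') {x : Y} {y : Y'} {n m : ℤ}
    {j : Seq ν} (hx : 𝖤 j • x = x) (hy : 𝖤 j • y = y) (hxn : π n x = x) (hym : π' m y = y)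
    (hx0 : x ≠ 0) (hy0 : y ≠ 0) :
    IsIsoGraph (Γ := Γ) (ν := ν) π (fun l => π' (l - (n - m))) 0 (k ∙ x) (k ∙ y)
      (k ∙ (x, y)) where
  homog := by
    intro l z hz
    obtain ⟨c, rfl⟩ := Submodule.mem_span_singleton.1 hz
    rcases eq_or_ne l n with rfl | hln
    · rw [map_smul, LinearMap.prodMap_apply, hxn, sub_sub_cancel, hym]
      exact hz
    · rw [map_smul, LinearMap.prodMap_apply, ← hxn, ← hym, hπ.proj_of_ne hln,
        hπ'.proj_of_ne (by omega)]
      rw [Prod.mk_zero_zero, smul_zero]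
      exact zero_mem _
  stable := by
    refine ⟨fun l z hz => ?_, fun a ha => by omega, fun a ha => by omega⟩
    obtain ⟨c, rfl⟩ := Submodule.mem_span_singleton.1 hz
    rw [smul_comm]
    rcases eq_or_ne l j with rfl | hlj
    · rw [show 𝖤 l • (x, y) = (x, y) from Prod.ext hx hy]
      exact hz
    · have h0 : 𝖤 l • (x, y) = 0 := Prod.ext
        (by rw [Prod.smul_fst, ← hx, ← mul_smul, idem_mul_idem_of_ne hlj, zero_smul]; rfl)
        (by rw [Prod.smul_snd, ← hy, ← mul_smul, idem_mul_idem_of_ne hlj, zero_smul]; rfl)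
      rw [h0, smul_zero]
      exact zero_mem _
  map_fst := by rw [Submodule.map_span, Set.image_singleton]; rfl
  map_snd := by rw [Submodule.map_span, Set.image_singleton]; rfl
  eq_zero_fst z hz := by
    obtain ⟨c, hc⟩ := Submodule.mem_span_singleton.1 hz
    rw [Prod.smul_mk, Prod.mk.injEq] at hc
    rw [← hc.1, (smul_eq_zero.1 hc.2).resolve_right hy0, zero_smul]
  eq_zero_snd z hz := by
    obtain ⟨c, hc⟩ := Submodule.mem_span_singleton.1 hz
    rw [Prod.smul_mk, Prod.mk.injEq] at hc
    rw [← hc.2, (smul_eq_zero.1 hc.1).resolve_right hx0, zero_smul]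

/-- A block from `s` preceded by `i` is a block from `s - 1`, so maximality of the block gives the
condition on the entry before it. -/
lemma blockPart_le_avoid {s r : ℕ} {i : I} {N : Submodule k Y} (hN : Stable k Γ ν r 0 N)
    (h : 0 < s → blockPart k Γ ν (s - 1) r i N = ⊥) :
    blockPart k Γ ν s r i N ≤ weightSum k Γ Y (avoidSeq ν s i) := by
  intro x hx j hj
  obtain ⟨hs, hl⟩ : 0 < s ∧ j.label (s - 1) = some i := by simpa [avoidSeq] using hj
  rw [← Submodule.mem_bot k, ← h hs]
  refine ⟨hN.idem_smul j x hx.1, fun l hl' => ?_⟩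
  rcases eq_or_ne l j with rfl | hlj
  · rw [hx.2 l, smul_zero]
    refine fun hls => hl' fun a ha ha' => ?_
    rcases eq_or_ne a (s - 1) with rfl | hne
    · exact hl
    · exact hls a (by omega) ha'
  · rw [← mul_smul, idem_mul_idem_of_ne hlj, zero_smul]

end Shift

open FMod

/-- The characters of simple subspaces are linearly independent. -/
theorem linearIndependent_subChar (r : ℕ) (hr : r ≤ ν.degree) {B : Type*} (S : B → FMod k Γ ν)
    (N : ∀ b, Submodule k (S b).carrier)
    (hN : ∀ b, IsSimpleSub (Γ := Γ) (ν := ν) (S b).proj r (N b))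
    (hS : ∀ b c, ∀ a : ℤ, ∀ Z, IsIsoGraph (Γ := Γ) (ν := ν) (S b).proj
      (fun n => (S c).proj (n - a)) r (N b) (N c) Z → b = c) :
    LinearIndependent ℤ[T;T⁻¹] fun b => subChar (N b) := by
  classical
  induction r using Nat.strong_induction_on generalizing B with
  | _ r ih =>
  rw [linearIndependent_iff']
  intro t g hg
  by_contra! hne
  obtain ⟨b₀, hb₀, hgb₀⟩ := hne
  have hgj : ∀ j, ∑ b ∈ t, g b * (S b).gdim (N b ⊓ (S b).weightSpace j) = 0 := fun j => by
    have := DFunLike.congr_fun hg j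
    rw [Finsupp.finsetSum_apply] at this
    exact this
  rcases Nat.eq_zero_or_pos r with rfl | hr0
  -- Without strands every object is a line. Distinct indices have distinct weights, so the
  -- coefficient at the weight of `b₀` isolates a single unit times `g b₀`.
  · choose j n x hx0 hjx hnx hNx using fun b => (hN b).exists_eq_span (S b).isGrading_proj
    have hinj : Function.Injective j := fun b c hbc => by
      refine hS b c (n b - n c) (k ∙ (x b, x c)) ?_
      rw [hNx b, hNx c]
      exact isIsoGraph_span (S b).isGrading_proj (S c).isGrading_proj (hjx b) (hbc ▸ hjx c)
        (hnx b) (hnx c) (hx0 b) (hx0 c)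
    have h0 := hgj (j b₀)
    rw [Finset.sum_eq_single b₀] at h0
    · have : N b₀ ⊓ (S b₀).weightSpace (j b₀) = k ∙ x b₀ := by
        rw [hNx b₀]
        exact inf_eq_left.2 ((Submodule.span_singleton_le_iff_mem _ _).2
          (mem_weightSpace.2 (hjx b₀)))
      rw [this, gdim_span_singleton (proj_eq_self_iff.1 (hnx b₀)) (hx0 b₀)] at h0
      exact hgb₀ ((LaurentPolynomial.isUnit_T (n b₀)).mul_left_eq_zero.1 h0)
    · intro b _ hb
      have : N b ⊓ (S b).weightSpace (j b₀) = ⊥ := by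
        refine inf_weightSpace_eq_bot (J := {j b}) ?_ fun h => hb (hinj h).symm
        rw [hNx b, Submodule.span_singleton_le_iff_mem]
        exact weightSpace_le_weightSum (Set.mem_singleton _) (mem_weightSpace.2 (hjx b))
      rw [this, gdim_bot, mul_zero]
    · exact fun h => absurd hb₀ h
  · obtain ⟨x, hx, hx0⟩ := (N b₀).exists_mem_ne_zero_of_ne_bot (hN b₀).ne_bot
    obtain ⟨j, hj⟩ : ∃ j : Seq ν, 𝖤 j • x ≠ 0 := by
      by_contra! h'
      exact hx0 (eq_zero_of_idem_smul (k := k) (Γ := Γ) (ν := ν) h')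
    -- The label of the block is the entry in position `r - 1` of a weight occurring in `N b₀`; it
    -- gives a block of length at least one, whence `s < r` below.
    obtain ⟨i, hi⟩ : ∃ i, j.label (r - 1) = some i := ⟨_, Seq.label_of_lt (by omega) j⟩
    have hlast : ∃ b ∈ t, g b ≠ 0 ∧ blockPart k Γ ν (r - 1) r i (N b) ≠ ⊥ := by
      refine ⟨b₀, hb₀, hgb₀, (Submodule.ne_bot_iff _).2
        ⟨𝖤 j • x, ⟨(hN b₀).stable.idem_smul j x hx, weightSpace_le_weightSum ?_ ⟨x, rfl⟩⟩, hj⟩⟩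
      intro a ha ha'
      obtain rfl : a = r - 1 := by omega
      exact hi
    have hex : ∃ s, ∃ b ∈ t, g b ≠ 0 ∧ blockPart k Γ ν s r i (N b) ≠ ⊥ := ⟨r - 1, hlast⟩
    obtain ⟨s, hs, hmin⟩ : ∃ s < r, (∃ b ∈ t, g b ≠ 0 ∧ blockPart k Γ ν s r i (N b) ≠ ⊥) ∧
        ∀ b ∈ t, g b ≠ 0 → 0 < s → blockPart k Γ ν (s - 1) r i (N b) = ⊥ := by
      refine ⟨Nat.find hex, (Nat.find_min' hex hlast).trans_lt (by omega), Nat.find_spec hex,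
        fun b hb hgb h0 => ?_⟩
      by_contra h
      exact Nat.find_min hex (m := Nat.find hex - 1) (by omega) ⟨b, hb, hgb, h⟩
    obtain ⟨⟨b₁, hb₁, hgb₁, hNb₁⟩, hmin⟩ := hmin
    -- The members that attain the longest block; only these contribute to the coefficients at its
    -- weights.
    set t' := t.filter fun b => g b ≠ 0 ∧ blockPart k Γ ν s r i (N b) ≠ ⊥ with ht'
    have hav : ∀ b ∈ t', blockPart k Γ ν s r i (N b) ≤
        weightSum k Γ (S b).carrier (avoidSeq ν s i) := fun b hb => by
      rw [ht', Finset.mem_filter] at hb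
      exact blockPart_le_avoid (hN b).stable (hmin b hb.1 hb.2.1)
    have hnb : ∀ b ∈ t', blockPart k Γ ν s r i (N b) ≠ ⊥ := fun b hb => by
      rw [ht', Finset.mem_filter] at hb
      exact hb.2.2
    have hli : LinearIndepOn ℤ[T;T⁻¹] (fun b => subChar (singular k Γ ν s r i (N b)))
        (t' : Set B) := by
      refine ih s hs (by omega) (fun b : (t' : Set B) => S b) (fun b => singular k Γ ν s r i (N b))
        (fun b => (hN b).singular (S b).isGrading_proj hs.le hr (hav b b.2) (hnb b b.2))
        fun b c a Z hZ => Subtype.ext (hS b c a (generate k Γ ν r Z) ?_)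
      exact (hN b).exists_isIsoGraph (S b).isGrading_proj ((S c).isGrading_proj.shift a)
        ((hN c).shift a) hs.le hr (hav b b.2) (hav c c.2) (hnb b b.2) (hnb c c.2) hZ
    rw [linearIndepOn_finset_iff] at hli
    -- Multiplied by the common `q`-factorial, the coefficients give a relation among the singular
    -- parts; at weights without the block all terms vanish.
    have hz := hli (fun b => g b * qFactorial (r - s)) ?_ b₁
      (by rw [ht', Finset.mem_filter]; exact ⟨hb₁, hgb₁, hNb₁⟩)
    · exact (mul_ne_zero hgb₁ (qFactorial_ne_zero _)) hz
    · refine Finsupp.ext fun l => ?_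
      rw [Finsupp.finsetSum_apply, Finsupp.zero_apply]
      by_cases hl : l ∈ blockSeq ν s r i
      · rw [← hgj l, ht', Finset.sum_filter]
        refine Finset.sum_congr rfl fun b _ => ?_
        split_ifs with h
        · rw [gdim_eq_qFactorial_mul (hN b).stable hr hl, ← mul_assoc]
          rfl
        · by_cases hgb : g b = 0
          · rw [hgb, zero_mul]
          · have hb : blockPart k Γ ν s r i (N b) = ⊥ := by
              by_contra hb
              exact h ⟨hgb, hb⟩
            have : N b ⊓ (S b).weightSpace l = ⊥ :=
              le_bot_iff.1 (hb ▸ inf_le_inf_left _ (weightSpace_le_weightSum hl))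
            rw [this, gdim_bot, mul_zero]
      · refine Finset.sum_eq_zero fun b _ => ?_
        have : singular k Γ ν s r i (N b) ⊓ (S b).weightSpace l = ⊥ :=
          
          inf_weightSpace_eq_bot ((singular_le_blockPart _).trans inf_le_right) hl
        rw [Finsupp.smul_apply, subChar_apply, this, gdim_bot, smul_zero]

end Characters

/-! ### From stable subspaces to graded modules and the Grothendieck group -/

section Modules

variable {k : Type u} [Field k] {I : Type v} {Γ : SimpleGraph I} {ν : I →₀ ℕ}

section General

variable {Y : Type*} [AddCommGroup Y] [Module k Y] [Module (R k Γ ν) Y] [IsScalarTower k (R k Γ ν) Y]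

/-- Stability under the generators is stability under the whole ring. -/
lemma Stable.smul_mem {N : Submodule k Y} (hN : Stable k Γ ν ν.degree 0 N) (g : R k Γ ν) :
    ∀ x ∈ N, g • x ∈ N := by
  obtain ⟨z, rfl⟩ := RingQuot.mkAlgHom_surjective k (Rel k Γ ν) g
  induction z using FreeAlgebra.induction with
  | grade0 c =>
    intro x hx
    rw [AlgHom.commutes, algebraMap_smul]
    exact N.smul_mem c hx
  | grade1 z =>
    intro x hx
    change gen k Γ ν z • x ∈ N
    cases z with
    | idem j => exact hN.idem_smul j x hx
    | dot a h j =>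
      rw [← dot_mul_idem_eq_gen h, mul_smul]
      exact hN.dot_smul a h _ (hN.idem_smul j x hx)
    | cross a h j =>
      rw [← crossing_mul_idem_eq_gen h, mul_smul]
      exact hN.crossing_smul a h (by omega) _ (hN.idem_smul j x hx)
  | mul z z' hz hz' =>
    intro x hx
    rw [map_mul, mul_smul]
    exact hz _ (hz' x hx)
  | add z z' hz hz' =>
    intro x hx
    rw [map_add, add_smul]
    exact add_mem (hz x hx) (hz' x hx)

/-- A stable subspace as a submodule. -/
def Stable.toSubmodule {N : Submodule k Y} (hN : Stable k Γ ν ν.degree 0 N) :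
    Submodule (R k Γ ν) Y :=
  { N with smul_mem' := fun g x hx => hN.smul_mem g x hx }

lemma Stable.mem_toSubmodule {N : Submodule k Y} (hN : Stable k Γ ν ν.degree 0 N) {x : Y} :
    x ∈ hN.toSubmodule ↔ x ∈ N := Iff.rfl

end General

namespace FMod

variable {M : FMod k Γ ν}

lemma isGradedSubmodule_iff (N : Submodule (R k Γ ν) M.carrier) :
    M.IsGradedSubmodule N ↔ IsHomog M.proj (N.restrictScalars k) := by
  constructor
  · intro h n x hx
    have : N.restrictScalars k ≤ (N.restrictScalars k).comap (M.proj n) := by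
      conv_lhs => rw [h]
      refine iSup_le fun m x hx => ?_
      classical
      rw [Submodule.mem_comap, proj_apply_of_mem hx.2]
      split_ifs
      · exact hx.1
      · exact zero_mem _
    exact this hx
  · intro h
    refine le_antisymm (fun x hx => ?_) (iSup_le fun n => inf_le_left)
    obtain ⟨s, hs⟩ := M.isGrading_proj.exists_sum x
    rw [← hs]
    exact sum_mem fun n _ => Submodule.mem_iSup_of_mem n ⟨h n x hx, proj_mem n x⟩

/-- For all `ν.degree` strands, stable subspaces are submodules. -/
lemma IsSimple.isSimpleSub (hM : M.IsSimple) :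
    IsSimpleSub (Γ := Γ) (ν := ν) M.proj ν.degree (⊤ : Submodule k M.carrier) where
  ne_bot := by
    have := hM.1
    exact top_ne_bot
  homog := fun _ _ _ => Submodule.mem_top
  stable := ⟨fun _ _ _ => Submodule.mem_top, fun _ _ _ _ => Submodule.mem_top,
    fun _ _ _ _ _ => Submodule.mem_top⟩
  eq_of_le N _ hN0 hNh hNs := by
    rcases hM.2 hNs.toSubmodule ((isGradedSubmodule_iff _).2 hNh) with h | h
    · refine absurd ((Submodule.eq_bot_iff _).2 fun x hx => ?_) hN0
      exact (Submodule.mem_bot _).1 (h ▸ hNs.mem_toSubmodule.2 hx)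
    · refine eq_top_iff.2 fun x _ => hNs.mem_toSubmodule.1 ?_
      rw [h]
      exact Submodule.mem_top

/-- Both projections of the graph are bijective and linear over the ring. -/
lemma iso_of_isIsoGraph {M' : FMod k Γ ν} {a : ℤ} {Z : Submodule k (M.carrier × M'.carrier)}
    (hZ : IsIsoGraph (Γ := Γ) (ν := ν) M.proj (fun n => M'.proj (n - a)) ν.degree ⊤ ⊤ Z) :
    Iso M (M'.shift a) := by
  let p := LinearMap.fst (R k Γ ν) M.carrier M'.carrier ∘ₗ hZ.stable.toSubmodule.subtype
  let p' := LinearMap.snd (R k Γ ν) M.carrier M'.carrier ∘ₗ hZ.stable.toSubmodule.subtype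
  have hp : Function.Bijective p := by
    refine ⟨?_, fun x => ?_⟩
    · rintro ⟨⟨x, y⟩, hz⟩ ⟨⟨x', y'⟩, hz'⟩ (rfl : x = x')
      have h := Z.sub_mem hz hz'
      rw [Prod.mk_sub_mk, sub_self] at h
      exact Subtype.ext (Prod.ext rfl (sub_eq_zero.1 (hZ.eq_zero_snd _ h)))
    · obtain ⟨z, hz, rfl⟩ := (hZ.map_fst.ge : _ ≤ _) (Submodule.mem_top (x := x))
      exact ⟨⟨z, hz⟩, rfl⟩
  have hp' : Function.Bijective p' := by
    refine ⟨?_, fun y => ?_⟩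
    · rintro ⟨⟨x, y⟩, hz⟩ ⟨⟨x', y'⟩, hz'⟩ (rfl : y = y')
      have h := Z.sub_mem hz hz'
      rw [Prod.mk_sub_mk, sub_self] at h
      exact Subtype.ext (Prod.ext (sub_eq_zero.1 (hZ.eq_zero_fst _ h)) rfl)
    · obtain ⟨z, hz, rfl⟩ := (hZ.map_snd.ge : _ ≤ _) (Submodule.mem_top (x := y))
      exact ⟨⟨z, hz⟩, rfl⟩
  let e := LinearEquiv.ofBijective p hp
  let e' := LinearEquiv.ofBijective p' hp'
  refine ⟨e.symm.trans e', ?_, ?_⟩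
  · intro n x hx
    change e' (e.symm x) ∈ M'.part (n - a)
    obtain ⟨⟨⟨x, y⟩, hz⟩, rfl⟩ := e.surjective x
    rw [LinearEquiv.symm_apply_apply]
    have hx' : x ∈ M.part n := hx
    change y ∈ M'.part (n - a)
    -- Subtracting its component of degree `n` from a point of the graph leaves a point with first
    -- coordinate zero, so the second coordinate is homogeneous too.
    have h1 := sub_mem hz (hZ.homog n _ hz)
    rw [LinearMap.prodMap_apply, Prod.mk_sub_mk, proj_eq_self_iff.2 hx', sub_self] at h1
    rw [← proj_eq_self_iff]
    exact (sub_eq_zero.1 (hZ.eq_zero_snd _ h1)).symm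
  · intro n y hy
    change e (e'.symm y) ∈ M.part n
    obtain ⟨⟨⟨x, y⟩, hz⟩, rfl⟩ := e'.surjective y
    erw [LinearEquiv.symm_apply_apply]
    have hy' : y ∈ M'.part (n - a) := hy
    change x ∈ M.part n
    have h1 := sub_mem hz (hZ.homog n _ hz)
    rw [LinearMap.prodMap_apply, Prod.mk_sub_mk, proj_eq_self_iff.2 hy', sub_self] at h1
    rw [← proj_eq_self_iff]
    exact (sub_eq_zero.1 (hZ.eq_zero_fst _ h1)).symm

/-- The characters of simple modules that are pairwise not isomorphic up to shifts are linearly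
independent. -/
theorem linearIndependent_char {B : Type*} (S : B → FMod k Γ ν) (hS : ∀ b, (S b).IsSimple)
    (hS' : ∀ b c, ∀ a : ℤ, Iso (S b) ((S c).shift a) → b = c) :
    LinearIndependent ℤ[T;T⁻¹] fun b => (S b).char := by
  have := linearIndependent_subChar ν.degree le_rfl S (fun b => ⊤) (fun b => (hS b).isSimpleSub)
    fun b c a Z hZ => hS' b c a (iso_of_isIsoGraph hZ)
  simpa only [subChar_top] using this

/-! ### Submodules and quotients -/

section Construction

variable {Y : Type max u v} [AddCommGroup Y] [Module k Y] [Module (R k Γ ν) Y]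
  [IsScalarTower k (R k Γ ν) Y] [Module.Finite k Y]

/-- A finite-dimensional module with projections to homogeneous parts as a graded module. -/
def ofGrading (π : ℤ → Y →ₗ[k] Y) (hπ : IsGrading k Γ ν π) : FMod k Γ ν where
  carrier := Y
  part n := LinearMap.range (π n)
  isInternal := by
    rw [DirectSum.isInternal_submodule_iff_iSupIndep_and_iSup_eq_top]
    constructor
    · rw [iSupIndep_def]
      intro n
      rw [Submodule.disjoint_def]
      rintro _ ⟨x, rfl⟩ h
      have : ⨆ m, ⨆ (_ : m ≠ n), LinearMap.range (π m) ≤ LinearMap.ker (π n) := by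
        refine iSup₂_le fun m hm => ?_
        rintro _ ⟨y, rfl⟩
        exact hπ.proj_of_ne hm.symm y
      rw [← hπ.proj_self]
      exact this h
    · refine eq_top_iff.2 fun x _ => ?_
      obtain ⟨s, hs⟩ := hπ.exists_sum x
      rw [← hs]
      exact sum_mem fun n _ => Submodule.mem_iSup_of_mem n ⟨x, rfl⟩
  smul_mem := by
    rintro m n g _ hg ⟨x, rfl⟩
    exact ⟨g • x, (hπ.smul_proj hg n x).symm⟩

lemma mem_part_ofGrading {π : ℤ → Y →ₗ[k] Y} {hπ : IsGrading k Γ ν π} {n : ℤ} {x : Y} :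
    x ∈ (ofGrading π hπ).part n ↔ π n x = x :=
  ⟨fun ⟨y, hy⟩ => hy ▸ hπ.proj_self n y, fun h => ⟨x, h⟩⟩

end Construction

/-- The projections to the homogeneous parts of a graded submodule. -/
def subProj (N : Submodule (R k Γ ν) M.carrier) (hN : M.IsGradedSubmodule N) (n : ℤ) :
    N →ₗ[k] N :=
  (M.proj n).restrict (p := N.restrictScalars k) (q := N.restrictScalars k)
    ((isGradedSubmodule_iff N).1 hN n)

lemma coe_subProj (N : Submodule (R k Γ ν) M.carrier) (hN : M.IsGradedSubmodule N) (n : ℤ)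
    (x : N) : (subProj N hN n x : M.carrier) = M.proj n x := rfl

lemma isGrading_subProj (N : Submodule (R k Γ ν) M.carrier) (hN : M.IsGradedSubmodule N) :
    IsGrading (Y := N) k Γ ν (subProj N hN) where
  proj_self n x := Subtype.ext (M.isGrading_proj.proj_self n x)
  proj_of_ne h x := Subtype.ext (M.isGrading_proj.proj_of_ne h x)
  smul_proj hg n x := Subtype.ext (M.isGrading_proj.smul_proj hg n x)
  exists_sum x := by
    obtain ⟨s, hs⟩ := M.isGrading_proj.exists_sum (x : M.carrier)
    refine ⟨s, Subtype.ext ?_⟩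
    rw [AddSubmonoidClass.coe_finsetSum]
    exact hs
  bounded := by
    obtain ⟨b, hb⟩ := M.isGrading_proj.bounded
    refine ⟨b, fun n hn => LinearMap.ext fun x => Subtype.ext ?_⟩
    rw [coe_subProj, hb n hn]
    rfl

/-- The projections to the homogeneous parts of the quotient by a graded submodule. -/
def quotProj (N : Submodule (R k Γ ν) M.carrier) (hN : M.IsGradedSubmodule N) (n : ℤ) :
    (M.carrier ⧸ N) →ₗ[k] (M.carrier ⧸ N) :=
  (N.restrictScalars k).mapQ (N.restrictScalars k) (M.proj n)
    ((isGradedSubmodule_iff N).1 hN n)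

lemma quotProj_mk (N : Submodule (R k Γ ν) M.carrier) (hN : M.IsGradedSubmodule N) (n : ℤ)
    (x : M.carrier) : quotProj N hN n (N.mkQ x) = N.mkQ (M.proj n x) := rfl

lemma isGrading_quotProj (N : Submodule (R k Γ ν) M.carrier) (hN : M.IsGradedSubmodule N) :
    IsGrading (Y := M.carrier ⧸ N) k Γ ν (quotProj N hN) where
  proj_self n x := by
    obtain ⟨x, rfl⟩ := N.mkQ_surjective x
    rw [quotProj_mk, quotProj_mk, M.isGrading_proj.proj_self]
  proj_of_ne h x := by
    obtain ⟨x, rfl⟩ := N.mkQ_surjective x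
    rw [quotProj_mk, quotProj_mk, M.isGrading_proj.proj_of_ne h, map_zero]
  smul_proj {_ g} hg n x := by
    obtain ⟨x, rfl⟩ := N.mkQ_surjective x
    change N.mkQ (g • M.proj n x) = N.mkQ (M.proj _ (g • x))
    rw [M.isGrading_proj.smul_proj hg]
  exists_sum x := by
    obtain ⟨x, rfl⟩ := N.mkQ_surjective x
    obtain ⟨s, hs⟩ := M.isGrading_proj.exists_sum x
    refine ⟨s, ?_⟩
    simp only [quotProj_mk, ← map_sum, hs]
  bounded := by
    obtain ⟨b, hb⟩ := M.isGrading_proj.bounded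
    refine ⟨b, fun n hn => LinearMap.ext fun x => ?_⟩
    obtain ⟨x, rfl⟩ := N.mkQ_surjective x
    rw [quotProj_mk, hb n hn, LinearMap.zero_apply, map_zero, LinearMap.zero_apply]

instance (N : Submodule (R k Γ ν) M.carrier) : Module.Finite k N :=
  inferInstanceAs (Module.Finite k (N.restrictScalars k))

instance (N : Submodule (R k Γ ν) M.carrier) : Module.Finite k (M.carrier ⧸ N) :=
  inferInstanceAs (Module.Finite k (M.carrier ⧸ N.restrictScalars k))

/-- A graded submodule as a graded module. -/
def sub (N : Submodule (R k Γ ν) M.carrier) (hN : M.IsGradedSubmodule N) : FMod k Γ ν :=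
  ofGrading.{u, v} (Y := N) (subProj N hN) (isGrading_subProj N hN)

/-- The quotient of a graded module by a graded submodule. -/
def quot (N : Submodule (R k Γ ν) M.carrier) (hN : M.IsGradedSubmodule N) : FMod k Γ ν :=
  ofGrading.{u, v} (Y := M.carrier ⧸ N) (quotProj N hN) (isGrading_quotProj N hN)

lemma shortExact_sub_quot (N : Submodule (R k Γ ν) M.carrier) (hN : M.IsGradedSubmodule N) :
    ShortExact (sub N hN) M (quot N hN) := by
  refine ⟨N.subtype, N.mkQ, fun n x hx => ?_, fun n x hx => ?_, N.injective_subtype,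
    LinearMap.exact_subtype_mkQ N, N.mkQ_surjective⟩
  · have := congrArg Subtype.val (mem_part_ofGrading.1 hx)
    exact proj_eq_self_iff.1 this
  · have h : quotProj N hN n (N.mkQ x) = N.mkQ x := by rw [quotProj_mk, proj_eq_self_iff.2 hx]
    exact ⟨N.mkQ x, h⟩

/-! ### Generation of the Grothendieck group by simple modules -/

/-- The zero maps form a short exact sequence with all three terms `M`, so its class is twice
itself. -/
lemma cls_eq_zero [Subsingleton M.carrier] : G0.cls M = 0 := by
  have : ShortExact M M M :=
    ⟨0, 0, fun _ _ _ => zero_mem _, fun _ _ _ => zero_mem _,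
      Function.injective_of_subsingleton _, fun x => ⟨fun _ => ⟨0, Subsingleton.elim _ _⟩,
        fun _ => Subsingleton.elim _ _⟩, fun x => ⟨0, Subsingleton.elim _ _⟩⟩
  simpa using G0.cls_eq_add this

lemma isGradedSubmodule_bot : M.IsGradedSubmodule ⊥ :=
  (isGradedSubmodule_iff _).2 fun n x hx => by
    have : x = 0 := hx
    rw [this, map_zero]
    exact zero_mem _

lemma Iso.cls_eq {M' : FMod k Γ ν} (h : Iso M M') : G0.cls M = G0.cls M' := by
  obtain ⟨f, hf, -⟩ := h
  have hs : Subsingleton (sub (M := M) (⊥ : Submodule (R k Γ ν) M.carrier) isGradedSubmodule_bot).carrier :=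
    inferInstanceAs (Subsingleton (⊥ : Submodule (R k Γ ν) M.carrier))
  have : ShortExact (sub (⊥ : Submodule (R k Γ ν) M.carrier) isGradedSubmodule_bot) M M' := by
    refine ⟨0, f.toLinearMap, fun _ _ _ => zero_mem _, hf,
      Function.injective_of_subsingleton _, fun x => ⟨fun hx => ⟨0, ?_⟩, ?_⟩, f.surjective⟩
    · rw [map_zero]
      exact (f.map_eq_zero_iff.1 hx).symm
    · rintro ⟨y, rfl⟩
      simp
  rw [G0.cls_eq_add this, cls_eq_zero, zero_add]

variable (k Γ ν) in
/-- Isomorphism up to shift is an equivalence relation on simple modules. -/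
def shiftSetoid : Setoid {M : FMod k Γ ν // M.IsSimple} where
  r M M' := ∃ a : ℤ, Iso M.1 (M'.1.shift a)
  iseqv := by
    refine ⟨fun M => ⟨0, ?_⟩, ?_, ?_⟩
    · rw [shift_zero]
      exact ⟨LinearEquiv.refl _ _, fun _ _ h => h, fun _ _ h => h⟩
    · rintro M M' ⟨a, f, hf, hf'⟩
      refine ⟨-a, f.symm, fun n x hx => ?_, fun n x hx => ?_⟩
      · change f.symm x ∈ M.1.part (n - -a)
        refine hf' _ x ?_
        change x ∈ M'.1.part (n - -a - a)
        rwa [sub_neg_eq_add, add_sub_cancel_right]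
      · have : f x ∈ M'.1.part (n - -a - a) := hf _ x hx
        rwa [sub_neg_eq_add, add_sub_cancel_right] at this
    · rintro M M' M'' ⟨a, f, hf, hf'⟩ ⟨b, g, hg, hg'⟩
      refine ⟨a + b, f.trans g, fun n x hx => ?_, fun n x hx => ?_⟩
      · have : g (f x) ∈ M''.1.part (n - a - b) := hg _ _ (hf _ x hx)
        rwa [sub_sub] at this
      · refine hf' n _ (hg' (n - a) x ?_)
        change x ∈ M''.1.part (n - a - b)
        rwa [sub_sub]

/-- Representatives of the simple modules up to isomorphism and shift. -/
def simpleRep (b : Quotient (shiftSetoid k Γ ν)) : FMod k Γ ν := b.out.1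

/-- Induction on the dimension: a nonzero module that is not simple has a proper nonzero graded
submodule, and its class is the sum of two of smaller dimension. -/
lemma cls_mem_span (M : FMod k Γ ν) :
    G0.cls M ∈ Submodule.span ℤ[T;T⁻¹] (Set.range fun b => G0.cls (simpleRep (Γ := Γ) (ν := ν)
      (k := k) b)) := by
  induction hd : Module.finrank k M.carrier using Nat.strong_induction_on generalizing M with
  | _ d ih =>
  rcases subsingleton_or_nontrivial M.carrier with h | h
  · rw [cls_eq_zero]
    exact zero_mem _
  by_cases hs : M.IsSimple
  · obtain ⟨a, ha⟩ := (shiftSetoid k Γ ν).symm (Quotient.mk_out (s := shiftSetoid k Γ ν) ⟨M, hs⟩)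
    rw [ha.cls_eq, ← G0.T_smul_cls]
    exact Submodule.smul_mem _ _ (Submodule.subset_span ⟨_, rfl⟩)
  · obtain ⟨N, hN, hN0, hN1⟩ : ∃ N : Submodule (R k Γ ν) M.carrier, M.IsGradedSubmodule N ∧
        N ≠ ⊥ ∧ N ≠ ⊤ := by
      by_contra! hcon
      exact hs ⟨h, fun N hN => or_iff_not_imp_left.2 (hcon N hN)⟩
    have hq := Submodule.finrank_quotient_add_finrank (N.restrictScalars k)
    have h0 : 0 < Module.finrank k (N.restrictScalars k) := by
      refine Nat.pos_of_ne_zero fun h0 => hN0 ?_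
      rw [Submodule.finrank_eq_zero] at h0
      exact (Submodule.restrictScalars_eq_bot_iff k _ _).1 h0
    have h1 : Module.finrank k (N.restrictScalars k) < Module.finrank k M.carrier := by
      refine Submodule.finrank_lt fun h1 => hN1 ?_
      exact (Submodule.restrictScalars_eq_top_iff k _ _).1 h1
    rw [G0.cls_eq_add (shortExact_sub_quot N hN)]
    refine add_mem (ih _ (lt_of_lt_of_eq h1 hd) (sub N hN) rfl) (ih _ ?_ (quot N hN) rfl)
    change Module.finrank k (M.carrier ⧸ N.restrictScalars k) < d
    omega

lemma span_cls_simpleRep :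
    Submodule.span ℤ[T;T⁻¹] (Set.range fun b => G0.cls (simpleRep (Γ := Γ) (ν := ν)
      (k := k) b)) = ⊤ := by
  refine (Submodule.eq_top_iff').2 fun x => ?_
  obtain ⟨y, rfl⟩ := QuotientAddGroup.mk_surjective x
  induction y using FreeAbelianGroup.induction_on with
  | zero => exact zero_mem _
  | of M => exact cls_mem_span M
  | neg M h => exact neg_mem h
  | add y z hy hz => exact add_mem hy hz

variable (k Γ ν) in
-- A linear map that sends a generating family to a linearly independent one is injective.
theorem ch_injective : Function.Injective (ch k Γ ν) := by
  have hli := linearIndependent_char (k := k) (Γ := Γ) (ν := ν) simpleRep (fun b => b.out.2)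
    fun b c a h => by
      rw [← Quotient.out_eq b, ← Quotient.out_eq c]
      exact Quotient.sound ⟨a, h⟩
  rw [injective_iff_map_eq_zero]
  intro x hx
  have hxs : x ∈ Submodule.span ℤ[T;T⁻¹] (Set.range fun b => G0.cls (simpleRep (Γ := Γ) (ν := ν)
      (k := k) b)) := by
    rw [span_cls_simpleRep]
    exact Submodule.mem_top
  obtain ⟨c, rfl⟩ := (Finsupp.mem_span_range_iff_exists_finsupp).1 hxs
  have h0 : Finsupp.linearCombination ℤ[T;T⁻¹] (fun b => (simpleRep (k := k) (Γ := Γ) (ν := ν)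
      b).char) c = 0 := by
    rw [← hx, Finsupp.linearCombination_apply, map_finsuppSum]
    simp only [map_smul, ch_cls]
  rw [linearIndependent_iff.1 hli c h0]
  exact Finsupp.sum_zero_index

end FMod
end Modules
end KLR
end

theorem mainTheorem7 {k : Type u} [Field k] {I : Type v} (Γ : SimpleGraph I) (ν : I →₀ ℕ) :
    Function.Injective (KLR.ch k Γ ν) ∧
      ∀ {B : Type*} (S : B → KLR.FMod k Γ ν),
        (∀ b, (S b).IsSimple) →
        (∀ b c, ∀ a : ℤ, KLR.FMod.Iso (S b) ((S c).shift a) → b = c) →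
        LinearIndependent ℤ[T;T⁻¹] fun b => (S b).char :=
  ⟨KLR.FMod.ch_injective k Γ ν, fun S hS hS' => KLR.FMod.linearIndependent_char S hS hS'⟩
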